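/- **Setting.** Let $(M,g)$ be a smooth pseudo-Riemannian manifold of dimension $n$ with a spin structure (structure group $\mathrm{Spin}$ of elements $u$ with $u^{*}u=1$, i.e. $M$ is oriented, and time-oriented in indefinite signature). Let $\nabla$ be the Levi-Civita connection, and suppose that $M$ has constant curvature $k$: $R(X,Y)Z=k(g(Y,Z)X-g(X,Z)Y)$. Clifford multiplication is normalised by $X.X=g(X,X)$. Let $\{X_a\}$ be a local orthonormal frame with dual coframe $\{e^a\}$, $X^a=g(X_a,X_a)X_a$, and $e_a=\widetilde X_a$ the metric dual of $X_a$. Let $\mathbb K=\mathbb R$ or $\mathbb C$. Forms have coefficients in $\mathbb K$. The spinor space $S$ is a finite-dimensional $\mathbb K$-linear module over the real Clifford algebra (for example an irreducible one); the spinor bundle and its covariant derivative are induced by the spin structure and $\nabla$. Let $(\cdot,\cdot)$ be a spinor inner product on $S$: non-degenerate, linear in the second argument and $\sigma$-linear in the first, where $\sigma$ is the identity or complex conjugation, with $$(X.\psi,\varphi)=\varepsilon(\psi,X.\varphi),\qquad (\psi,\varphi)=s\,\sigma\big((\varphi,\psi)\big),\qquad \varepsilon,s\in\{1,-1\}.$$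 Fix $\lambda\in\mathbb K$. * A Killing–Yano (KY) $p$-form is a smooth $p$-form $\omega$ with $\nabla_X\omega=\frac1{p+1}i_Xd\omega$ for all $X$. Let $\bar{\mathfrak g}_0$ be the direct sum of the spaces of KY forms of odd degree. * A Killing spinor is a smooth spinor field with $\nabla_X\psi=\lambda\widetilde X.\psi$ for all $X$. Let $\bar{\mathfrak g}_1$ be the space of these. * For a $p$-form $\omega_1$ and a $q$-form $\omega_2$, $[\omega_1,\omega_2]_{SN}=i_{X^a}\omega_1\wedge\nabla_{X_a}\omega_2+(-1)^{pq}i_{X^a}\omega_2\wedge\nabla_{X_a}\omega_1$, extended bilinearly to sums. * For a $p$-form $\omega$, $L_\omega\psi=-(-1)^p\lambda p\,\omega.\psi+\frac{p}{2(p+1)}d\omega.\psi$, extended linearly to sums. * The $p$-form Dirac current is $(\psi\overline\varphi)_p=\sum_{a_1<\dots<a_p}(\psi,e_{a_p}.\cdots.e_{a_1}.\varphi)\,e^{a_1}\wedge\dots\wedge e^{a_p}$, and $\ast$ is the Hodge star. Let $q$ be odd and let $J:\bar{\mathfrak g}_1\times\bar{\mathfrak g}_1\to\{q\text{-forms}\}$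 be one of the following: * (A) $J(\psi,\varphi)=(\psi\overline\varphi)_p$ with $q=p$ odd, if $\varepsilon\,\sigma(\lambda)=-\lambda$; * (B) $J(\psi,\varphi)=\ast(\psi\overline\varphi)_p$ with $0\le p\le n$ and $q=n-p$ odd, if $\varepsilon\,\sigma(\lambda)=-(-1)^p\lambda$. Put $\kappa=s\,\varepsilon^p(-1)^{p(p-1)/2}$. **Theorem.** 1. $\bar{\mathfrak g}_0$ is a Lie algebra over $\mathbb K$ under $[\cdot,\cdot]_{SN}$: this bracket is bilinear and skew-symmetric on $\bar{\mathfrak g}_0$, takes values in $\bar{\mathfrak g}_0$, and satisfies the Jacobi identity. 2. $L_\omega\psi\in\bar{\mathfrak g}_1$ for all $\omega\in\bar{\mathfrak g}_0$ and $\psi\in\bar{\mathfrak g}_1$. 3. In each of the cases (A) and (B), $J(\psi,\varphi)$ is a KY $q$-form, hence in $\bar{\mathfrak g}_0$, for all $\psi,\varphi\in\bar{\mathfrak g}_1$. 4. In each of these cases $\bar{\mathfrak g}=\bar{\mathfrak g}_0\oplus\bar{\mathfrak g}_1$ is a superalgebra over $\mathbb R$ with the brackets $$[\omega,\omega']=[\omega,\omega']_{SN},\qquad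 [\omega,\psi]=-[\psi,\omega]=L_\omega\psi,\qquad [\psi,\varphi]=\tfrac12\big(J(\psi,\varphi)+J(\varphi,\psi)\big),$$ the last being the polarization of the squaring map $\psi\mapsto J(\psi,\psi)$. That is, the bracket is bilinear, $[\bar{\mathfrak g}_i,\bar{\mathfrak g}_j]\subseteq\bar{\mathfrak g}_{i+j}$ for indices mod 2, and $[a,b]=-(-1)^{|a||b|}[b,a]$ for homogeneous $a,b$. 5. If moreover $(\cdot,\cdot)$ is bilinear ($\sigma=\mathrm{id}$), then $J(\varphi,\psi)=\kappa J(\psi,\varphi)$ for all $\psi,\varphi\in\bar{\mathfrak g}_1$. If also $\kappa=1$, then $[\psi,\varphi]=J(\psi,\varphi)$, together with the other brackets above, makes $\bar{\mathfrak g}$ a superalgebra over $\mathbb K$. -/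

import Mathlib

open scoped ContDiff Manifold

noncomputable section

namespace SpinGeom

/-! ### Superalgebras -/

section Algebra

/-- `br` makes the submodule `g` a Lie algebra over `R`. -/
structure IsLieAlgebraOn (R : Type*) [CommRing R] {V : Type*} [AddCommGroup V] [Module R V]
    (g : Submodule R V) (br : V → V → V) : Prop where
  closed : ∀ a ∈ g, ∀ b ∈ g, br a b ∈ g
  add_left : ∀ a ∈ g, ∀ b ∈ g, ∀ c ∈ g, br (a + b) c = br a c + br b c
  add_right : ∀ a ∈ g, ∀ b ∈ g, ∀ c ∈ g, br a (b + c) = br a b + br a c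
  smul_left : ∀ (r : R), ∀ a ∈ g, ∀ b ∈ g, br (r • a) b = r • br a b
  smul_right : ∀ (r : R), ∀ a ∈ g, ∀ b ∈ g, br a (r • b) = r • br a b
  self : ∀ a ∈ g, br a a = 0
  skew : ∀ a ∈ g, ∀ b ∈ g, br a b = -br b a
  jacobi : ∀ a ∈ g, ∀ b ∈ g, ∀ c ∈ g, br a (br b c) + br b (br c a) + br c (br a b) = 0

/-- `br` makes `g₀ ⊕ g₁` a superalgebra over `R`: it is bilinear, it maps `g_i × g_j` to
`g_{i+j}` (indices mod 2), and `[a, b] = -(-1)^{|a||b|} [b, a]` for homogeneous `a`, `b`. -/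
structure IsSuperalgebra (R : Type*) [CommRing R] {V₀ V₁ : Type*}
    [AddCommGroup V₀] [Module R V₀] [AddCommGroup V₁] [Module R V₁]
    (g₀ : Submodule R V₀) (g₁ : Submodule R V₁)
    (br : V₀ × V₁ → V₀ × V₁ → V₀ × V₁) : Prop where
  add_left : ∀ a ∈ g₀.prod g₁, ∀ b ∈ g₀.prod g₁, ∀ c ∈ g₀.prod g₁,
    br (a + b) c = br a c + br b c
  add_right : ∀ a ∈ g₀.prod g₁, ∀ b ∈ g₀.prod g₁, ∀ c ∈ g₀.prod g₁,
    br a (b + c) = br a b + br a c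
  smul_left : ∀ (r : R), ∀ a ∈ g₀.prod g₁, ∀ b ∈ g₀.prod g₁, br (r • a) b = r • br a b
  smul_right : ∀ (r : R), ∀ a ∈ g₀.prod g₁, ∀ b ∈ g₀.prod g₁, br a (r • b) = r • br a b
  even_even : ∀ a ∈ g₀, ∀ b ∈ g₀, br (a, 0) (b, 0) ∈ g₀.prod ⊥
  even_odd : ∀ a ∈ g₀, ∀ b ∈ g₁, br (a, 0) (0, b) ∈ Submodule.prod ⊥ g₁
  odd_even : ∀ a ∈ g₁, ∀ b ∈ g₀, br (0, a) (b, 0) ∈ Submodule.prod ⊥ g₁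
  odd_odd : ∀ a ∈ g₁, ∀ b ∈ g₁, br (0, a) (0, b) ∈ g₀.prod ⊥
  skew_even_even : ∀ a ∈ g₀, ∀ b ∈ g₀, br (a, 0) (b, 0) = -br (b, 0) (a, 0)
  skew_even_odd : ∀ a ∈ g₀, ∀ b ∈ g₁, br (a, 0) (0, b) = -br (0, b) (a, 0)
  symm_odd_odd : ∀ a ∈ g₁, ∀ b ∈ g₁, br (0, a) (0, b) = br (0, b) (0, a)

end Algebra

/-! ### Clifford modules and spinor inner products -/

section Clifford

variable {n : ℕ}

/-- The sign `η a = ±1`, as an element of a ring. -/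
def sgn (R : Type*) [Ring R] (η : Fin n → ℤˣ) (a : Fin n) : R := ((η a : ℤ) : R)

/-- The quadratic form `∑ a, η a * v a ^ 2` of signature `η`. -/
def quadForm (R : Type*) [CommRing R] (η : Fin n → ℤˣ) : QuadraticForm R (Fin n → R) :=
  QuadraticMap.weightedSumSquares R (sgn R η)

variable {𝕜 : Type*} [RCLike 𝕜] {η : Fin n → ℤˣ}
  {S : Type*} [NormedAddCommGroup S] [NormedSpace ℝ S] [NormedSpace 𝕜 S] [IsScalarTower ℝ 𝕜 S]

/-- Clifford multiplication by the vector `e_a` of an orthonormal frame on the spinor space. -/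
def gam (ρ : CliffordAlgebra (quadForm ℝ η) →ₐ[ℝ] Module.End 𝕜 S) (a : Fin n) :
    Module.End 𝕜 S :=
  ρ (CliffordAlgebra.ι (quadForm ℝ η) (Pi.single a 1))

/-- Clifford multiplication by the element `e^a = η a • e_a` of the dual coframe. -/
def gamUp (ρ : CliffordAlgebra (quadForm ℝ η) →ₐ[ℝ] Module.End 𝕜 S) (a : Fin n) :
    Module.End 𝕜 S :=
  sgn 𝕜 η a • gam ρ a

/-- A spinor inner product on the spinor space: a non-degenerate pairing, bilinear (`σ = id`) or
sesquilinear (`σ` the conjugation), `σ`-symmetric or `σ`-antisymmetric, for which Clifford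
multiplication by vectors is self-adjoint or anti-self-adjoint; so the adjoint of Clifford
multiplication is given by one of the two (anti)automorphisms of the Clifford algebra
which reverse products and act as `ε` on vectors, combined with conjugation of
the scalars if `σ` is the conjugation. -/
structure SpinorInner (ρ : CliffordAlgebra (quadForm ℝ η) →ₐ[ℝ] Module.End 𝕜 S)
    (σ : 𝕜 →+* 𝕜) where
  form : S →ₛₗ[σ] S →ₗ[𝕜] 𝕜
  ε : ℤˣ
  s : ℤˣ
  conj_type : σ = RingHom.id 𝕜 ∨ σ = starRingEnd 𝕜
  adjoint : ∀ a ψ φ, form (gam ρ a ψ) φ = ((ε : ℤ) : 𝕜) * form ψ (gam ρ a φ)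
  symm : ∀ ψ φ, form ψ φ = ((s : ℤ) : 𝕜) * σ (form φ ψ)
  nondegenerate : ∀ ψ, (∀ φ, form ψ φ = 0) → ψ = 0

/-- Exterior algebra on the coframe `e^0, …, e^{n-1}`, with coefficients in `𝕜`. -/
abbrev Lam (𝕜 : Type*) [RCLike 𝕜] (n : ℕ) := ExteriorAlgebra 𝕜 (Fin n → 𝕜)

/-- The coframe element `e^a`. -/
def coE (a : Fin n) : Lam 𝕜 n := ExteriorAlgebra.ι 𝕜 (Pi.single a 1)

/-- The interior product with the frame vector `e_a`. -/
def contr (a : Fin n) : Lam 𝕜 n →ₗ[𝕜] Lam 𝕜 n :=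
  CliffordAlgebra.contractLeft (LinearMap.proj a)

/-- The basis of the exterior algebra consisting of the ordered products of the `e^a`. -/
def lamBasis (𝕜 : Type*) [RCLike 𝕜] (n : ℕ) : Module.Basis (Finset (Fin n)) 𝕜 (Lam 𝕜 n) :=
  (Pi.basisFun 𝕜 (Fin n)).ExteriorAlgebra

/-- The volume form `e^0 ∧ ⋯ ∧ e^{n-1}`. -/
def vol : Lam 𝕜 n := ((List.finRange n).map coE).prod

/-- The interior product with the vector which is the metric dual of a covector. -/
def contrSharp (η : Fin n → ℤˣ) : (Fin n → 𝕜) →ₗ[𝕜] Module.End 𝕜 (Lam 𝕜 n) :=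
  ∑ a, (LinearMap.proj a : (Fin n → 𝕜) →ₗ[𝕜] 𝕜).smulRight
    (sgn 𝕜 η a • (contr a : Module.End 𝕜 (Lam 𝕜 n)))

lemma contrSharp_eq (v : Fin n → 𝕜) : contrSharp η v =
    CliffordAlgebra.contractLeft
      (∑ a, (v a * sgn 𝕜 η a) • (LinearMap.proj a : (Fin n → 𝕜) →ₗ[𝕜] 𝕜)) := by
  refine LinearMap.ext fun x => ?_
  simp [contrSharp, contr, LinearMap.sum_apply, smul_smul]

lemma contrSharp_sq (v : Fin n → 𝕜) : contrSharp η v * contrSharp η v = 0 := by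
  refine LinearMap.ext fun x => ?_
  rw [contrSharp_eq]
  exact CliffordAlgebra.contractLeft_contractLeft _ x

/-- The Hodge star: `⋆(α¹ ∧ ⋯ ∧ αᵖ)` is the volume form contracted successively with the
metric duals of `α¹`, …, `αᵖ`, so that `α ∧ ⋆β = ⟨α, β⟩ vol` for forms of equal degree. -/
def hodge (η : Fin n → ℤˣ) : Lam 𝕜 n →ₗ[𝕜] Lam 𝕜 n where
  toFun F := ExteriorAlgebra.lift 𝕜 ⟨contrSharp η, contrSharp_sq⟩ (CliffordAlgebra.reverse F) vol
  map_add' F G := by simp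
  map_smul' c F := by simp

lemma gam_anticomm (ρ : CliffordAlgebra (quadForm ℝ η) →ₐ[ℝ] Module.End 𝕜 S) (a b : Fin n) :
    gam ρ a * gam ρ b + gam ρ b * gam ρ a = if a = b then (2 * sgn 𝕜 η a) • 1 else 0 := by
  have h := CliffordAlgebra.ι_mul_ι_add_swap (Q := quadForm ℝ η) (Pi.single a 1) (Pi.single b 1)
  have h2 := congrArg ρ h
  rw [map_add, map_mul, map_mul, AlgHom.commutes] at h2
  unfold gam
  rw [h2]
  have h3 : QuadraticMap.polar (quadForm ℝ η) (Pi.single a 1) (Pi.single b 1)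
      = if a = b then 2 * sgn ℝ η a else 0 := by
    unfold QuadraticMap.polar quadForm
    simp only [QuadraticMap.weightedSumSquares_apply, Pi.add_apply, smul_eq_mul]
    rw [← Finset.sum_sub_distrib, ← Finset.sum_sub_distrib]
    split_ifs with hab
    · subst hab
      rw [Finset.sum_eq_single a]
      · simp; ring
      · intro c _ hc; simp [hc]
      · simp
    · apply Finset.sum_eq_zero
      intro c _
      by_cases hca : c = a
      · subst hca; simp [hab]
      · simp [hca]
  rw [h3]
  split_ifs with hab
  · ext1 x
    simp only [Module.algebraMap_end_apply, LinearMap.smul_apply, Module.End.one_apply]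
    rw [← algebraMap_smul 𝕜 (2 * sgn ℝ η a) x]
    simp only [sgn, map_mul, map_ofNat, map_intCast]
  · simp

/-- Clifford multiplication by covectors with coefficients in `𝕜`. -/
def gamLin (ρ : CliffordAlgebra (quadForm ℝ η) →ₐ[ℝ] Module.End 𝕜 S) :
    (Fin n → 𝕜) →ₗ[𝕜] Module.End 𝕜 S :=
  ∑ a, (LinearMap.proj a : (Fin n → 𝕜) →ₗ[𝕜] 𝕜).smulRight (gamUp ρ a)

lemma gamLin_sq (ρ : CliffordAlgebra (quadForm ℝ η) →ₐ[ℝ] Module.End 𝕜 S) (v : Fin n → 𝕜) :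
    gamLin ρ v * gamLin ρ v = algebraMap 𝕜 _ (quadForm 𝕜 η v) := by
  have hs : ∀ a, sgn 𝕜 η a * sgn 𝕜 η a = 1 := fun a => by
    unfold sgn; rw [← Int.cast_mul, Int.units_coe_mul_self, Int.cast_one]
  have e1 : gamLin ρ v * gamLin ρ v
      = ∑ a, ∑ b, (v a * sgn 𝕜 η a * (v b * sgn 𝕜 η b)) • (gam ρ a * gam ρ b) := by
    simp only [gamLin, gamUp, LinearMap.sum_apply, LinearMap.smulRight_apply,
      LinearMap.proj_apply, Finset.sum_mul_sum, smul_smul, smul_mul_smul_comm]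
  have e2 : (2 : 𝕜) • (gamLin ρ v * gamLin ρ v)
      = ∑ a, ∑ b, (v a * sgn 𝕜 η a * (v b * sgn 𝕜 η b)) •
        (gam ρ a * gam ρ b + gam ρ b * gam ρ a) := by
    simp only [smul_add, Finset.sum_add_distrib]
    rw [two_smul, ← e1, Finset.sum_comm (f := fun a b => _ • (gam ρ b * gam ρ a)), e1]
    congr 1
    refine Finset.sum_congr rfl fun a _ => Finset.sum_congr rfl fun b _ => ?_
    rw [mul_comm (v b * _)]
  have e3 : (2 : 𝕜) • (gamLin ρ v * gamLin ρ v)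
      = (2 : 𝕜) • algebraMap 𝕜 (Module.End 𝕜 S) (quadForm 𝕜 η v) := by
    rw [e2]
    simp only [gam_anticomm, smul_ite, smul_zero, Finset.sum_ite_eq, Finset.mem_univ, if_true,
      smul_smul, ← Finset.sum_smul, Algebra.algebraMap_eq_smul_one]
    congr 1
    simp only [quadForm, QuadraticMap.weightedSumSquares_apply, smul_eq_mul, Finset.mul_sum]
    refine Finset.sum_congr rfl fun a _ => ?_
    linear_combination (2 * v a * v a * sgn 𝕜 η a) * hs a
  exact smul_right_injective _ (two_ne_zero : (2 : 𝕜) ≠ 0) e3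

/-- The Clifford action `θ.ψ` of forms on spinors: the product `e^{a₁} ∧ ⋯ ∧ e^{aₚ}` of distinct
coframe elements acts as the Clifford product `e^{a₁}. ⋯ .e^{aₚ}`. -/
def cliff (ρ : CliffordAlgebra (quadForm ℝ η) →ₐ[ℝ] Module.End 𝕜 S) :
    Lam 𝕜 n →ₗ[𝕜] Module.End 𝕜 S :=
  letI : Invertible (2 : 𝕜) := invertibleOfNonzero two_ne_zero
  (CliffordAlgebra.lift (quadForm 𝕜 η) ⟨gamLin ρ, gamLin_sq ρ⟩).toLinearMap ∘ₗ
    (CliffordAlgebra.equivExterior (quadForm 𝕜 η)).symm.toLinearMap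

/-- The components of the `p`-form Dirac current:
`∑_{a₁ < ⋯ < aₚ} (ψ, e_{aₚ}. ⋯ .e_{a₁}.φ) e^{a₁} ∧ ⋯ ∧ e^{aₚ}`. -/
def currentLam {ρ : CliffordAlgebra (quadForm ℝ η) →ₐ[ℝ] Module.End 𝕜 S} {σ : 𝕜 →+* 𝕜}
    (B : SpinorInner ρ σ) (p : ℕ) (ψ φ : S) : Lam 𝕜 n :=
  ∑ A ∈ Finset.powersetCard p (Finset.univ : Finset (Fin n)),
    B.form ψ (((A.sort (· ≥ ·)).map (gam ρ)).prod φ) • ((A.sort (· ≤ ·)).map coE).prod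

/-- The sign by which `(ψ, e_{aₚ}. ⋯ .e_{a₁}.φ)` changes when `ψ` and `φ` are exchanged. -/
def SpinorInner.exchangeSign {ρ : CliffordAlgebra (quadForm ℝ η) →ₐ[ℝ] Module.End 𝕜 S}
    {σ : 𝕜 →+* 𝕜} (B : SpinorInner ρ σ) (p : ℕ) : ℤˣ :=
  B.s * B.ε ^ p * (-1) ^ (p * (p - 1) / 2)

end Clifford

/-! ### Metrics and spin structures -/

section Geometry

variable {n : ℕ} {M : Type*} [TopologicalSpace M]
  [ChartedSpace (EuclideanSpace ℝ (Fin n)) M] [IsManifold (𝓡 n) ∞ M]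

variable (n M) in
/-- A smooth pseudo-Riemannian metric on `M`. -/
structure PseudoMetric where
  val (x : M) : TangentSpace (𝓡 n) x →L[ℝ] TangentSpace (𝓡 n) x →L[ℝ] ℝ
  symm (x : M) (v w : TangentSpace (𝓡 n) x) : val x v w = val x w v
  nondegenerate (x : M) (v : TangentSpace (𝓡 n) x) : (∀ w, val x v w = 0) → v = 0
  contMDiff : ContMDiff (𝓡 n)
    ((𝓡 n).prod 𝓘(ℝ, EuclideanSpace ℝ (Fin n) →L[ℝ] EuclideanSpace ℝ (Fin n) →L[ℝ] ℝ)) ∞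
    (fun x ↦ Bundle.TotalSpace.mk'
      (EuclideanSpace ℝ (Fin n) →L[ℝ] EuclideanSpace ℝ (Fin n) →L[ℝ] ℝ)
      (E := fun x : M ↦ TangentSpace (𝓡 n) x →L[ℝ] TangentSpace (𝓡 n) x →L[ℝ] ℝ) x (val x))

/-- A spin structure for the metric `g` of signature `η`, given by an open cover with smooth
orthonormal frames and smooth spin-group-valued transition functions, satisfying the cocycle
condition, which cover the transition functions of the frames under the double cover
`Spin → SO`, `u ↦ (v ↦ u v u⁻¹)`. -/
structure SpinStructure (η : Fin n → ℤˣ) (g : PseudoMetric n M) (ι : Type*) where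
  U : ι → Set M
  isOpen (i : ι) : IsOpen (U i)
  /-- a choice of a member of the cover at each point -/
  idx : M → ι
  mem_idx (x : M) : x ∈ U (idx x)
  frame (i : ι) (a : Fin n) (x : M) : TangentSpace (𝓡 n) x
  frame_smooth (i : ι) (a : Fin n) : ContMDiffOn (𝓡 n) (𝓡 n).tangent ∞
    (fun x ↦ (⟨x, frame i a x⟩ : TangentBundle (𝓡 n) M)) (U i)
  orthonormal (i : ι) : ∀ x ∈ U i, ∀ a b,
    g.val x (frame i a x) (frame i b x) = if a = b then sgn ℝ η a else 0
  trans (i j : ι) (x : M) : CliffordAlgebra (quadForm ℝ η)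
  trans_mem (i j : ι) : ∀ x ∈ U i ∩ U j, trans i j x ∈ spinGroup (quadForm ℝ η)
  trans_smooth (i j : ι) (l : Module.Dual ℝ (CliffordAlgebra (quadForm ℝ η))) :
    ContMDiffOn (𝓡 n) 𝓘(ℝ, ℝ) ∞ (fun x ↦ l (trans i j x)) (U i ∩ U j)
  cocycle (i j k : ι) : ∀ x ∈ U i ∩ U j ∩ U k, trans i j x * trans j k x = trans i k x
  covers (i j : ι) : ∀ x ∈ U i ∩ U j, ∀ v w : Fin n → ℝ,
    ∑ a, v a • frame i a x = ∑ a, w a • frame j a x →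
    CliffordAlgebra.ι (quadForm ℝ η) v * trans i j x
      = trans i j x * CliffordAlgebra.ι (quadForm ℝ η) w

variable {η : Fin n → ℤˣ} {g : PseudoMetric n M} {ι : Type*}

/-! ### The Levi-Civita connection and its curvature in the orthonormal frames -/

namespace SpinStructure

variable (P : SpinStructure η g ι)

/-- The structure functions `g([e_a, e_b], e_c)`. -/
def bracketCoeff (i : ι) (a b c : Fin n) (x : M) : ℝ :=
  g.val x (VectorField.mlieBracket (𝓡 n) (P.frame i a) (P.frame i b) x) (P.frame i c x)

/-- The Levi-Civita connection, `g(∇_{e_a} e_b, e_c)`, by the Koszul formula. -/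
def connCoeff (i : ι) (a b c : Fin n) (x : M) : ℝ :=
  (P.bracketCoeff i a b c x - P.bracketCoeff i b c a x + P.bracketCoeff i c a b x) / 2

/-- The coefficient of `e_c` in `[e_a, e_b]`. -/
def bracketUp (i : ι) (a b c : Fin n) (x : M) : ℝ := sgn ℝ η c * P.bracketCoeff i a b c x

/-- The coefficient of `e_c` in `∇_{e_a} e_b`. -/
def connUp (i : ι) (a b c : Fin n) (x : M) : ℝ := sgn ℝ η c * P.connCoeff i a b c x

/-- The derivative of the function `f` along the frame vector `e_a`. -/
def dirDeriv {W : Type*} [NormedAddCommGroup W] [NormedSpace ℝ W] (i : ι) (a : Fin n)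
    (f : M → W) (x : M) : W :=
  (mfderiv (𝓡 n) 𝓘(ℝ, W) f x (P.frame i a x) : W)

/-- The coefficient of `e_d` in
`R(e_a, e_b) e_c = ∇_{e_a} ∇_{e_b} e_c - ∇_{e_b} ∇_{e_a} e_c - ∇_{[e_a, e_b]} e_c`. -/
def riem (i : ι) (a b c d : Fin n) (x : M) : ℝ :=
  P.dirDeriv i a (P.connUp i b c d) x - P.dirDeriv i b (P.connUp i a c d) x
    + ∑ f, (P.connUp i b c f x * P.connUp i a f d x - P.connUp i a c f x * P.connUp i b f d x)
    - ∑ f, P.bracketUp i a b f x * P.connUp i f c d x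

/-- Constant curvature `k`: `R(X, Y) Z = k (g(Y, Z) X - g(X, Z) Y)`. -/
def HasConstantCurvature (k : ℝ) : Prop :=
  ∀ i, ∀ x ∈ P.U i, ∀ a b c d, P.riem i a b c d x =
    k * ((if b = c then sgn ℝ η b else 0) * (if a = d then 1 else 0)
      - (if a = c then sgn ℝ η a else 0) * (if b = d then 1 else 0))

end SpinStructure

/-! ### Differential forms -/

variable (n M) in
/-- Fields of (inhomogeneous) exterior forms on `M` with coefficients in `𝕜`. -/
abbrev FormField (𝕜 : Type*) [RCLike 𝕜] :=
  (x : M) → ExteriorAlgebra 𝕜 (TangentSpace (𝓡 n) x →L[ℝ] 𝕜)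

namespace SpinStructure

variable {𝕜 : Type*} [RCLike 𝕜] (P : SpinStructure η g ι)

/-- The components of a covector in the frame `i`. -/
def frameEval (i : ι) (x : M) : (TangentSpace (𝓡 n) x →L[ℝ] 𝕜) →ₗ[𝕜] (Fin n → 𝕜) where
  toFun α a := α (P.frame i a x)
  map_add' _ _ := rfl
  map_smul' _ _ := rfl

/-- The covector with given components in the frame `i`; the dual coframe is
`e^a = η a • g(e_a, ·)`. -/
def coframeComb (i : ι) (x : M) : (Fin n → 𝕜) →ₗ[𝕜] (TangentSpace (𝓡 n) x →L[ℝ] 𝕜) :=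
  ∑ a, (LinearMap.proj a : (Fin n → 𝕜) →ₗ[𝕜] 𝕜).smulRight
    (sgn 𝕜 η a • (RCLike.ofRealCLM (K := 𝕜)).comp (g.val x (P.frame i a x)))

/-- A form field in the frame `i`. -/
def toFrame (i : ι) (θ : FormField n M 𝕜) (x : M) : Lam 𝕜 n :=
  ExteriorAlgebra.map (P.frameEval i x) (θ x)

/-- The form at `x` with a given expression in the frame `i`. -/
def ofFrame (i : ι) (x : M) (F : Lam 𝕜 n) : ExteriorAlgebra 𝕜 (TangentSpace (𝓡 n) x →L[ℝ] 𝕜) :=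
  ExteriorAlgebra.map (P.coframeComb i x) F

/-- Componentwise derivative along `e_a` of a form written in the coframe. -/
def lamDeriv (i : ι) (a : Fin n) (F : M → Lam 𝕜 n) (x : M) : Lam 𝕜 n :=
  ∑ A, P.dirDeriv i a (fun y ↦ (lamBasis 𝕜 n).repr (F y) A) x • lamBasis 𝕜 n A

/-- The covariant derivative `∇_{e_a}` of forms, with `∇_{e_a} e^c = - ∑_b Γ_{ab}^c e^b`. -/
def covForm (i : ι) (a : Fin n) (F : M → Lam 𝕜 n) (x : M) : Lam 𝕜 n :=
  P.lamDeriv i a F x - ∑ b, ∑ c, (P.connUp i a b c x : 𝕜) • (coE b * contr c (F x))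

/-- The exterior derivative, by the structure equations
`d(f e^A) = ∑_a e_a(f) e^a ∧ e^A + f d(e^A)` and `d e^c = - 1/2 ∑_{a,b} C_{ab}^c e^a ∧ e^b`
where `[e_a, e_b] = ∑_c C_{ab}^c e_c`. -/
def extD (i : ι) (F : M → Lam 𝕜 n) (x : M) : Lam 𝕜 n :=
  ∑ a, coE a * P.lamDeriv i a F x
    - (1 / 2 : 𝕜) • ∑ a, ∑ b, ∑ c, (P.bracketUp i a b c x : 𝕜) • (coE a * coE b * contr c (F x))

/-- Smoothness of a form field. -/
def SmoothForm (θ : FormField n M 𝕜) : Prop :=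
  ∀ i A, ContMDiffOn (𝓡 n) 𝓘(ℝ, 𝕜) ∞ (fun x ↦ (lamBasis 𝕜 n).repr (P.toFrame i θ x) A) (P.U i)

/-- Killing-Yano `p`-forms: `∇_X θ = 1/(p+1) i_X dθ`. -/
structure IsKY (p : ℕ) (θ : FormField n M 𝕜) : Prop where
  degree : ∀ x, θ x ∈ ⋀[𝕜]^p (TangentSpace (𝓡 n) x →L[ℝ] 𝕜)
  smooth : P.SmoothForm θ
  eqn : ∀ i, ∀ x ∈ P.U i, ∀ a, P.covForm i a (P.toFrame i θ) x
    = (1 / ((p : 𝕜) + 1)) • contr a (P.extD i (P.toFrame i θ) x)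

/-- The Schouten-Nijenhuis bracket of a `p`-form and a `q`-form:
`i_{X^a} θ₁ ∧ ∇_{X_a} θ₂ + (-1)^{pq} i_{X^a} θ₂ ∧ ∇_{X_a} θ₁`. -/
def snBracket (p q : ℕ) (θ₁ θ₂ : FormField n M 𝕜) : FormField n M 𝕜 := fun x ↦
  P.ofFrame (P.idx x) x (∑ a, sgn 𝕜 η a •
    (contr a (P.toFrame (P.idx x) θ₁ x) * P.covForm (P.idx x) a (P.toFrame (P.idx x) θ₂) x
      + (-1 : 𝕜) ^ (p * q) •
        (contr a (P.toFrame (P.idx x) θ₂ x) * P.covForm (P.idx x) a (P.toFrame (P.idx x) θ₁) x)))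

/-- The Hodge star of a form field. -/
def star (θ : FormField n M 𝕜) : FormField n M 𝕜 := fun x ↦
  P.ofFrame (P.idx x) x (hodge η (P.toFrame (P.idx x) θ x))

/-! ### Spinor fields -/

variable {S : Type*} [NormedAddCommGroup S] [NormedSpace ℝ S] [NormedSpace 𝕜 S]
  [IsScalarTower ℝ 𝕜 S]
  (ρ : CliffordAlgebra (quadForm ℝ η) →ₐ[ℝ] Module.End 𝕜 S)

/-- Sections of the spinor bundle are given by functions `ψ : M → S`, where `ψ x` is the value
in the local trivialization with index `P.idx x`; this is the section in the trivialization `i`. -/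
def spinorIn (i : ι) (ψ : M → S) (x : M) : S := ρ (P.trans i (P.idx x) x) (ψ x)

/-- The spinor covariant derivative
`∇_{e_a} ψ = e_a(ψ) - 1/4 ∑_{b,c} g(∇_{e_a} e_b, e_c) e^b.e^c.ψ`. -/
def covSpinor (i : ι) (a : Fin n) (ψ : M → S) (x : M) : S :=
  P.dirDeriv i a ψ x
    - (1 / 4 : 𝕜) • ∑ b, ∑ c, (P.connCoeff i a b c x : 𝕜) • gamUp ρ b (gamUp ρ c (ψ x))

/-- Killing spinors with Killing number `lam`: `∇_X ψ = lam X̃.ψ`. -/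
structure IsKillingSpinor (lam : 𝕜) (ψ : M → S) : Prop where
  smooth : ∀ i, ContMDiffOn (𝓡 n) 𝓘(ℝ, S) ∞ (P.spinorIn ρ i ψ) (P.U i)
  eqn : ∀ i, ∀ x ∈ P.U i, ∀ a, P.covSpinor ρ i a (P.spinorIn ρ i ψ) x
    = lam • gam ρ a (P.spinorIn ρ i ψ x)

/-- The symmetry operator of a KY `p`-form `θ`,
`L_θ ψ = -(-1)^p lam p θ.ψ + p/(2(p+1)) dθ.ψ`. -/
def symOp (lam : 𝕜) (p : ℕ) (θ : FormField n M 𝕜) (ψ : M → S) : M → S := fun x ↦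
  (-(-1 : 𝕜) ^ p * lam * p) • cliff ρ (P.toFrame (P.idx x) θ x) (ψ x)
    + ((p : 𝕜) / (2 * (p + 1))) • cliff ρ (P.extD (P.idx x) (P.toFrame (P.idx x) θ) x) (ψ x)

/-- The `p`-form Dirac current `(ψ φ̄)_p`. -/
def diracCurrent {ρ : CliffordAlgebra (quadForm ℝ η) →ₐ[ℝ] Module.End 𝕜 S} {σ : 𝕜 →+* 𝕜}
    (B : SpinorInner ρ σ) (p : ℕ) (ψ φ : M → S) : FormField n M 𝕜 := fun x ↦
  P.ofFrame (P.idx x) x (currentLam B p (ψ x) (φ x))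

/-! ### The spaces of KY forms and of Killing spinors -/

lemma dirDeriv_add {W : Type*} [NormedAddCommGroup W] [NormedSpace ℝ W] (i : ι) (a : Fin n)
    {f h : M → W} {x : M} (hx : x ∈ P.U i) (hf : ContMDiffOn (𝓡 n) 𝓘(ℝ, W) ∞ f (P.U i))
    (hh : ContMDiffOn (𝓡 n) 𝓘(ℝ, W) ∞ h (P.U i)) :
    P.dirDeriv i a (f + h) x = P.dirDeriv i a f x + P.dirDeriv i a h x := by
  have hf' := (hf.contMDiffAt ((P.isOpen i).mem_nhds hx)).mdifferentiableAt (by simp)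
  have hh' := (hh.contMDiffAt ((P.isOpen i).mem_nhds hx)).mdifferentiableAt (by simp)
  unfold dirDeriv
  rw [mfderiv_add hf' hh']
  rfl

lemma dirDeriv_smul {W : Type*} [NormedAddCommGroup W] [NormedSpace ℝ W] [NormedSpace 𝕜 W]
    [IsScalarTower ℝ 𝕜 W] (i : ι) (a : Fin n) (c : 𝕜)
    {f : M → W} {x : M} (hx : x ∈ P.U i) (hf : ContMDiffOn (𝓡 n) 𝓘(ℝ, W) ∞ f (P.U i)) :
    P.dirDeriv i a (c • f) x = c • P.dirDeriv i a f x := by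
  have hf' := (hf.contMDiffAt ((P.isOpen i).mem_nhds hx)).mdifferentiableAt (by simp)
  have h2 : HasMFDerivAt (𝓡 n) 𝓘(ℝ, W) (c • f) x
      (((c • ContinuousLinearMap.id 𝕜 W).restrictScalars ℝ).comp
        (mfderiv (𝓡 n) 𝓘(ℝ, W) f x)) :=
    HasMFDerivAt.comp (I' := 𝓘(ℝ, W)) (g := (c • ContinuousLinearMap.id 𝕜 W).restrictScalars ℝ) x
      (((c • ContinuousLinearMap.id 𝕜 W).restrictScalars ℝ).hasMFDerivAt (x := f x))
      hf'.hasMFDerivAt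
  unfold dirDeriv
  rw [h2.mfderiv]
  rfl

lemma contMDiffOn_smul {W : Type*} [NormedAddCommGroup W] [NormedSpace ℝ W] [NormedSpace 𝕜 W]
    [IsScalarTower ℝ 𝕜 W] (c : 𝕜) {f : M → W} {s : Set M}
    (hf : ContMDiffOn (𝓡 n) 𝓘(ℝ, W) ∞ f s) : ContMDiffOn (𝓡 n) 𝓘(ℝ, W) ∞ (c • f) s :=
  ((c • ContinuousLinearMap.id 𝕜 W).restrictScalars ℝ).contMDiff.comp_contMDiffOn hf

lemma toFrame_add (i : ι) (θ θ' : FormField n M 𝕜) :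
    P.toFrame i (θ + θ') = P.toFrame i θ + P.toFrame i θ' := by
  funext x; simp [toFrame]

lemma toFrame_smul (i : ι) (c : 𝕜) (θ : FormField n M 𝕜) :
    P.toFrame i (c • θ) = c • P.toFrame i θ := by
  funext x; simp [toFrame]

lemma SmoothForm.add {θ θ' : FormField n M 𝕜} (h : P.SmoothForm θ) (h' : P.SmoothForm θ') :
    P.SmoothForm (θ + θ') := fun i A => by
  refine ((h i A).add (h' i A)).congr fun x _ => ?_
  simp [toFrame_add]

lemma SmoothForm.smul {θ : FormField n M 𝕜} (h : P.SmoothForm θ) (c : 𝕜) :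
    P.SmoothForm (c • θ) := fun i A => by
  refine (contMDiffOn_smul c (h i A)).congr fun x _ => ?_
  simp [toFrame_smul]

lemma lamDeriv_add {θ θ' : FormField n M 𝕜} (h : P.SmoothForm θ) (h' : P.SmoothForm θ')
    (i : ι) (a : Fin n) {x : M} (hx : x ∈ P.U i) :
    P.lamDeriv i a (P.toFrame i θ + P.toFrame i θ') x
      = P.lamDeriv i a (P.toFrame i θ) x + P.lamDeriv i a (P.toFrame i θ') x := by
  unfold lamDeriv
  rw [← Finset.sum_add_distrib]
  refine Finset.sum_congr rfl fun A _ => ?_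
  rw [← add_smul, ← P.dirDeriv_add i a hx (h i A) (h' i A)]
  congr 2
  funext y; simp

lemma lamDeriv_smul {θ : FormField n M 𝕜} (h : P.SmoothForm θ) (c : 𝕜)
    (i : ι) (a : Fin n) {x : M} (hx : x ∈ P.U i) :
    P.lamDeriv i a (c • P.toFrame i θ) x = c • P.lamDeriv i a (P.toFrame i θ) x := by
  unfold lamDeriv
  rw [Finset.smul_sum]
  refine Finset.sum_congr rfl fun A _ => ?_
  rw [smul_smul, ← smul_eq_mul, ← P.dirDeriv_smul i a c hx (h i A)]
  congr 2
  funext y; simp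

lemma covForm_add {θ θ' : FormField n M 𝕜} (h : P.SmoothForm θ) (h' : P.SmoothForm θ')
    (i : ι) (a : Fin n) {x : M} (hx : x ∈ P.U i) :
    P.covForm i a (P.toFrame i (θ + θ')) x
      = P.covForm i a (P.toFrame i θ) x + P.covForm i a (P.toFrame i θ') x := by
  unfold covForm
  rw [toFrame_add, P.lamDeriv_add h h' i a hx]
  simp only [Pi.add_apply, map_add, mul_add, smul_add, Finset.sum_add_distrib]
  abel

lemma covForm_smul {θ : FormField n M 𝕜} (h : P.SmoothForm θ) (c : 𝕜)
    (i : ι) (a : Fin n) {x : M} (hx : x ∈ P.U i) :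
    P.covForm i a (P.toFrame i (c • θ)) x = c • P.covForm i a (P.toFrame i θ) x := by
  unfold covForm
  rw [toFrame_smul, P.lamDeriv_smul h c i a hx]
  simp only [Pi.smul_apply, map_smul, mul_smul_comm, smul_sub, Finset.smul_sum, smul_comm c]

lemma extD_add {θ θ' : FormField n M 𝕜} (h : P.SmoothForm θ) (h' : P.SmoothForm θ')
    (i : ι) {x : M} (hx : x ∈ P.U i) :
    P.extD i (P.toFrame i (θ + θ')) x
      = P.extD i (P.toFrame i θ) x + P.extD i (P.toFrame i θ') x := by
  unfold extD
  simp only [toFrame_add, P.lamDeriv_add h h' i _ hx, Pi.add_apply, map_add, mul_add, smul_add,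
    Finset.sum_add_distrib]
  abel

lemma extD_smul {θ : FormField n M 𝕜} (h : P.SmoothForm θ) (c : 𝕜) (i : ι) {x : M}
    (hx : x ∈ P.U i) :
    P.extD i (P.toFrame i (c • θ)) x = c • P.extD i (P.toFrame i θ) x := by
  unfold extD
  simp only [toFrame_smul, P.lamDeriv_smul h c i _ hx, Pi.smul_apply, map_smul, mul_smul_comm,
    smul_sub, Finset.smul_sum, smul_comm c]

lemma lamDeriv_zero (i : ι) (a : Fin n) (x : M) :
    P.lamDeriv i a (fun _ => (0 : Lam 𝕜 n)) x = 0 := by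
  refine Finset.sum_eq_zero fun A _ => ?_
  have : P.dirDeriv i a (fun _ : M => ((lamBasis 𝕜 n).repr 0) A) x = 0 := by
    unfold dirDeriv; rw [mfderiv_const]; rfl
  rw [this, zero_smul]

lemma isKY_zero (p : ℕ) : P.IsKY p (0 : FormField n M 𝕜) := by
  have h0 : ∀ i, P.toFrame i (0 : FormField n M 𝕜) = fun _ => 0 := fun i => by
    funext x; simp [toFrame]
  refine ⟨fun x => Submodule.zero_mem _, fun i A => ?_, fun i x hx a => ?_⟩
  · simp only [h0, map_zero, Finsupp.coe_zero, Pi.zero_apply]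
    exact contMDiffOn_const
  · simp [covForm, extD, h0, lamDeriv_zero]

variable (𝕜) in
/-- The space of KY `p`-forms with coefficients in `𝕜`. -/
def KY (p : ℕ) : Submodule 𝕜 (FormField n M 𝕜) where
  carrier := {θ | P.IsKY p θ}
  zero_mem' := P.isKY_zero p
  add_mem' {θ θ'} h h' := ⟨fun x => Submodule.add_mem _ (h.degree x) (h'.degree x),
    SmoothForm.add P h.smooth h'.smooth, fun i x hx a => by
      rw [P.covForm_add h.smooth h'.smooth i a hx, P.extD_add h.smooth h'.smooth i hx,
        h.eqn i x hx a, h'.eqn i x hx a, map_add, smul_add]⟩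
  smul_mem' c θ h := ⟨fun x => Submodule.smul_mem _ c (h.degree x),
    SmoothForm.smul P h.smooth c, fun i x hx a => by
      rw [P.covForm_smul h.smooth c i a hx, P.extD_smul h.smooth c i hx,
        h.eqn i x hx a, map_smul, smul_comm c]⟩

variable (𝕜) in
/-- The even part: the direct sum of the spaces of KY forms of odd degree; `θ p` is the component
of degree `p` of `θ` (it vanishes for `p > n`). -/
def evenPart : Submodule 𝕜 (ℕ → FormField n M 𝕜) where
  carrier := {θ | ∀ p, (Odd p → θ p ∈ P.KY 𝕜 p) ∧ (¬ Odd p → θ p = 0)}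
  zero_mem' p := ⟨fun _ => Submodule.zero_mem _, fun _ => rfl⟩
  add_mem' {θ θ'} h h' p := ⟨fun hp => Submodule.add_mem _ ((h p).1 hp) ((h' p).1 hp),
    fun hp => by simp [(h p).2 hp, (h' p).2 hp]⟩
  smul_mem' c θ h p := ⟨fun hp => Submodule.smul_mem _ c ((h p).1 hp),
    fun hp => by simp [(h p).2 hp]⟩

lemma spinorIn_add (i : ι) (ψ φ : M → S) :
    P.spinorIn ρ i (ψ + φ) = P.spinorIn ρ i ψ + P.spinorIn ρ i φ := by
  funext x; simp [spinorIn]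

lemma spinorIn_smul (i : ι) (c : 𝕜) (ψ : M → S) :
    P.spinorIn ρ i (c • ψ) = c • P.spinorIn ρ i ψ := by
  funext x; simp [spinorIn]

/-- The odd part: the space of Killing spinors with Killing number `lam`. -/
def oddPart (lam : 𝕜) : Submodule 𝕜 (M → S) where
  carrier := {ψ | P.IsKillingSpinor ρ lam ψ}
  zero_mem' := by
    have h0 : ∀ i, P.spinorIn ρ i (0 : M → S) = fun _ => 0 := fun i => by
      funext x; simp [spinorIn]
    refine ⟨fun i => ?_, fun i x hx a => ?_⟩
    · rw [h0]; exact contMDiffOn_const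
    · have : P.dirDeriv i a (fun _ : M => (0 : S)) x = 0 := by
        unfold dirDeriv; rw [mfderiv_const]; rfl
      simp [covSpinor, h0, this]
  add_mem' {ψ φ} h h' := by
    refine ⟨fun i => ?_, fun i x hx a => ?_⟩
    · rw [spinorIn_add]; exact (h.smooth i).add (h'.smooth i)
    · have e : P.covSpinor ρ i a (P.spinorIn ρ i (ψ + φ)) x
          = P.covSpinor ρ i a (P.spinorIn ρ i ψ) x + P.covSpinor ρ i a (P.spinorIn ρ i φ) x := by
        unfold covSpinor
        rw [spinorIn_add, P.dirDeriv_add i a hx (h.smooth i) (h'.smooth i)]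
        simp only [Pi.add_apply, map_add, smul_add, Finset.sum_add_distrib]
        abel
      rw [e, h.eqn i x hx a, h'.eqn i x hx a, spinorIn_add, Pi.add_apply, map_add, smul_add]
  smul_mem' c ψ h := by
    refine ⟨fun i => ?_, fun i x hx a => ?_⟩
    · rw [spinorIn_smul]; exact contMDiffOn_smul c (h.smooth i)
    · have e : P.covSpinor ρ i a (P.spinorIn ρ i (c • ψ)) x
          = c • P.covSpinor ρ i a (P.spinorIn ρ i ψ) x := by
        unfold covSpinor
        rw [spinorIn_smul, P.dirDeriv_smul i a c hx (h.smooth i)]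
        simp only [Pi.smul_apply, map_smul, smul_sub, Finset.smul_sum, smul_comm c]
      rw [e, h.eqn i x hx a, spinorIn_smul, Pi.smul_apply, map_smul, smul_comm c]

/-! ### The brackets -/

/-- The even-even bracket: the Schouten-Nijenhuis bracket, extended bilinearly. -/
def evenEven (θ θ' : ℕ → FormField n M 𝕜) : ℕ → FormField n M 𝕜 := fun r ↦
  ∑ pq ∈ Finset.HasAntidiagonal.antidiagonal (r + 1), P.snBracket pq.1 pq.2 (θ pq.1) (θ' pq.2)

/-- The even-odd bracket: the symmetry operators, extended linearly. -/
def evenOdd (lam : 𝕜) (θ : ℕ → FormField n M 𝕜) (ψ : M → S) : M → S :=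
  ∑ p ∈ Finset.range (n + 1), P.symOp ρ lam p (θ p) ψ

/-- The bracket on `g₀ ⊕ g₁` with the even-even bracket `evenEven`, the even-odd bracket
`evenOdd`, the odd-even bracket `[ψ, θ] = -[θ, ψ]` and the odd-odd bracket `J`, which takes
values in the forms of degree `q`. -/
def superBracket (lam : 𝕜) (q : ℕ) (J : (M → S) → (M → S) → FormField n M 𝕜)
    (a b : (ℕ → FormField n M 𝕜) × (M → S)) : (ℕ → FormField n M 𝕜) × (M → S) :=
  (P.evenEven a.1 b.1 + Pi.single q (J a.2 b.2),
    P.evenOdd ρ lam a.1 b.2 - P.evenOdd ρ lam b.1 a.2)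

end SpinStructure

/-- The symmetric pairing `J'` obtained by polarization of the squaring map `ψ ↦ J ψ ψ`. -/
def polarized {𝕜 : Type*} [RCLike 𝕜] {S : Type*} (J : (M → S) → (M → S) → FormField n M 𝕜)
    (ψ φ : M → S) : FormField n M 𝕜 :=
  (1 / 2 : 𝕜) • (J ψ φ + J φ ψ)

/-- The properties of a pairing `J` of Killing spinors with values in the KY forms of odd degree
`q`, as the odd-odd bracket. Each `J ψ φ` is a KY form. The polarization of the squaring map
`ψ ↦ J ψ ψ` is the odd-odd bracket of a superalgebra over `ℝ`. If the spinor inner product is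
bilinear, then `J` is symmetric or antisymmetric, according to the sign `κ`, and if it is symmetric,
then `J` itself is the odd-odd bracket of a superalgebra over `𝕜`. -/
structure IsOddOddBracket {𝕜 : Type*} [RCLike 𝕜] (P : SpinStructure η g ι)
    {S : Type*} [NormedAddCommGroup S] [NormedSpace ℝ S] [NormedSpace 𝕜 S] [IsScalarTower ℝ 𝕜 S]
    (ρ : CliffordAlgebra (quadForm ℝ η) →ₐ[ℝ] Module.End 𝕜 S) (σ : 𝕜 →+* 𝕜) (lam : 𝕜)
    (q : ℕ) (κ : ℤˣ) (J : (M → S) → (M → S) → FormField n M 𝕜) : Prop where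
  mem_KY : ∀ ψ ∈ P.oddPart ρ lam, ∀ φ ∈ P.oddPart ρ lam, J ψ φ ∈ P.KY 𝕜 q
  superalgebra : IsSuperalgebra ℝ ((P.evenPart 𝕜).restrictScalars ℝ)
    ((P.oddPart ρ lam).restrictScalars ℝ) (P.superBracket ρ lam q (polarized J))
  exchange : σ = RingHom.id 𝕜 → ∀ ψ ∈ P.oddPart ρ lam, ∀ φ ∈ P.oddPart ρ lam,
    J φ ψ = ((κ : ℤ) : 𝕜) • J ψ φ
  superalgebra_of_symm : σ = RingHom.id 𝕜 → κ = 1 →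
    IsSuperalgebra 𝕜 (P.evenPart 𝕜) (P.oddPart ρ lam) (P.superBracket ρ lam q J)

end Geometry

end SpinGeom

end

/-! In an orthonormal frame, forms and spinors become functions with values in fixed
finite-dimensional spaces, and both covariant derivatives have the shape `∂ - r(Γ)`, where `r` is
the form or the spin representation applied to the connection matrix.

Even part. A KY `p`-form `F` amounts to a pair `(F, G)` with `∇_a F = i_a G`, and then `dF = (p + 1)
G`. For constant curvature `k` the Ricci identity yields a second equation `∇_a G = -k e_a ∧ F` when
`p > 0` (`IsKYPair.covForm_next`), so the derivatives of a pair are algebraic in the pair. For odd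
degrees the Schouten-Nijenhuis bracket is the first component of an algebraic bracket of pairs,
whose second component is `-∑ i_a G ∧ i^a G' - k F ∧ F'`; that the result is again a KY pair is the
algebraic identity `contr_pairBracketNext`. For the Jacobi identity the pair is encoded as the even
form `G + e^0 ∧ F` in one more dimension, as on a cone. Up to sign the bracket becomes the Poisson
bracket `∑ c_a i_a X ∧ i_a Y` with weight `k` in the new direction, and the Poisson bracket of even
forms satisfies the Jacobi identity (`poisson_jacobi`, `pairBracket_jacobi`).

Action on spinors. Commuting two derivatives of a Killing spinor gives `(k + 4λ²) ψ = 0` if `n ≥ 2`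
(`IsKillingIn.smul_eq_zero`). For odd `p` the failure of `L_F ψ` to be Killing is `-(p/2)(k + 4λ²)
(e_b ∧ F).ψ`. It vanishes by this condition if `n ≥ 2`, and because `e_b ∧ F` has degree above `n`
otherwise (`IsKillingIn.symmetry`).

Currents. The currents of all degrees are collected in one inhomogeneous form `T`, characterised by
`⟨X, T⟩ = (ψ, rev X.φ)` (`pair_totalCurrent`). Transposing Clifford multiplication under the metric
on forms gives, for Killing spinors, `∇_b T = e_b ∧ (λT + εσ(λ) hat T) + i_b(λT - εσ(λ) hat T)`,
with `hat` the parity involution. In degree `p`, condition (A) removes the wedge term and leaves `2λ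
i_b T_{p+1}`, the KY equation. Condition (B) removes the contraction, and the Hodge star turns the
remaining wedge into a contraction.

Since fields are built pointwise from a chosen trivialization `P.idx x`, every operation must also
be natural under changes of frame. These act by isometries covered by the spin group; the exterior
derivative (`extD_toFrame`) and the volume form (`IsFrameChange.map_vol`) need arguments of their
own. The superalgebra axioms are then formal. -/

set_option linter.unusedSectionVars false

noncomputable section

namespace SpinGeom

/-! ### Exterior algebra on a coframe: anticommutation, parity, degree, naturality. -/

section ExteriorAlgebra

variable {n : ℕ} {𝕜 : Type*} [RCLike 𝕜] {η : Fin n → ℤˣ}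

lemma sgn_mul_self (R : Type*) [Ring R] (η : Fin n → ℤˣ) (a : Fin n) :
    sgn R η a * sgn R η a = 1 := by
  unfold sgn; rw [← Int.cast_mul, Int.units_coe_mul_self, Int.cast_one]

lemma sgn_ne_zero (η : Fin n → ℤˣ) (a : Fin n) : sgn 𝕜 η a ≠ 0 := fun h => by
  have := sgn_mul_self 𝕜 η a
  simp [h] at this

lemma ofReal_sgn (η : Fin n → ℤˣ) (a : Fin n) : ((sgn ℝ η a : ℝ) : 𝕜) = sgn 𝕜 η a := by
  simp [sgn]

lemma ι_eq_sum (v : Fin n → 𝕜) : ExteriorAlgebra.ι 𝕜 v = ∑ a, v a • (coE a : Lam 𝕜 n) := by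
  conv_lhs => rw [pi_eq_sum_univ' v]
  rw [map_sum]
  refine Finset.sum_congr rfl fun a _ => ?_
  rw [map_smul, coE]

/-- Induction on exterior forms, by left multiplication with coframe elements. -/
lemma lam_induction {P : Lam 𝕜 n → Prop} (one : P 1) (add : ∀ X Y, P X → P Y → P (X + Y))
    (smul : ∀ (c : 𝕜) X, P X → P (c • X)) (mul : ∀ a X, P X → P (coE a * X)) (X : Lam 𝕜 n) :
    P X := by
  induction X using CliffordAlgebra.left_induction with
  | algebraMap r => rw [Algebra.algebraMap_eq_smul_one]; exact smul _ _ one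
  | add x y hx hy => exact add _ _ hx hy
  | ι_mul x m hx =>
    have : CliffordAlgebra.ι (0 : QuadraticForm 𝕜 (Fin n → 𝕜)) m * x
        = ∑ a, m a • ((coE a : Lam 𝕜 n) * x) := by
      rw [show CliffordAlgebra.ι (0 : QuadraticForm 𝕜 (Fin n → 𝕜)) m
        = ExteriorAlgebra.ι 𝕜 m from rfl, ι_eq_sum, Finset.sum_mul]
      simp only [smul_mul_assoc]
    rw [this]
    refine Finset.sum_induction _ P add ?_ fun a _ => smul _ _ (mul _ _ hx)
    simpa using smul 0 _ one

/-! ### Anticommutation relations -/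

lemma contr_coE_mul (a b : Fin n) (X : Lam 𝕜 n) :
    contr a (coE b * X) = (if a = b then X else 0) - coE b * contr a X := by
  unfold contr coE ExteriorAlgebra.ι
  rw [CliffordAlgebra.contractLeft_ι_mul]
  split_ifs with h <;> simp [h]

lemma coE_mul_contr (a b : Fin n) (X : Lam 𝕜 n) :
    coE b * contr a X = (if a = b then X else 0) - contr a (coE b * X) := by
  rw [contr_coE_mul]; abel

@[simp] lemma contr_one (a : Fin n) : contr a (1 : Lam 𝕜 n) = 0 :=
  CliffordAlgebra.contractLeft_one _ _

lemma contr_contr (a b : Fin n) (X : Lam 𝕜 n) : contr a (contr b X) = -contr b (contr a X) :=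
  CliffordAlgebra.contractLeft_comm _ _ X

lemma coE_mul_coE (a b : Fin n) : (coE a * coE b : Lam 𝕜 n) = -(coE b * coE a) :=
  eq_neg_of_add_eq_zero_left (ExteriorAlgebra.ι_add_mul_swap _ _)

lemma coE_mul_coE_mul (a b : Fin n) (X : Lam 𝕜 n) :
    coE a * (coE b * X) = -(coE b * (coE a * X)) := by
  rw [← mul_assoc, coE_mul_coE, neg_mul, mul_assoc]

@[simp] lemma coE_mul_self (a : Fin n) : (coE a * coE a : Lam 𝕜 n) = 0 :=
  ExteriorAlgebra.ι_sq_zero _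

/-- The parity involution of exterior forms. -/
def hat : Lam 𝕜 n →ₐ[𝕜] Lam 𝕜 n := CliffordAlgebra.involute

@[simp] lemma hat_coE (a : Fin n) : hat (coE a : Lam 𝕜 n) = -coE a :=
  CliffordAlgebra.involute_ι _

@[simp] lemma hat_hat (X : Lam 𝕜 n) : hat (hat X) = X :=
  CliffordAlgebra.involute_involute X

lemma contr_hat (a : Fin n) (X : Lam 𝕜 n) : contr a (hat X) = -hat (contr a X) := by
  induction X using lam_induction with
  | one => simp
  | add X Y hX hY => simp only [map_add, hX, hY, neg_add]
  | smul c X hX => simp only [map_smul, hX, smul_neg]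
  | mul b X hX =>
    rw [map_mul, hat_coE, neg_mul, map_neg, contr_coE_mul, hX, contr_coE_mul, map_sub, map_mul,
      hat_coE]
    split_ifs <;> simp

lemma contr_mul (a : Fin n) (X Y : Lam 𝕜 n) :
    contr a (X * Y) = contr a X * Y + hat X * contr a Y := by
  induction X using lam_induction with
  | one => simp
  | add X X' hX hY => simp only [map_add, add_mul, hX, hY]; abel
  | smul c X hX => simp only [map_smul, smul_mul_assoc, hX, smul_add]
  | mul b X hX =>
    rw [mul_assoc, contr_coE_mul, hX, contr_coE_mul, map_mul, hat_coE, mul_add, sub_mul]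
    split_ifs <;> simp only [mul_assoc, neg_mul, zero_mul] <;> abel

/-- Signs are carried by `hat` and not by a degree, so that the rules also apply to inhomogeneous
forms: total currents, and sums of KY forms of all odd degrees. -/
lemma mul_coE (a : Fin n) (X : Lam 𝕜 n) : X * coE a = coE a * hat X := by
  induction X using lam_induction with
  | one => simp
  | add X Y hX hY => simp only [map_add, add_mul, mul_add, hX, hY]
  | smul c X hX => simp only [map_smul, smul_mul_assoc, mul_smul_comm, hX]
  | mul b X hX =>
    rw [mul_assoc, hX, map_mul, hat_coE, neg_mul, mul_neg, coE_mul_coE_mul]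

lemma hat_mul_coE (a : Fin n) (X : Lam 𝕜 n) : hat X * coE a = coE a * X := by
  rw [mul_coE, hat_hat]

lemma commute_of_hat_eq {X : Lam 𝕜 n} (h : hat X = X) (Y : Lam 𝕜 n) : X * Y = Y * X := by
  induction Y using lam_induction with
  | one => simp
  | add Y Z hY hZ => simp only [add_mul, mul_add, hY, hZ]
  | smul c Y hY => simp only [smul_mul_assoc, mul_smul_comm, hY]
  | mul b Y hY => rw [← mul_assoc, mul_coE, h, mul_assoc, hY, mul_assoc]

lemma mul_comm_of_hat_eq_neg {X : Lam 𝕜 n} (h : hat X = -X) (Y : Lam 𝕜 n) :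
    X * Y = hat Y * X := by
  induction Y using lam_induction with
  | one => simp
  | add Y Z hY hZ => simp only [map_add, add_mul, mul_add, hY, hZ]
  | smul c Y hY => simp only [map_smul, smul_mul_assoc, mul_smul_comm, hY]
  | mul b Y hY =>
    rw [← mul_assoc, mul_coE, h, map_mul, hat_coE, mul_assoc, neg_mul, hY]
    simp [mul_assoc]

/-! ### Degrees -/

lemma coE_mem (a : Fin n) : (coE a : Lam 𝕜 n) ∈ LinearMap.range (ExteriorAlgebra.ι 𝕜) :=
  LinearMap.mem_range_self _ _

lemma coE_mul_mem (a : Fin n) {p : ℕ} {X : Lam 𝕜 n} (h : X ∈ ⋀[𝕜]^p (Fin n → 𝕜)) :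
    coE a * X ∈ ⋀[𝕜]^(p + 1) (Fin n → 𝕜) := by
  change _ ∈ LinearMap.range (ExteriorAlgebra.ι 𝕜) ^ (p + 1)
  rw [pow_succ']
  exact Submodule.mul_mem_mul (coE_mem a) h

lemma mul_mem_degree {p q : ℕ} {X Y : Lam 𝕜 n} (h : X ∈ ⋀[𝕜]^p (Fin n → 𝕜))
    (h' : Y ∈ ⋀[𝕜]^q (Fin n → 𝕜)) : X * Y ∈ ⋀[𝕜]^(p + q) (Fin n → 𝕜) := by
  change _ ∈ LinearMap.range (ExteriorAlgebra.ι 𝕜) ^ (p + q)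
  rw [pow_add]
  exact Submodule.mul_mem_mul h h'

/-- Induction on forms of given degree. -/
lemma degree_induction {P : ∀ _ : ℕ, Lam 𝕜 n → Prop} (one : P 0 1) (zero : ∀ p, P p 0)
    (add : ∀ p X Y, P p X → P p Y → P p (X + Y)) (smul : ∀ p (c : 𝕜) X, P p X → P p (c • X))
    (mul : ∀ p a X, X ∈ ⋀[𝕜]^p (Fin n → 𝕜) → P p X → P (p + 1) (coE a * X))
    {p : ℕ} {X : Lam 𝕜 n} (h : X ∈ ⋀[𝕜]^p (Fin n → 𝕜)) : P p X := by
  induction p generalizing X with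
  | zero =>
    change _ ∈ LinearMap.range (ExteriorAlgebra.ι 𝕜) ^ 0 at h
    rw [pow_zero, Submodule.mem_one] at h
    obtain ⟨c, rfl⟩ := h
    rw [Algebra.algebraMap_eq_smul_one]
    exact smul _ _ _ one
  | succ p ih =>
    change _ ∈ LinearMap.range (ExteriorAlgebra.ι 𝕜) ^ (p + 1) at h
    rw [pow_succ'] at h
    refine Submodule.mul_induction_on h ?_ fun x y => add _ x y
    rintro _ ⟨v, rfl⟩ Y hY
    rw [ι_eq_sum, Finset.sum_mul]
    refine Finset.sum_induction _ (P (p + 1)) (add _) (zero _) fun a _ => ?_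
    rw [smul_mul_assoc]
    exact smul _ _ _ (mul _ _ _ hY (ih hY))

lemma hat_of_degree {p : ℕ} {X : Lam 𝕜 n} (h : X ∈ ⋀[𝕜]^p (Fin n → 𝕜)) :
    hat X = (-1 : 𝕜) ^ p • X := by
  refine degree_induction (P := fun p X => hat X = (-1 : 𝕜) ^ p • X) (by simp) (by simp)
    (fun p X Y hX hY => by rw [map_add, hX, hY, smul_add])
    (fun p c X hX => by rw [map_smul, hX, smul_comm]) (fun p a X _ hX => ?_) h
  rw [map_mul, hX, hat_coE, pow_succ]
  simp

lemma hat_of_odd {p : ℕ} (hp : Odd p) {X : Lam 𝕜 n} (h : X ∈ ⋀[𝕜]^p (Fin n → 𝕜)) :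
    hat X = -X := by
  rw [hat_of_degree h, hp.neg_one_pow, neg_one_smul]

lemma hat_of_even {p : ℕ} (hp : Even p) {X : Lam 𝕜 n} (h : X ∈ ⋀[𝕜]^p (Fin n → 𝕜)) :
    hat X = X := by
  rw [hat_of_degree h, hp.neg_one_pow, one_smul]

/-- The number operator is multiplication by the degree. -/
lemma sum_coE_mul_contr {p : ℕ} {X : Lam 𝕜 n} (h : X ∈ ⋀[𝕜]^p (Fin n → 𝕜)) :
    ∑ a, coE a * contr a X = (p : 𝕜) • X := by
  refine degree_induction (P := fun p X => ∑ a, coE a * contr a X = (p : 𝕜) • X)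
    (by simp) (by simp)
    (fun p X Y hX hY => by simp only [map_add, mul_add, Finset.sum_add_distrib, hX, hY, smul_add])
    (fun p c X hX => by
      simp only [map_smul, mul_smul_comm, ← Finset.smul_sum, hX, smul_comm c])
    (fun p a X _ hX => ?_) h
  simp only [contr_coE_mul, mul_sub, Finset.sum_sub_distrib, mul_ite, mul_zero,
    Finset.sum_ite_eq', Finset.mem_univ, if_true]
  simp_rw [coE_mul_coE_mul _ a, Finset.sum_neg_distrib, ← Finset.mul_sum, hX]
  push_cast
  rw [add_smul, one_smul, mul_smul_comm]
  abel

lemma contr_mem (a : Fin n) {p : ℕ} {X : Lam 𝕜 n} (h : X ∈ ⋀[𝕜]^(p + 1) (Fin n → 𝕜)) :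
    contr a X ∈ ⋀[𝕜]^p (Fin n → 𝕜) := by
  -- `p - 1` truncates at `p = 0`. The second conjunct records that contraction kills scalars, which
  -- is needed when passing from degree 0 to degree 1.
  have key := degree_induction (p := p + 1) (X := X)
    (P := fun p X => contr a X ∈ ⋀[𝕜]^(p - 1) (Fin n → 𝕜) ∧ (p = 0 → contr a X = 0))
    (by simp) (by simp)
    (fun p X Y hX hY => by
      rw [map_add]
      exact ⟨add_mem hX.1 hY.1, fun hp => by rw [hX.2 hp, hY.2 hp, add_zero]⟩)
    (fun p c X hX => by
      rw [map_smul]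
      exact ⟨Submodule.smul_mem _ _ hX.1, fun hp => by rw [hX.2 hp, smul_zero]⟩)
    (fun p b X hm hX => ⟨?_, by simp⟩) h
  · exact key.1
  · rw [contr_coE_mul, Nat.add_sub_cancel]
    refine sub_mem (by split_ifs; exacts [hm, Submodule.zero_mem _]) ?_
    rcases Nat.eq_zero_or_pos p with hp | hp
    · simp [hX.2 hp]
    · have := coE_mul_mem b hX.1
      rwa [Nat.sub_add_cancel hp] at this

lemma contr_degree_zero (a : Fin n) {X : Lam 𝕜 n} (h : X ∈ ⋀[𝕜]^0 (Fin n → 𝕜)) :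
    contr a X = 0 := by
  change _ ∈ LinearMap.range (ExteriorAlgebra.ι 𝕜) ^ 0 at h
  rw [pow_zero, Submodule.mem_one] at h
  obtain ⟨c, rfl⟩ := h
  rw [Algebra.algebraMap_eq_smul_one, map_smul, contr_one, smul_zero]

lemma eq_zero_of_lt_degree {p : ℕ} (hp : n < p) {X : Lam 𝕜 n}
    (h : X ∈ ⋀[𝕜]^p (Fin n → 𝕜)) : X = 0 := by
  have key : Module.finrank 𝕜 (⋀[𝕜]^p (Fin n → 𝕜)) = 0 := by
    rw [exteriorPower.finrank_eq]
    simp [Nat.choose_eq_zero_of_lt hp]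
  have := Module.finrank_zero_iff.1 key
  exact congrArg Subtype.val (Subsingleton.elim (⟨X, h⟩ : ⋀[𝕜]^p (Fin n → 𝕜)) 0)

lemma map_mem_degree {V W : Type*} [AddCommGroup V] [Module 𝕜 V] [AddCommGroup W] [Module 𝕜 W]
    (T : V →ₗ[𝕜] W) {p : ℕ} {X : ExteriorAlgebra 𝕜 V} (h : X ∈ ⋀[𝕜]^p V) :
    ExteriorAlgebra.map T X ∈ ⋀[𝕜]^p W := by
  have h1 : ExteriorAlgebra.map T X ∈ (⋀[𝕜]^p V).map (ExteriorAlgebra.map T).toLinearMap :=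
    Submodule.mem_map_of_mem h
  change _ ∈ (LinearMap.range (ExteriorAlgebra.ι 𝕜) ^ p).map _ at h1
  rw [Submodule.map_pow] at h1
  refine pow_le_pow_left' (M := Submodule 𝕜 (ExteriorAlgebra 𝕜 W)) ?_ p h1
  rintro _ ⟨_, ⟨v, rfl⟩, rfl⟩
  exact ⟨T v, by simp⟩

/-! ### Naturality and isometries -/

/-- Source and target are kept general because this serves both for changes of frame and for the
embedding into the exterior algebra with one more generator. -/
lemma contractLeft_map {V W : Type*} [AddCommGroup V] [Module 𝕜 V] [AddCommGroup W] [Module 𝕜 W]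
    (T : V →ₗ[𝕜] W) (d : Module.Dual 𝕜 W) (X : ExteriorAlgebra 𝕜 V) :
    (CliffordAlgebra.contractLeft d (ExteriorAlgebra.map T X) : ExteriorAlgebra 𝕜 W)
      = ExteriorAlgebra.map T
        (CliffordAlgebra.contractLeft (d ∘ₗ T) X : ExteriorAlgebra 𝕜 V) := by
  induction X using CliffordAlgebra.left_induction with
  | algebraMap r =>
    rw [CliffordAlgebra.contractLeft_algebraMap, map_zero, AlgHom.commutes]
    exact CliffordAlgebra.contractLeft_algebraMap (0 : QuadraticForm 𝕜 W) d r
  | add x y hx hy => rw [map_add, map_add, map_add, map_add, hx, hy]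
  | ι_mul x m hx =>
    have e : ExteriorAlgebra.map T (CliffordAlgebra.ι 0 m) = CliffordAlgebra.ι 0 (T m) :=
      ExteriorAlgebra.map_apply_ι T m
    rw [map_mul, e, CliffordAlgebra.contractLeft_ι_mul, CliffordAlgebra.contractLeft_ι_mul, hx,
      map_sub, map_mul, e, map_smul]
    rfl

/-- The metric on covectors. -/
def bil (η : Fin n → ℤˣ) (v w : Fin n → 𝕜) : 𝕜 := ∑ a, sgn 𝕜 η a * v a * w a

lemma contrSharp_single (η : Fin n → ℤˣ) (a : Fin n) :
    contrSharp η (Pi.single a (1 : 𝕜)) = sgn 𝕜 η a • (contr a : Module.End 𝕜 (Lam 𝕜 n)) := by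
  unfold contrSharp
  rw [LinearMap.sum_apply, Finset.sum_eq_single a]
  · simp
  · intro b _ hb; simp [hb]
  · simp

lemma contrSharp_ι_mul (v w : Fin n → 𝕜) (X : Lam 𝕜 n) :
    contrSharp η v (ExteriorAlgebra.ι 𝕜 w * X)
      = bil η v w • X - ExteriorAlgebra.ι 𝕜 w * contrSharp η v X := by
  rw [contrSharp_eq]
  refine (CliffordAlgebra.contractLeft_ι_mul _ _ _).trans ?_
  congr 2
  simp only [LinearMap.sum_apply, LinearMap.smul_apply, LinearMap.proj_apply, smul_eq_mul, bil]
  exact Finset.sum_congr rfl fun a _ => by ring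

/-- Linear isometries of the space of covectors. -/
def IsIsom (η : Fin n → ℤˣ) (T : (Fin n → 𝕜) →ₗ[𝕜] (Fin n → 𝕜)) : Prop :=
  ∀ v w, bil η (T v) (T w) = bil η v w

lemma IsIsom.contrSharp_map {T : (Fin n → 𝕜) →ₗ[𝕜] (Fin n → 𝕜)} (hT : IsIsom η T)
    (v : Fin n → 𝕜) (X : Lam 𝕜 n) : contrSharp η (T v) (ExteriorAlgebra.map T X)
      = ExteriorAlgebra.map T (contrSharp η v X) := by
  rw [contrSharp_eq, contractLeft_map, contrSharp_eq]
  congr 3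
  refine LinearMap.ext fun w => ?_
  have := hT v w
  simp only [bil] at this
  simp only [LinearMap.sum_apply, LinearMap.smul_apply, LinearMap.proj_apply, smul_eq_mul,
    LinearMap.comp_apply]
  simpa only [mul_comm (sgn 𝕜 η _)] using this

/-- The contraction `∑ η_a i_a X ∧ i_a Y` of two forms. -/
def contrProd (η : Fin n → ℤˣ) (X Y : Lam 𝕜 n) : Lam 𝕜 n :=
  ∑ a, sgn 𝕜 η a • (contr a X * contr a Y)

lemma contr_map (T : (Fin n → 𝕜) →ₗ[𝕜] (Fin n → 𝕜)) (a : Fin n) (X : Lam 𝕜 n) :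
    contr a (ExteriorAlgebra.map T X)
      = ∑ b, T (Pi.single b 1) a • ExteriorAlgebra.map T (contr b X) := by
  unfold contr
  rw [contractLeft_map]
  have : (LinearMap.proj a : (Fin n → 𝕜) →ₗ[𝕜] 𝕜) ∘ₗ T
      = ∑ b, T (Pi.single b 1) a • (LinearMap.proj b : (Fin n → 𝕜) →ₗ[𝕜] 𝕜) := by
    refine LinearMap.pi_ext' fun b => LinearMap.ext_ring ?_
    simp [Pi.single_apply]
  rw [this, map_sum, LinearMap.sum_apply, map_sum]
  simp

/-- The images of the coframe elements are again orthonormal, so the double sum over their indices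
collapses to the diagonal. -/
lemma IsIsom.contrProd_map {T : (Fin n → 𝕜) →ₗ[𝕜] (Fin n → 𝕜)} (hT : IsIsom η T)
    (X Y : Lam 𝕜 n) : contrProd η (ExteriorAlgebra.map T X) (ExteriorAlgebra.map T Y)
      = ExteriorAlgebra.map T (contrProd η X Y) := by
  unfold contrProd
  have h : ∀ b c, ∑ a, sgn 𝕜 η a * T (Pi.single b 1) a * T (Pi.single c 1) a
      = if b = c then sgn 𝕜 η b else 0 := fun b c => by
    refine (hT _ _).trans ?_
    unfold bil
    simp only [Pi.single_apply, mul_ite, mul_one, mul_zero]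
    by_cases hbc : b = c
    · simp [hbc]
    · simp [hbc, Ne.symm hbc]
  calc _ = ∑ a, ∑ b, ∑ c, (sgn 𝕜 η a * T (Pi.single b 1) a * T (Pi.single c 1) a) •
        ExteriorAlgebra.map T (contr b X * contr c Y) := by
        refine Finset.sum_congr rfl fun a _ => ?_
        rw [contr_map, contr_map, Finset.sum_mul_sum, Finset.smul_sum]
        refine Finset.sum_congr rfl fun b _ => ?_
        rw [Finset.smul_sum]
        refine Finset.sum_congr rfl fun c _ => ?_
        rw [smul_mul_smul_comm, smul_smul, map_mul, mul_assoc]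
    _ = ∑ b, ∑ c, (if b = c then sgn 𝕜 η b else 0) •
        ExteriorAlgebra.map T (contr b X * contr c Y) := by
        rw [Finset.sum_comm]
        refine Finset.sum_congr rfl fun b _ => ?_
        rw [Finset.sum_comm]
        refine Finset.sum_congr rfl fun c _ => ?_
        rw [← Finset.sum_smul, h]
    _ = _ := by
        simp [map_sum, map_smul]

end ExteriorAlgebra

/-! ### The Poisson bracket of even forms, the cone, and the Jacobi identity. -/

section Poisson

variable {n : ℕ} {𝕜 : Type*} [RCLike 𝕜] {η : Fin n → ℤˣ}

/-- The Poisson bracket `∑ c_a i_a X ∧ i_a Y` with weights `c_a`. -/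
def poisson (c : Fin n → 𝕜) (X Y : Lam 𝕜 n) : Lam 𝕜 n := ∑ a, c a • (contr a X * contr a Y)

/-- The auxiliary trilinear expression of which the iterated Poisson bracket consists. -/
def poissonTriple (c : Fin n → 𝕜) (X Y Z : Lam 𝕜 n) : Lam 𝕜 n :=
  ∑ a, ∑ b, (c a * c b) • (contr a X * (contr a (contr b Y) * contr b Z))

lemma hat_contr_of_even {X : Lam 𝕜 n} (h : hat X = X) (a : Fin n) :
    hat (contr a X) = -contr a X := by
  conv_rhs => rw [← h, contr_hat, neg_neg]

lemma hat_contr_of_odd {X : Lam 𝕜 n} (h : hat X = -X) (a : Fin n) :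
    hat (contr a X) = contr a X := by
  have := contr_hat a X
  rw [h, map_neg, neg_inj] at this
  exact this.symm

lemma hat_contr_contr_of_even {X : Lam 𝕜 n} (h : hat X = X) (a b : Fin n) :
    hat (contr a (contr b X)) = contr a (contr b X) :=
  hat_contr_of_odd (hat_contr_of_even h b) a

/-- The middle factor is even and commutes. Exchanging the two odd outer factors gives one sign, and
exchanging the two contractions of `Y` gives another. -/
lemma poissonTriple_swap (c : Fin n → 𝕜) {X Y Z : Lam 𝕜 n} (hX : hat X = X) (hY : hat Y = Y)
    (hZ : hat Z = Z) : poissonTriple c X Y Z = poissonTriple c Z Y X := by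
  unfold poissonTriple
  rw [Finset.sum_comm]
  refine Finset.sum_congr rfl fun b _ => Finset.sum_congr rfl fun a _ => ?_
  rw [mul_comm (c a)]
  congr 1
  rw [← mul_assoc, ← commute_of_hat_eq (hat_contr_contr_of_even hY a b), mul_assoc,
    mul_comm_of_hat_eq_neg (hat_contr_of_even hX a), hat_contr_of_even hZ, contr_contr a b Y,
    neg_mul_comm, neg_mul, neg_neg, ← mul_assoc,
    commute_of_hat_eq (hat_contr_contr_of_even hY b a), mul_assoc]

/-- The outer contraction falls on one of the two factors of the inner bracket, with a sign from
passing the odd form `i_b Y` in the second case. -/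
lemma poisson_poisson (c : Fin n → 𝕜) (X : Lam 𝕜 n) {Y Z : Lam 𝕜 n} (hY : hat Y = Y)
    (hZ : hat Z = Z) :
    poisson c X (poisson c Y Z) = poissonTriple c X Y Z - poissonTriple c X Z Y := by
  unfold poisson poissonTriple
  rw [← Finset.sum_sub_distrib]
  refine Finset.sum_congr rfl fun a _ => ?_
  rw [← Finset.sum_sub_distrib, map_sum, Finset.mul_sum, Finset.smul_sum]
  refine Finset.sum_congr rfl fun b _ => ?_
  rw [map_smul, contr_mul, hat_contr_of_even hY, mul_smul_comm, smul_smul, ← smul_sub, ← mul_sub,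
    commute_of_hat_eq (hat_contr_contr_of_even hZ a b), neg_mul, sub_eq_add_neg]

/-- The three double brackets expand to six triples, which cancel in pairs by `poissonTriple_swap`.
-/
lemma poisson_jacobi (c : Fin n → 𝕜) {X Y Z : Lam 𝕜 n} (hX : hat X = X) (hY : hat Y = Y)
    (hZ : hat Z = Z) : poisson c X (poisson c Y Z) + poisson c Y (poisson c Z X)
      + poisson c Z (poisson c X Y) = 0 := by
  rw [poisson_poisson c X hY hZ, poisson_poisson c Y hZ hX, poisson_poisson c Z hX hY,
    poissonTriple_swap c hX hY hZ, poissonTriple_swap c hX hZ hY, poissonTriple_swap c hY hX hZ]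
  abel

/-- The exterior algebra as a subalgebra of the one with an additional generator `coE 0`. -/
def lamSucc : Lam 𝕜 n →ₐ[𝕜] Lam 𝕜 (n + 1) :=
  ExteriorAlgebra.map (LinearMap.pi (Fin.cons 0 fun a => LinearMap.proj a))

lemma contr_zero_lamSucc (X : Lam 𝕜 n) : contr 0 (lamSucc X) = 0 := by
  unfold lamSucc contr
  rw [contractLeft_map]
  have : (LinearMap.proj 0 : (Fin (n + 1) → 𝕜) →ₗ[𝕜] 𝕜) ∘ₗ
      LinearMap.pi (Fin.cons 0 fun a : Fin n => LinearMap.proj a) = 0 := by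
    ext; simp
  rw [this]; simp

lemma contr_succ_lamSucc (a : Fin n) (X : Lam 𝕜 n) :
    contr a.succ (lamSucc X) = lamSucc (contr a X) := by
  unfold lamSucc contr
  rw [contractLeft_map]
  have : (LinearMap.proj a.succ : (Fin (n + 1) → 𝕜) →ₗ[𝕜] 𝕜) ∘ₗ
      LinearMap.pi (Fin.cons 0 fun a : Fin n => LinearMap.proj a) = LinearMap.proj a := by
    ext; simp
  rw [this]

/-- Forgetting coordinate `0` is a left inverse on generators. This allows identities proved on the
cone to be brought back. -/
lemma lamSucc_injective : Function.Injective (lamSucc : Lam 𝕜 n →ₐ[𝕜] Lam 𝕜 (n + 1)) := by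
  refine ExteriorAlgebra.map_injective ⟨LinearMap.pi fun a => LinearMap.proj a.succ, ?_⟩
  ext; simp

lemma hat_lamSucc (X : Lam 𝕜 n) : hat (lamSucc X) = lamSucc (hat X) := by
  have : (hat.comp lamSucc : Lam 𝕜 n →ₐ[𝕜] _) = lamSucc.comp hat := by
    refine ExteriorAlgebra.hom_ext (LinearMap.ext fun v => ?_)
    have h1 : ∀ {m} (w : Fin m → 𝕜), hat (ExteriorAlgebra.ι 𝕜 w) = -ExteriorAlgebra.ι 𝕜 w :=
      fun w => CliffordAlgebra.involute_ι w
    simp [lamSucc, h1]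
  exact DFunLike.congr_fun this X

/-- The form on the cone determined by a form `F` and a form `G` of the next degree. -/
def coneForm (F G : Lam 𝕜 n) : Lam 𝕜 (n + 1) := lamSucc G + coE 0 * lamSucc F

lemma contr_zero_coneForm (F G : Lam 𝕜 n) : contr 0 (coneForm F G) = lamSucc F := by
  rw [coneForm, map_add, contr_zero_lamSucc, contr_coE_mul, contr_zero_lamSucc]
  simp

lemma contr_succ_coneForm (a : Fin n) (F G : Lam 𝕜 n) : contr a.succ (coneForm F G)
    = lamSucc (contr a G) - coE 0 * lamSucc (contr a F) := by
  rw [coneForm, map_add, contr_succ_lamSucc, contr_coE_mul, contr_succ_lamSucc,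
    if_neg (Fin.succ_ne_zero a), zero_sub, sub_eq_add_neg]

lemma hat_coneForm {F G : Lam 𝕜 n} (hF : hat F = -F) (hG : hat G = G) :
    hat (coneForm F G) = coneForm F G := by
  rw [coneForm, map_add, map_mul, hat_lamSucc, hat_lamSucc, hF, hG, hat_coE, map_neg, neg_mul_neg]

/-- The first component of the bracket of pairs of forms: for KY forms with `∇_a F = i_a G` this
is the Schouten-Nijenhuis bracket. -/
def pairBracket (η : Fin n → ℤˣ) (F G F' G' : Lam 𝕜 n) : Lam 𝕜 n :=
  contrProd η F G' - contrProd η F' G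

/-- The second component of the bracket of pairs of forms. -/
def pairBracketNext (η : Fin n → ℤˣ) (k : 𝕜) (F G F' G' : Lam 𝕜 n) : Lam 𝕜 n :=
  -contrProd η G G' - k • (F * F')

/-- The curvature enters only as the weight of the radial index `0`, where both contractions return
the first components and produce `k F ∧ F'`. The terms with two factors `e^0` vanish. The overall
sign disappears once the bracket is iterated. -/
lemma poisson_coneForm (η : Fin n → ℤˣ) (k : 𝕜) {F G F' : Lam 𝕜 n} (G' : Lam 𝕜 n)
    (hG : hat G = G) (hF' : hat F' = -F') :
    poisson (Fin.cons k fun a => sgn 𝕜 η a) (coneForm F G) (coneForm F' G')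
      = -coneForm (pairBracket η F G F' G') (pairBracketNext η k F G F' G') := by
  have key : ∀ a : Fin n, contr a.succ (coneForm F G) * contr a.succ (coneForm F' G')
      = lamSucc (contr a G * contr a G') - coE 0 * (lamSucc (contr a F * contr a G')
        - lamSucc (contr a F' * contr a G)) := fun a => by
    rw [contr_succ_coneForm, contr_succ_coneForm, commute_of_hat_eq (hat_contr_of_odd hF' a)]
    simp only [map_mul, sub_mul, mul_sub]
    have e1 : lamSucc (contr a G) * (coE 0 * lamSucc (contr a F'))
        = -(coE 0 * (lamSucc (contr a G) * lamSucc (contr a F'))) := by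
      rw [← mul_assoc, mul_coE, hat_lamSucc, hat_contr_of_even hG, map_neg, mul_neg, neg_mul,
        mul_assoc]
    have e2 : coE 0 * lamSucc (contr a F) * (coE 0 * lamSucc (contr a F')) = 0 := by
      rw [mul_assoc, ← mul_assoc (lamSucc _), mul_coE, ← mul_assoc, ← mul_assoc, coE_mul_self,
        zero_mul, zero_mul]
    rw [e1, e2]
    simp only [mul_assoc]
    abel
  unfold poisson
  rw [Fin.sum_univ_succ]
  simp only [Fin.cons_zero, Fin.cons_succ, key, contr_zero_coneForm]
  simp only [coneForm, pairBracket, pairBracketNext, contrProd, map_sub, map_neg, map_sum,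
    map_smul, map_mul, smul_sub, mul_sub, Finset.sum_sub_distrib, Finset.mul_sum, mul_smul_comm]
  abel

lemma hat_contrProd_of_odd_even {F G : Lam 𝕜 n} (hF : hat F = -F) (hG : hat G = G) :
    hat (contrProd η F G) = -contrProd η F G := by
  simp only [contrProd, map_sum, map_smul, map_mul, hat_contr_of_odd hF, hat_contr_of_even hG,
    mul_neg, smul_neg, Finset.sum_neg_distrib]

lemma hat_pairBracket {F G F' G' : Lam 𝕜 n} (hF : hat F = -F) (hG : hat G = G)
    (hF' : hat F' = -F') (hG' : hat G' = G') :
    hat (pairBracket η F G F' G') = -pairBracket η F G F' G' := by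
  rw [pairBracket, map_sub, hat_contrProd_of_odd_even hF hG', hat_contrProd_of_odd_even hF' hG]
  abel

/-- Contraction in the radial direction reads off the first component of a pair. -/
lemma contr_zero_poisson_poisson (η : Fin n → ℤˣ) (k : 𝕜) {F₁ G₁ F₂ G₂ F₃ G₃ : Lam 𝕜 n}
    (hG₁ : hat G₁ = G₁) (hF₂ : hat F₂ = -F₂) (hG₂ : hat G₂ = G₂)
    (hF₃ : hat F₃ = -F₃) (hG₃ : hat G₃ = G₃) :
    contr 0 (poisson (Fin.cons k fun a => sgn 𝕜 η a) (coneForm F₁ G₁)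
      (poisson (Fin.cons k fun a => sgn 𝕜 η a) (coneForm F₂ G₂) (coneForm F₃ G₃)))
      = lamSucc (pairBracket η F₁ G₁ (pairBracket η F₂ G₂ F₃ G₃)
        (pairBracketNext η k F₂ G₂ F₃ G₃)) := by
  have neg : ∀ c X Y, poisson c X (-Y) = -poisson (n := n + 1) (𝕜 := 𝕜) c X Y := fun c X Y => by
    simp [poisson]
  rw [poisson_coneForm η k G₃ hG₂ hF₃, neg, poisson_coneForm η k _ hG₁
    (hat_pairBracket hF₂ hG₂ hF₃ hG₃), neg_neg, contr_zero_coneForm]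

/-- The Jacobi identity for the bracket of pairs of forms. -/
lemma pairBracket_jacobi (η : Fin n → ℤˣ) (k : 𝕜) {F₁ G₁ F₂ G₂ F₃ G₃ : Lam 𝕜 n}
    (hF₁ : hat F₁ = -F₁) (hG₁ : hat G₁ = G₁) (hF₂ : hat F₂ = -F₂) (hG₂ : hat G₂ = G₂)
    (hF₃ : hat F₃ = -F₃) (hG₃ : hat G₃ = G₃) :
    pairBracket η F₁ G₁ (pairBracket η F₂ G₂ F₃ G₃) (pairBracketNext η k F₂ G₂ F₃ G₃)
      + pairBracket η F₂ G₂ (pairBracket η F₃ G₃ F₁ G₁) (pairBracketNext η k F₃ G₃ F₁ G₁)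
      + pairBracket η F₃ G₃ (pairBracket η F₁ G₁ F₂ G₂) (pairBracketNext η k F₁ G₁ F₂ G₂)
      = 0 := by
  -- The cyclic sum is the `e^0`-component of the Poisson Jacobi identity for the three cone forms.
  apply lamSucc_injective
  rw [map_add, map_add, map_zero, ← contr_zero_poisson_poisson η k hG₁ hF₂ hG₂ hF₃ hG₃,
    ← contr_zero_poisson_poisson η k hG₂ hF₃ hG₃ hF₁ hG₁,
    ← contr_zero_poisson_poisson η k hG₃ hF₁ hG₁ hF₂ hG₂, ← map_add, ← map_add,
    poisson_jacobi _ (hat_coneForm hF₁ hG₁) (hat_coneForm hF₂ hG₂) (hat_coneForm hF₃ hG₃),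
    map_zero]

end Poisson

/-! ### Infinitesimal rotations of forms; the algebra behind KY pairs. -/

section Rotation

variable {n : ℕ} {𝕜 : Type*} [RCLike 𝕜] {η : Fin n → ℤˣ}

/-- The derivation of the exterior algebra induced by a matrix. -/
def rot (m : Fin n → Fin n → 𝕜) : Lam 𝕜 n →ₗ[𝕜] Lam 𝕜 n :=
  ∑ b, ∑ c, m b c • (LinearMap.mulLeft 𝕜 (coE b) ∘ₗ contr c)

lemma rot_apply (m : Fin n → Fin n → 𝕜) (X : Lam 𝕜 n) :
    rot m X = ∑ b, ∑ c, m b c • (coE b * contr c X) := by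
  simp [rot, LinearMap.sum_apply]

lemma rot_mul (m : Fin n → Fin n → 𝕜) (X Y : Lam 𝕜 n) :
    rot m (X * Y) = rot m X * Y + X * rot m Y := by
  simp only [rot_apply, Finset.sum_mul, Finset.mul_sum, ← Finset.sum_add_distrib]
  refine Finset.sum_congr rfl fun b _ => Finset.sum_congr rfl fun c _ => ?_
  rw [contr_mul, mul_add, ← mul_assoc, ← mul_assoc, ← mul_coE, smul_mul_assoc, mul_smul_comm,
    smul_add, mul_assoc X]

lemma contr_rot (m : Fin n → Fin n → 𝕜) (a : Fin n) (X : Lam 𝕜 n) :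
    contr a (rot m X) = ∑ c, m a c • contr c X + rot m (contr a X) := by
  simp only [rot_apply, map_sum, map_smul, contr_coE_mul, contr_contr a, mul_neg,
    sub_neg_eq_add, smul_add, Finset.sum_add_distrib]
  congr 1
  rw [Finset.sum_eq_single a]
  · simp
  · intro b _ hb; simp [Ne.symm hb]
  · simp

lemma rot_coE (m : Fin n → Fin n → 𝕜) (a : Fin n) :
    rot m (coE a : Lam 𝕜 n) = ∑ b, m b a • coE b := by
  rw [rot_apply]
  refine Finset.sum_congr rfl fun b _ => ?_
  rw [Finset.sum_eq_single a]
  · rw [← mul_one (coE a), contr_coE_mul]; simp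
  · intro c _ hc; rw [← mul_one (coE a), contr_coE_mul]; simp [hc]
  · simp

lemma rot_mem (m : Fin n → Fin n → 𝕜) {p : ℕ} {X : Lam 𝕜 n} (h : X ∈ ⋀[𝕜]^p (Fin n → 𝕜)) :
    rot m X ∈ ⋀[𝕜]^p (Fin n → 𝕜) := by
  rw [rot_apply]
  refine Submodule.sum_mem _ fun b _ => Submodule.sum_mem _ fun c _ => Submodule.smul_mem _ _ ?_
  cases p with
  | zero => rw [contr_degree_zero c h, mul_zero]; exact Submodule.zero_mem _
  | succ p => exact coE_mul_mem b (contr_mem c h)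

lemma rot_one (m : Fin n → Fin n → 𝕜) : rot m (1 : Lam 𝕜 n) = 0 := by simp [rot_apply]

/-- A commutator of derivations is a derivation, so it is enough to compare the two sides on coframe
elements, where they give the commutator of matrices. -/
lemma rot_rot (m m' : Fin n → Fin n → 𝕜) (X : Lam 𝕜 n) :
    rot m (rot m' X) - rot m' (rot m X)
      = rot (fun b c => ∑ f, (m b f * m' f c - m' b f * m f c)) X := by
  induction X using lam_induction with
  | one => simp [rot_one]
  | add X Y hX hY => simp only [map_add, ← hX, ← hY]; abel
  | smul c X hX => simp only [map_smul, ← hX, smul_sub]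
  | mul a X hX =>
    have e : rot m (rot m' (coE a)) - rot m' (rot m (coE a : Lam 𝕜 n))
        = rot (fun b c => ∑ f, (m b f * m' f c - m' b f * m f c)) (coE a) := by
      simp only [rot_coE, map_sum, map_smul, Finset.smul_sum, smul_smul]
      rw [Finset.sum_comm, Finset.sum_comm (f := fun b c => (m b a * m' c b) • coE c),
        ← Finset.sum_sub_distrib]
      refine Finset.sum_congr rfl fun b _ => ?_
      rw [← Finset.sum_sub_distrib, Finset.sum_smul]
      refine Finset.sum_congr rfl fun c _ => ?_
      rw [← sub_smul, mul_comm (m' c a), mul_comm (m c a)]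
    simp only [rot_mul, map_add, ← hX, ← e, sub_mul, mul_sub]
    abel

/-- Antisymmetry of a matrix with respect to the metric. -/
def IsSkew (η : Fin n → ℤˣ) (m : Fin n → Fin n → 𝕜) : Prop :=
  ∀ b c, sgn 𝕜 η c * m b c = -(sgn 𝕜 η b * m c b)

lemma IsSkew.mul_eq {m : Fin n → Fin n → 𝕜} (h : IsSkew η m) (b c : Fin n) :
    sgn 𝕜 η b * m b c = -(sgn 𝕜 η c * m c b) := by
  linear_combination (sgn 𝕜 η b * sgn 𝕜 η c) * h b c - sgn 𝕜 η b * m b c * sgn_mul_self 𝕜 η c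
    - sgn 𝕜 η c * m c b * sgn_mul_self 𝕜 η b

/-- `rot m` commutes with `i_a` up to `∑ m_{ac} i_c`; skewness cancels these corrections between the
two factors (`key`). -/
lemma IsSkew.rot_contrProd {m : Fin n → Fin n → 𝕜} (h : IsSkew η m) (X Y : Lam 𝕜 n) :
    rot m (contrProd η X Y) = contrProd η (rot m X) Y + contrProd η X (rot m Y) := by
  have key : ∑ a, sgn 𝕜 η a • ((∑ c, m a c • contr c X) * contr a Y)
      + ∑ a, sgn 𝕜 η a • (contr a X * ∑ c, m a c • contr c Y) = 0 := by
    simp only [Finset.sum_mul, Finset.mul_sum, Finset.smul_sum, smul_mul_assoc, mul_smul_comm,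
      smul_smul]
    rw [Finset.sum_comm, ← Finset.sum_add_distrib]
    refine Finset.sum_eq_zero fun c _ => ?_
    rw [← Finset.sum_add_distrib]
    refine Finset.sum_eq_zero fun a _ => ?_
    rw [← add_smul, h.mul_eq, neg_add_cancel, zero_smul]
  have e : ∀ a Z, rot m (contr a Z) = contr a (rot m Z) - ∑ c, m a c • contr c Z := fun a Z => by
    rw [contr_rot]; abel
  have e2 : rot m (contrProd η X Y) = contrProd η (rot m X) Y + contrProd η X (rot m Y)
      - (∑ a, sgn 𝕜 η a • ((∑ c, m a c • contr c X) * contr a Y)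
        + ∑ a, sgn 𝕜 η a • (contr a X * ∑ c, m a c • contr c Y)) := by
    simp only [contrProd, map_sum, map_smul, rot_mul, e, sub_mul, mul_sub, smul_add, smul_sub,
      Finset.sum_add_distrib, Finset.sum_sub_distrib]
    abel
  rw [e2, key, sub_zero]

/-- If `F`, `G` and `F'`, `G'` are such that `∇_b F = i_b G` and `∇_b G = -k e_b ∧ F`, then the
first component of their bracket is again of this type. -/
lemma contr_pairBracketNext (k : 𝕜) {F G F' G' : Lam 𝕜 n} (hF : hat F = -F)
    (hG : hat G = G) (hF' : hat F' = -F') (hG' : hat G' = G') (b : Fin n) :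
    pairBracket η (contr b G) (-(k * sgn 𝕜 η b) • (coE b * F)) F' G'
      + pairBracket η F G (contr b G') (-(k * sgn 𝕜 η b) • (coE b * F'))
      = contr b (pairBracketNext η k F G F' G') := by
  have smul : ∀ (c : 𝕜) (X Y : Lam 𝕜 n), contrProd η X (c • Y) = c • contrProd η X Y := fun c X Y => by
    simp only [contrProd, map_smul, mul_smul_comm, Finset.smul_sum, smul_comm c]
  have e1 : ∀ X Y : Lam 𝕜 n, hat X = -X → contrProd η X (coE b * Y)
      = sgn 𝕜 η b • (contr b X * Y) - coE b * contrProd η X Y := fun X Y hX => by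
    simp only [contrProd, contr_coE_mul, mul_sub, smul_sub, Finset.sum_sub_distrib,
      Finset.mul_sum, mul_smul_comm]
    congr 1
    · rw [Finset.sum_eq_single b]
      · simp
      · intro a _ ha; simp [ha]
      · simp
    · refine Finset.sum_congr rfl fun a _ => ?_
      rw [← mul_assoc, mul_coE, hat_contr_of_odd hX, mul_assoc]
  -- This symmetry makes the two terms `k e_b ∧ ∑ i_a F ∧ i^a F'` cancel; only the derivative of `F
  -- ∧ F'` survives.
  have e2 : contrProd η F' F = contrProd η F F' := Finset.sum_congr rfl fun a _ => by
    rw [commute_of_hat_eq (hat_contr_of_odd hF' a)]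
  have e3 : contr b (contrProd η G G')
      = contrProd η (contr b G') G - contrProd η (contr b G) G' := by
    simp only [contrProd, map_sum, map_smul, ← Finset.sum_sub_distrib, ← smul_sub]
    refine Finset.sum_congr rfl fun a _ => ?_
    rw [contr_mul, hat_contr_of_even hG, commute_of_hat_eq (hat_contr_contr_of_even hG' a b),
      contr_contr b a G, contr_contr b a G']
    simp only [neg_mul, mul_neg, neg_neg]
    congr 1
    abel
  have e4 : contr b (F * F') = contr b F * F' - contr b F' * F := by
    rw [contr_mul, hF, neg_mul, commute_of_hat_eq (hat_contr_of_odd hF' b), sub_eq_add_neg]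
  simp only [pairBracket, pairBracketNext, map_sub, map_neg, map_smul, e3, e4, smul, e1 _ _ hF,
    e1 _ _ hF', e2]
  have hs : ∀ X : Lam 𝕜 n, (k * sgn 𝕜 η b) • sgn 𝕜 η b • X = k • X := fun X => by
    rw [smul_smul, mul_assoc, sgn_mul_self, mul_one]
  simp only [neg_smul, smul_sub, hs]
  abel

/-- A field of `(p+1)`-forms `Q_a` with `i_b Q_a = i_a Q_b` vanishes for `p ≥ 1`. -/
lemma eq_zero_of_contr_symm {p : ℕ} (hp : 0 < p) {Q : Fin n → Lam 𝕜 n}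
    (hQ : ∀ a, Q a ∈ ⋀[𝕜]^(p + 1) (Fin n → 𝕜)) (h : ∀ a b, contr b (Q a) = contr a (Q b))
    (a : Fin n) : Q a = 0 := by
  set Z : Lam 𝕜 n := ∑ b, coE b * Q b with hZ
  -- The number operator on `Q a` is `∑ e^b ∧ i_b Q_a = ∑ e^b ∧ i_a Q_b`; anticommuting `e^b` past
  -- `i_a` gives `Q_a - i_a Z`.
  have h1 : ∀ a, (p : 𝕜) • Q a = -contr a Z := fun a => by
    have e := sum_coE_mul_contr (hQ a)
    simp only [h a, coE_mul_contr, Finset.sum_sub_distrib, Finset.sum_ite_eq, Finset.mem_univ,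
      if_true, ← map_sum, ← hZ] at e
    push_cast at e
    rw [add_smul, one_smul] at e
    rw [← add_left_inj (Q a), ← e]; abel
  have hZm : Z ∈ ⋀[𝕜]^(p + 1 + 1) (Fin n → 𝕜) :=
    Submodule.sum_mem _ fun b _ => coE_mul_mem b (hQ b)
  -- Wedging `h1` with `e^a` and summing applies the number operator to `Z`. Hence `(2p + 2) Z = 0`,
  -- and `h1` then kills `Q` because `p ≠ 0`.
  have h2 : (p : 𝕜) • Z = -(((p + 1 + 1 : ℕ) : 𝕜) • Z) := by
    rw [← sum_coE_mul_contr hZm, hZ, Finset.smul_sum, ← hZ, ← Finset.sum_neg_distrib]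
    refine Finset.sum_congr rfl fun b _ => ?_
    rw [← mul_smul_comm, h1, mul_neg]
  have h3 : Z = 0 := by
    have : ((p + (p + 1 + 1) : ℕ) : 𝕜) • Z = 0 := by
      rw [Nat.cast_add, add_smul, h2, neg_add_cancel]
    exact (smul_eq_zero.1 this).resolve_left (Nat.cast_ne_zero.2 (by omega))
  have h4 := h1 a
  rw [h3, map_zero, neg_zero] at h4
  exact (smul_eq_zero.1 h4).resolve_left (Nat.cast_ne_zero.2 (by omega))

end Rotation

/-! ### Homogeneous components, the metric on forms, and the Hodge star. -/

section Pairing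

variable {n : ℕ} {𝕜 : Type*} [RCLike 𝕜] {η : Fin n → ℤˣ}

/-! ### Ordered products -/

/-- The ordered product of the coframe elements with indices in `A`. -/
def coEProd (A : Finset (Fin n)) : Lam 𝕜 n := ((A.sort (· ≤ ·)).map coE).prod

lemma lamBasis_apply (A : Finset (Fin n)) : lamBasis 𝕜 n A = coEProd A := by
  unfold lamBasis coEProd
  rw [ExteriorAlgebra.basis_apply]
  change ExteriorAlgebra.ιMulti 𝕜 A.card (_ ∘ A.orderEmbOfFin rfl) = _
  rw [ExteriorAlgebra.ιMulti_apply]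
  congr 1
  refine List.ext_getElem (by simp) fun i h1 h2 => ?_
  simp [coE, Finset.orderEmbOfFin_apply]

lemma list_prod_mem (l : List (Fin n)) :
    ((l.map coE).prod : Lam 𝕜 n) ∈ ⋀[𝕜]^l.length (Fin n → 𝕜) := by
  induction l with
  | nil => simp
  | cons a l ih =>
    rw [List.map_cons, List.prod_cons, List.length_cons]
    exact coE_mul_mem a ih

lemma contr_list_prod {a : Fin n} {l : List (Fin n)} (h : a ∉ l) :
    contr a ((l.map coE).prod : Lam 𝕜 n) = 0 := by
  induction l with
  | nil => simp
  | cons b l ih =>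
    rw [List.mem_cons, not_or] at h
    rw [List.map_cons, List.prod_cons, contr_coE_mul, if_neg h.1, ih h.2, mul_zero, sub_zero]

lemma coEProd_mem (A : Finset (Fin n)) : (coEProd A : Lam 𝕜 n) ∈ ⋀[𝕜]^A.card (Fin n → 𝕜) := by
  have := list_prod_mem (𝕜 := 𝕜) (A.sort (· ≤ ·))
  rwa [Finset.length_sort] at this

lemma vol_mem : (vol : Lam 𝕜 n) ∈ ⋀[𝕜]^n (Fin n → 𝕜) := by
  have := list_prod_mem (𝕜 := 𝕜) (List.finRange n)
  rwa [List.length_finRange] at this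

/-! ### Homogeneous components -/

/-- The component of degree `p` of a form. -/
def lamProj (p : ℕ) : Lam 𝕜 n →ₗ[𝕜] Lam 𝕜 n :=
  GradedAlgebra.proj (fun i : ℕ => ⋀[𝕜]^i (Fin n → 𝕜)) p

lemma lamProj_mem (p : ℕ) (X : Lam 𝕜 n) : lamProj p X ∈ ⋀[𝕜]^p (Fin n → 𝕜) := by
  rw [lamProj, GradedAlgebra.proj_apply]; exact Subtype.mem _

lemma lamProj_of_mem {p q : ℕ} {X : Lam 𝕜 n} (h : X ∈ ⋀[𝕜]^q (Fin n → 𝕜)) :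
    lamProj p X = if q = p then X else 0 := by
  rw [lamProj, GradedAlgebra.proj_apply]
  split_ifs with hpq
  · subst hpq
    exact DirectSum.decompose_of_mem_same (fun i : ℕ => ⋀[𝕜]^i (Fin n → 𝕜)) h
  · exact DirectSum.decompose_of_mem_ne (fun i : ℕ => ⋀[𝕜]^i (Fin n → 𝕜)) h hpq

lemma lam_hom_ext_degree {W : Type*} [AddCommGroup W] [Module 𝕜 W] {f g : Lam 𝕜 n →ₗ[𝕜] W}
    (h : ∀ p, ∀ X ∈ ⋀[𝕜]^p (Fin n → 𝕜), f X = g X) : f = g := by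
  refine LinearMap.ext fun X => ?_
  induction X using DirectSum.Decomposition.inductionOn (fun i : ℕ => ⋀[𝕜]^i (Fin n → 𝕜)) with
  | zero => simp
  | homogeneous m => exact h _ _ m.2
  | add X Y hX hY => rw [map_add, map_add, hX, hY]

lemma lamProj_succ_coE_mul (p : ℕ) (a : Fin n) (X : Lam 𝕜 n) :
    lamProj (p + 1) (coE a * X) = coE a * lamProj p X := by
  have : lamProj (p + 1) ∘ₗ LinearMap.mulLeft 𝕜 (coE a)
      = LinearMap.mulLeft 𝕜 (coE a : Lam 𝕜 n) ∘ₗ lamProj p := by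
    refine lam_hom_ext_degree fun q Y hY => ?_
    simp only [LinearMap.comp_apply, LinearMap.mulLeft_apply, lamProj_of_mem (coE_mul_mem a hY),
      lamProj_of_mem hY, add_left_inj, mul_ite, mul_zero]
  exact LinearMap.congr_fun this X

lemma lamProj_zero_coE_mul (a : Fin n) (X : Lam 𝕜 n) : lamProj 0 (coE a * X) = 0 := by
  have : lamProj 0 ∘ₗ LinearMap.mulLeft 𝕜 (coE a) = (0 : Lam 𝕜 n →ₗ[𝕜] Lam 𝕜 n) := by
    refine lam_hom_ext_degree fun q Y hY => ?_
    simp [lamProj_of_mem (coE_mul_mem a hY)]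
  exact LinearMap.congr_fun this X

lemma lamProj_contr (p : ℕ) (a : Fin n) (X : Lam 𝕜 n) :
    lamProj p (contr a X) = contr a (lamProj (p + 1) X) := by
  have : lamProj p ∘ₗ contr a = contr a ∘ₗ (lamProj (p + 1) : Lam 𝕜 n →ₗ[𝕜] Lam 𝕜 n) := by
    refine lam_hom_ext_degree fun q Y hY => ?_
    rw [LinearMap.comp_apply, LinearMap.comp_apply]
    cases q with
    | zero => rw [contr_degree_zero a hY, lamProj_of_mem hY]; simp
    | succ q =>
      rw [lamProj_of_mem (contr_mem a hY), lamProj_of_mem hY]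
      simp only [add_left_inj]
      split_ifs <;> simp
  exact LinearMap.congr_fun this X

lemma lamProj_hat (p : ℕ) (X : Lam 𝕜 n) :
    lamProj p (hat X) = (-1 : 𝕜) ^ p • lamProj p X := by
  have : lamProj p ∘ₗ (hat : Lam 𝕜 n →ₐ[𝕜] Lam 𝕜 n).toLinearMap = (-1 : 𝕜) ^ p • lamProj p := by
    refine lam_hom_ext_degree fun q Y hY => ?_
    simp only [LinearMap.comp_apply, AlgHom.toLinearMap_apply, hat_of_degree hY, map_smul,
      LinearMap.smul_apply, lamProj_of_mem hY]
    split_ifs with h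
    · rw [h]
    · simp
  exact LinearMap.congr_fun this X

lemma lamProj_rot (p : ℕ) (m : Fin n → Fin n → 𝕜) (X : Lam 𝕜 n) :
    lamProj p (rot m X) = rot m (lamProj p X) := by
  have : lamProj p ∘ₗ rot m = rot m ∘ₗ (lamProj p : Lam 𝕜 n →ₗ[𝕜] Lam 𝕜 n) := by
    refine lam_hom_ext_degree fun q Y hY => ?_
    simp only [LinearMap.comp_apply, lamProj_of_mem (rot_mem m hY), lamProj_of_mem hY]
    split_ifs <;> simp
  exact LinearMap.congr_fun this X

lemma lamProj_map (T : (Fin n → 𝕜) →ₗ[𝕜] (Fin n → 𝕜)) (p : ℕ) (X : Lam 𝕜 n) :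
    lamProj p (ExteriorAlgebra.map T X) = ExteriorAlgebra.map T (lamProj p X) := by
  have : lamProj p ∘ₗ (ExteriorAlgebra.map T).toLinearMap
      = (ExteriorAlgebra.map T).toLinearMap ∘ₗ (lamProj p : Lam 𝕜 n →ₗ[𝕜] Lam 𝕜 n) := by
    refine lam_hom_ext_degree fun q Y hY => ?_
    simp only [LinearMap.comp_apply, AlgHom.toLinearMap_apply, lamProj_of_mem (map_mem_degree T hY),
      lamProj_of_mem hY]
    split_ifs <;> simp
  exact LinearMap.congr_fun this X

/-! ### The metric on forms -/

/-- The interior product with a form, in reversed order. -/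
def contrForm (η : Fin n → ℤˣ) : Lam 𝕜 n →ₐ[𝕜] Module.End 𝕜 (Lam 𝕜 n) :=
  ExteriorAlgebra.lift 𝕜 ⟨contrSharp η, contrSharp_sq⟩

/-- The reversal of exterior products. -/
def rev : Lam 𝕜 n →ₗ[𝕜] Lam 𝕜 n := CliffordAlgebra.reverse

lemma rev_mul (X Y : Lam 𝕜 n) : rev (X * Y) = rev Y * rev X := CliffordAlgebra.reverse.map_mul X Y

@[simp] lemma rev_one : rev (1 : Lam 𝕜 n) = 1 := CliffordAlgebra.reverse.map_one

@[simp] lemma rev_coE (a : Fin n) : rev (coE a : Lam 𝕜 n) = coE a :=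
  CliffordAlgebra.reverse_ι _

lemma rev_coE_mul (a : Fin n) (X : Lam 𝕜 n) : rev (coE a * X) = rev X * coE a := by
  rw [rev_mul, rev_coE]

lemma rev_hat (X : Lam 𝕜 n) : rev (hat X) = hat (rev X) :=
  CliffordAlgebra.reverse_involute X

/-- Reversal exchanges contraction from the left with contraction from the right, and these differ
by parity involutions. -/
lemma contr_hat_rev (b : Fin n) (X : Lam 𝕜 n) : contr b (hat (rev X)) = -rev (contr b X) := by
  induction X using lam_induction with
  | one => simp
  | add X Y hX hY => simp only [map_add, hX, hY, neg_add]
  | smul c X hX => simp only [map_smul, hX, smul_neg]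
  | mul a X hX =>
    have h2 : rev (contr b X) = hat (contr b (rev X)) := by
      rw [← neg_neg (rev _), ← hX, contr_hat, neg_neg]
    rw [rev_coE_mul, mul_coE, map_mul, hat_hat, hat_coE, neg_mul, map_neg, contr_coE_mul,
      contr_coE_mul, map_sub, rev_coE_mul, h2, hat_mul_coE]
    split_ifs <;> simp

lemma contr_rev (b : Fin n) (X : Lam 𝕜 n) : contr b (rev X) = -rev (contr b (hat X)) := by
  rw [← contr_hat_rev, rev_hat, hat_hat]

lemma rev_map (T : (Fin n → 𝕜) →ₗ[𝕜] (Fin n → 𝕜)) (X : Lam 𝕜 n) :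
    rev (ExteriorAlgebra.map T X) = ExteriorAlgebra.map T (rev X) := by
  induction X using CliffordAlgebra.left_induction with
  | algebraMap r =>
    simp only [Algebra.algebraMap_eq_smul_one, map_smul, map_one, rev_one]
  | add x y hx hy => simp only [map_add, hx, hy]
  | ι_mul x m hx =>
    have e : ∀ v, rev (ExteriorAlgebra.ι 𝕜 v : Lam 𝕜 n) = ExteriorAlgebra.ι 𝕜 v :=
      fun v => CliffordAlgebra.reverse_ι v
    change rev (ExteriorAlgebra.map T (ExteriorAlgebra.ι 𝕜 m * x))
      = ExteriorAlgebra.map T (rev (ExteriorAlgebra.ι 𝕜 m * x))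
    rw [map_mul, ExteriorAlgebra.map_apply_ι, rev_mul, rev_mul, map_mul, hx, e, e,
      ExteriorAlgebra.map_apply_ι]

lemma contrForm_ι (v : Fin n → 𝕜) : contrForm η (ExteriorAlgebra.ι 𝕜 v) = contrSharp η v :=
  ExteriorAlgebra.lift_ι_apply _ _ _ _

lemma contrForm_coE (a : Fin n) (X : Lam 𝕜 n) :
    contrForm η (coE a) X = sgn 𝕜 η a • contr a X := by
  rw [coE, contrForm_ι, contrSharp_single]; rfl

lemma IsIsom.contrForm_map {T : (Fin n → 𝕜) →ₗ[𝕜] (Fin n → 𝕜)} (hT : IsIsom η T)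
    (X Y : Lam 𝕜 n) : contrForm η (ExteriorAlgebra.map T X) (ExteriorAlgebra.map T Y)
      = ExteriorAlgebra.map T (contrForm η X Y) := by
  induction X using CliffordAlgebra.left_induction generalizing Y with
  | algebraMap r => simp [Algebra.algebraMap_eq_smul_one]
  | add x y hx hy => simp only [map_add, LinearMap.add_apply, hx, hy]
  | ι_mul x m hx =>
    change contrForm η (ExteriorAlgebra.map T (ExteriorAlgebra.ι 𝕜 m * x)) _
      = ExteriorAlgebra.map T (contrForm η (ExteriorAlgebra.ι 𝕜 m * x) Y)
    rw [map_mul, ExteriorAlgebra.map_apply_ι, map_mul, map_mul, Module.End.mul_apply,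
      Module.End.mul_apply, hx, contrForm_ι, contrForm_ι, hT.contrSharp_map]

/-- The metric on forms. -/
def pair (η : Fin n → ℤˣ) (X : Lam 𝕜 n) : Lam 𝕜 n →ₗ[𝕜] 𝕜 :=
  ExteriorAlgebra.algebraMapInv.toLinearMap ∘ₗ contrForm η (rev X)

lemma pair_add_left (X Y Z : Lam 𝕜 n) : pair η (X + Y) Z = pair η X Z + pair η Y Z := by
  simp [pair]

lemma pair_smul_left (c : 𝕜) (X Y : Lam 𝕜 n) : pair η (c • X) Y = c * pair η X Y := by
  simp [pair]

lemma pair_coE_mul (a : Fin n) (X Y : Lam 𝕜 n) :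
    pair η (coE a * X) Y = sgn 𝕜 η a * pair η X (contr a Y) := by
  simp only [pair, rev_coE_mul, map_mul, LinearMap.comp_apply, Module.End.mul_apply,
    contrForm_coE, map_smul, smul_eq_mul]

lemma pair_one (Y : Lam 𝕜 n) : pair η 1 Y = ExteriorAlgebra.algebraMapInv Y := by
  simp [pair]

/-- With `pair_coE_mul` this says that wedge and contraction are mutually adjoint, up to the metric
sign. The induction uses only their anticommutation. -/
lemma pair_contr (b : Fin n) (X Y : Lam 𝕜 n) :
    pair η (contr b X) Y = sgn 𝕜 η b * pair η X (coE b * Y) := by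
  induction X using lam_induction generalizing Y with
  | one =>
    rw [contr_one, pair_one, map_mul]
    simp [pair, coE, ExteriorAlgebra.algebraMapInv]
  | add X Z hX hZ => rw [map_add, pair_add_left, pair_add_left, hX, hZ, mul_add]
  | smul c X hX => rw [map_smul, pair_smul_left, pair_smul_left, hX]; ring
  | mul a X hX =>
    rw [contr_coE_mul, sub_eq_add_neg, ← neg_one_smul 𝕜 (coE a * _), pair_add_left,
      pair_smul_left, pair_coE_mul, hX, pair_coE_mul, contr_coE_mul, map_sub]
    by_cases h : a = b
    · subst h
      simp only [if_true]
      linear_combination -(pair η X Y) * sgn_mul_self 𝕜 η a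
    · rw [if_neg h, if_neg (Ne.symm h)]
      simp only [pair, map_zero, LinearMap.comp_zero, LinearMap.zero_apply]
      ring

/-- By the number operator, a nonzero multiple of `X` is a sum of products with a coframe factor,
and each of these has no scalar part. -/
lemma algebraMapInv_of_degree {p : ℕ} {X : Lam 𝕜 n} (h : X ∈ ⋀[𝕜]^(p + 1) (Fin n → 𝕜)) :
    ExteriorAlgebra.algebraMapInv X = (0 : 𝕜) := by
  rw [← (smul_right_injective _ (Nat.cast_ne_zero.2 p.succ_ne_zero :
    ((p + 1 : ℕ) : 𝕜) ≠ 0)).eq_iff]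
  rw [← map_smul, ← sum_coE_mul_contr h, map_sum, smul_zero]
  refine Finset.sum_eq_zero fun a _ => ?_
  rw [map_mul]
  simp [coE, ExteriorAlgebra.algebraMapInv]

lemma pair_list_prod_of_contr {l : List (Fin n)} {a : Fin n} (ha : a ∈ l) {Y : Lam 𝕜 n}
    (h : contr a Y = 0) : pair η ((l.map coE).prod) Y = 0 := by
  induction l generalizing Y with
  | nil => simp at ha
  | cons b l ih =>
    rw [List.map_cons, List.prod_cons, pair_coE_mul]
    rcases List.mem_cons.1 ha with rfl | hal
    · rw [h]; simp
    · rw [ih hal (by rw [contr_contr, h, map_zero, neg_zero]), mul_zero]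

lemma pair_list_prod_self {l : List (Fin n)} (hl : l.Nodup) :
    pair η ((l.map coE).prod) ((l.map coE).prod) = (l.map (sgn 𝕜 η)).prod := by
  induction l with
  | nil => simp [pair_one]
  | cons b l ih =>
    rw [List.nodup_cons] at hl
    rw [List.map_cons, List.prod_cons, pair_coE_mul, contr_coE_mul, if_pos rfl,
      contr_list_prod hl.1, mul_zero, sub_zero, ih hl.2, List.map_cons, List.prod_cons]

lemma contrForm_mem {p q : ℕ} {X Y : Lam 𝕜 n} (hX : X ∈ ⋀[𝕜]^p (Fin n → 𝕜))
    (hY : Y ∈ ⋀[𝕜]^(p + q) (Fin n → 𝕜)) : contrForm η X Y ∈ ⋀[𝕜]^q (Fin n → 𝕜) := by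
  refine degree_induction (P := fun p X => ∀ q, ∀ Y ∈ ⋀[𝕜]^(p + q) (Fin n → 𝕜),
    contrForm η X Y ∈ ⋀[𝕜]^q (Fin n → 𝕜)) ?_ ?_ ?_ ?_ ?_ hX q Y hY
  · intro q Y hY; simpa using hY
  · intro p q Y _; simp
  · intro p X X' h h' q Y hY
    rw [map_add, LinearMap.add_apply]; exact add_mem (h q Y hY) (h' q Y hY)
  · intro p c X h q Y hY
    rw [map_smul, LinearMap.smul_apply]; exact Submodule.smul_mem _ _ (h q Y hY)
  · intro p a X _ h q Y hY
    rw [map_mul, Module.End.mul_apply, contrForm_coE]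
    refine Submodule.smul_mem _ _ (contr_mem a (h (q + 1) Y ?_))
    rwa [show p + (q + 1) = p + 1 + q by ring]

lemma rev_mem {p : ℕ} {X : Lam 𝕜 n} (h : X ∈ ⋀[𝕜]^p (Fin n → 𝕜)) :
    rev X ∈ ⋀[𝕜]^p (Fin n → 𝕜) := by
  refine degree_induction (P := fun p X => rev X ∈ ⋀[𝕜]^p (Fin n → 𝕜)) ?_ (by simp) ?_ ?_ ?_ h
  · simp
  · intro p X Y hX hY; rw [map_add]; exact add_mem hX hY
  · intro p c X hX; rw [map_smul]; exact Submodule.smul_mem _ _ hX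
  · intro p a X _ hX
    rw [rev_coE_mul, mul_coE, hat_of_degree hX, mul_smul_comm]
    exact Submodule.smul_mem _ _ (coE_mul_mem a hX)

/-- If `A ⊊ C`, contraction leaves a form of positive degree, without scalar part. If `A ⊄ C`, an
index of `A` outside `C` already contracts the product over `C` to zero. -/
lemma pair_coEProd (A C : Finset (Fin n)) : pair η (coEProd A) (coEProd C)
    = if A = C then ((A.sort (· ≤ ·)).map (sgn 𝕜 η)).prod else 0 := by
  split_ifs with h
  · subst h; exact pair_list_prod_self (Finset.sort_nodup _ _)
  · by_cases hAC : A ⊆ C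
    · have hlt := Finset.card_lt_card (hAC.ssubset_of_ne h)
      have h1 : contrForm η (rev (coEProd A)) (coEProd C : Lam 𝕜 n)
          ∈ ⋀[𝕜]^(C.card - A.card - 1 + 1) (Fin n → 𝕜) := by
        refine contrForm_mem (rev_mem (coEProd_mem A)) ?_
        rw [show A.card + (C.card - A.card - 1 + 1) = C.card by omega]
        exact coEProd_mem C
      exact algebraMapInv_of_degree h1
    · obtain ⟨a, ha, haC⟩ := Finset.not_subset.1 hAC
      exact pair_list_prod_of_contr ((Finset.mem_sort _).2 ha)
        (contr_list_prod fun h => haC ((Finset.mem_sort _).1 h))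

lemma pair_coEProd_sum (c : Finset (Fin n) → 𝕜) (A : Finset (Fin n)) :
    pair η (coEProd A) (∑ C, c C • (coEProd C : Lam 𝕜 n))
      = ((A.sort (· ≤ ·)).map (sgn 𝕜 η)).prod * c A := by
  rw [map_sum, Finset.sum_eq_single A]
  · rw [map_smul, pair_coEProd, if_pos rfl, smul_eq_mul, mul_comm]
  · intro C _ hC; rw [map_smul, pair_coEProd, if_neg (Ne.symm hC), smul_zero]
  · simp

/-- Non-degeneracy: the ordered products are orthogonal with squares `±1`. Identities for Dirac
currents are proved by testing against all forms. -/
lemma eq_of_pair_eq {X Y : Lam 𝕜 n} (h : ∀ Z, pair η Z X = pair η Z Y) : X = Y := by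
  apply (lamBasis 𝕜 n).repr.injective
  ext A
  have h1 := h (coEProd A)
  rw [← (lamBasis 𝕜 n).sum_repr X, ← (lamBasis 𝕜 n).sum_repr Y] at h1
  simp only [lamBasis_apply, pair_coEProd_sum] at h1
  refine mul_left_cancel₀ (fun h0 => ?_) h1
  obtain ⟨a, _, ha⟩ := List.mem_map.1 (List.prod_eq_zero_iff.1 h0)
  exact sgn_ne_zero η a ha

lemma IsIsom.pair_map {T : (Fin n → 𝕜) →ₗ[𝕜] (Fin n → 𝕜)} (hT : IsIsom η T) (X Y : Lam 𝕜 n) :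
    pair η (ExteriorAlgebra.map T X) (ExteriorAlgebra.map T Y) = pair η X Y := by
  have e : ∀ Z : Lam 𝕜 n, ExteriorAlgebra.algebraMapInv (ExteriorAlgebra.map T Z)
      = (ExteriorAlgebra.algebraMapInv Z : 𝕜) := fun Z => by
    have : (ExteriorAlgebra.algebraMapInv (R := 𝕜)).comp (ExteriorAlgebra.map T)
        = ExteriorAlgebra.algebraMapInv := by
      refine ExteriorAlgebra.hom_ext (LinearMap.ext fun v => ?_)
      simp [ExteriorAlgebra.algebraMapInv]
    exact DFunLike.congr_fun this Z
  simp only [pair, LinearMap.comp_apply, AlgHom.toLinearMap_apply, rev_map, hT.contrForm_map, e]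

/-! ### The Hodge star -/

lemma hodge_apply (X : Lam 𝕜 n) : hodge η X = contrForm η (rev X) vol := rfl

lemma hodge_mem {p : ℕ} (hp : p ≤ n) {X : Lam 𝕜 n} (h : X ∈ ⋀[𝕜]^p (Fin n → 𝕜)) :
    hodge η X ∈ ⋀[𝕜]^(n - p) (Fin n → 𝕜) := by
  rw [hodge_apply]
  refine contrForm_mem (rev_mem h) ?_
  rw [Nat.add_sub_cancel' hp]
  exact vol_mem

lemma contr_contrForm (a : Fin n) (X Y : Lam 𝕜 n) :
    contr a (contrForm η X Y) = contrForm η (hat X) (contr a Y) := by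
  induction X using lam_induction with
  | one => simp
  | add X Z hX hZ => simp only [map_add, LinearMap.add_apply, hX, hZ]
  | smul c X hX => simp only [map_smul, LinearMap.smul_apply, hX]
  | mul b X hX =>
    simp only [map_mul, hat_coE, map_neg, Module.End.mul_apply, LinearMap.neg_apply, contrForm_coE,
      map_smul, ← hX, neg_mul]
    rw [contr_contr, smul_neg]

/-- This exchange of wedge and contraction turns a current whose derivative is a pure wedge term
into a KY form. -/
lemma hodge_coE_mul (a : Fin n) (X : Lam 𝕜 n) :
    hodge η (coE a * X) = sgn 𝕜 η a • contr a (hodge η (hat X)) := by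
  rw [hodge_apply, hodge_apply, contr_contrForm, rev_coE_mul, rev_hat, hat_hat, map_mul,
    Module.End.mul_apply, contrForm_coE, map_smul]

/-- Invariance of `vol` is a separate hypothesis, since an isometry may reverse the orientation. -/
lemma IsIsom.hodge_map {T : (Fin n → 𝕜) →ₗ[𝕜] (Fin n → 𝕜)} (hT : IsIsom η T)
    (hvol : ExteriorAlgebra.map T vol = (vol : Lam 𝕜 n)) (X : Lam 𝕜 n) :
    hodge η (ExteriorAlgebra.map T X) = ExteriorAlgebra.map T (hodge η X) := by
  rw [hodge_apply, hodge_apply, rev_map]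
  conv_lhs => rw [← hvol]
  exact hT.contrForm_map _ _

lemma rot_rev (m : Fin n → Fin n → 𝕜) (X : Lam 𝕜 n) : rot m (rev X) = rev (rot m X) := by
  induction X using lam_induction with
  | one => simp [rot_one]
  | add X Y hX hY => simp only [map_add, hX, hY]
  | smul c X hX => simp only [map_smul, hX]
  | mul a X hX =>
    have e : rev (rot m (coE a)) = rot m (coE a : Lam 𝕜 n) := by
      rw [rot_coE, map_sum]; simp
    rw [rev_coE_mul, rot_mul, rot_mul, map_add, rev_mul, rev_coE_mul, hX, e]
    abel

lemma IsSkew.rot_contrForm {m : Fin n → Fin n → 𝕜} (h : IsSkew η m) (X Y : Lam 𝕜 n) :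
    rot m (contrForm η X Y) = contrForm η (rot m X) Y + contrForm η X (rot m Y) := by
  induction X using lam_induction generalizing Y with
  | one => simp [rot_one]
  | add X Z hX hZ => simp only [map_add, LinearMap.add_apply, hX, hZ]; abel
  | smul c X hX => simp only [map_smul, LinearMap.smul_apply, hX, smul_add]
  | mul b X hX =>
    have e : contrForm η (rot m (coE b)) (contrForm η X Y)
        + sgn 𝕜 η b • ∑ c, m b c • contr c (contrForm η X Y) = 0 := by
      rw [rot_coE, map_sum, LinearMap.sum_apply, Finset.smul_sum, ← Finset.sum_add_distrib]
      refine Finset.sum_eq_zero fun c _ => ?_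
      rw [map_smul, LinearMap.smul_apply, contrForm_coE, smul_smul, smul_smul, ← add_smul,
        h.mul_eq b c, mul_comm (m c b), add_neg_cancel, zero_smul]
    have e2 : rot m (contr b (contrForm η X Y)) = contr b (rot m (contrForm η X Y))
        - ∑ c, m b c • contr c (contrForm η X Y) := by rw [contr_rot]; abel
    simp only [rot_mul, map_add, map_mul, LinearMap.add_apply, Module.End.mul_apply,
      eq_neg_of_add_eq_zero_left e]
    rw [contrForm_coE, map_smul, e2, hX]
    simp only [contrForm_coE, map_add, smul_sub, smul_add]
    abel

lemma coE_mul_vol (a : Fin n) : (coE a * vol : Lam 𝕜 n) = 0 :=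
  eq_zero_of_lt_degree n.lt_succ_self (coE_mul_mem a vol_mem)

/-- On forms of top degree `rot m` acts by the trace, and a skew matrix has zero diagonal. -/
lemma IsSkew.rot_vol {m : Fin n → Fin n → 𝕜} (h : IsSkew η m) : rot m (vol : Lam 𝕜 n) = 0 := by
  have h0 : ∀ b, m b b = 0 := fun b => by
    have := h b b
    rw [eq_neg_iff_add_eq_zero, ← two_mul] at this
    simpa [sgn_ne_zero] using this
  rw [rot_apply]
  refine Finset.sum_eq_zero fun b _ => Finset.sum_eq_zero fun c _ => ?_
  rw [coE_mul_contr, coE_mul_vol, map_zero, sub_zero]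
  split_ifs with hbc
  · rw [hbc, h0, zero_smul]
  · rw [smul_zero]

lemma IsSkew.rot_hodge {m : Fin n → Fin n → 𝕜} (h : IsSkew η m) (X : Lam 𝕜 n) :
    rot m (hodge η X) = hodge η (rot m X) := by
  rw [hodge_apply, h.rot_contrForm, h.rot_vol, map_zero, add_zero, rot_rev, hodge_apply]

end Pairing

/-! ### The Clifford action of forms on spinors. -/

section Clifford

variable {n : ℕ} {𝕜 : Type*} [RCLike 𝕜] {η : Fin n → ℤˣ}
  {S : Type*} [NormedAddCommGroup S] [NormedSpace ℝ S] [NormedSpace 𝕜 S] [IsScalarTower ℝ 𝕜 S]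
  (ρ : CliffordAlgebra (quadForm ℝ η) →ₐ[ℝ] Module.End 𝕜 S)

/-! ### The Clifford action of forms -/

/-- The compatibility required by the `changeForm` lemmas when they are applied to the inverse of
`equivExterior`, which passes from the zero form to `quadForm`. -/
lemma toQuadraticMap_neg_associated [Invertible (2 : 𝕜)] :
    LinearMap.BilinMap.toQuadraticMap (-QuadraticMap.associated (R := 𝕜) (-quadForm 𝕜 η))
      = quadForm 𝕜 η - 0 :=
  CliffordAlgebra.changeForm.neg_proof CliffordAlgebra.changeForm.associated_neg_proof

@[simp] lemma cliff_one : cliff ρ (1 : Lam 𝕜 n) = 1 := by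
  let : Invertible (2 : 𝕜) := invertibleOfNonzero two_ne_zero
  have : (CliffordAlgebra.equivExterior (quadForm 𝕜 η)).symm 1 = 1 :=
    CliffordAlgebra.changeForm_one toQuadraticMap_neg_associated
  unfold cliff
  simp only [LinearMap.comp_apply, LinearEquiv.coe_coe, AlgHom.toLinearMap_apply, this, map_one]

lemma associated_quadForm_apply [Invertible (2 : 𝕜)] (v w : Fin n → 𝕜) :
    QuadraticMap.associated (R := 𝕜) (-quadForm 𝕜 η) v w = -bil η v w := by
  have h2 := LinearMap.congr_fun (LinearMap.congr_fun
    (QuadraticMap.two_nsmul_associated 𝕜 (-quadForm 𝕜 η)) v) w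
  have h3 : (2 : 𝕜) * QuadraticMap.associated (R := 𝕜) (-quadForm 𝕜 η) v w
      = 2 * -bil η v w := by
    rw [two_mul, ← two_nsmul]
    refine h2.trans ?_
    simp only [QuadraticMap.polarBilin_apply_apply, QuadraticMap.polar, neg_apply,
      quadForm, QuadraticMap.weightedSumSquares_apply, Pi.add_apply, smul_eq_mul, bil,
      ← Finset.sum_sub_distrib, ← Finset.sum_neg_distrib, Finset.mul_sum]
    exact Finset.sum_congr rfl fun a _ => by ring
  exact mul_left_cancel₀ two_ne_zero h3

lemma contrSharp_eq_neg_associated [Invertible (2 : 𝕜)] (v : Fin n → 𝕜) (X : Lam 𝕜 n) :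
    contrSharp η v X = CliffordAlgebra.contractLeft
      ((-QuadraticMap.associated (R := 𝕜) (-quadForm 𝕜 η)) v) X := by
  rw [contrSharp_eq]
  congr 2
  refine LinearMap.ext fun w => ?_
  rw [LinearMap.neg_apply, LinearMap.neg_apply, associated_quadForm_apply, neg_neg]
  simp [bil, LinearMap.sum_apply, mul_comm]

/-- The quantization rule `v.X = v ∧ X + i_v X`, read off from the recursion for `changeForm`. -/
lemma cliff_ι_mul (v : Fin n → 𝕜) (X : Lam 𝕜 n) : cliff ρ (ExteriorAlgebra.ι 𝕜 v * X)
    = gamLin ρ v * cliff ρ X - cliff ρ (contrSharp η v X) := by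
  let : Invertible (2 : 𝕜) := invertibleOfNonzero two_ne_zero
  rw [contrSharp_eq_neg_associated]
  unfold cliff
  simp only [LinearMap.comp_apply, LinearEquiv.coe_coe, AlgHom.toLinearMap_apply]
  have h1 : (CliffordAlgebra.equivExterior (quadForm 𝕜 η)).symm (ExteriorAlgebra.ι 𝕜 v * X)
      = CliffordAlgebra.ι (quadForm 𝕜 η) v * (CliffordAlgebra.equivExterior (quadForm 𝕜 η)).symm X
        - CliffordAlgebra.contractLeft ((-QuadraticMap.associated (R := 𝕜) (-quadForm 𝕜 η)) v)
          ((CliffordAlgebra.equivExterior (quadForm 𝕜 η)).symm X) :=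
    CliffordAlgebra.changeForm_ι_mul toQuadraticMap_neg_associated v X
  have h2 : (CliffordAlgebra.equivExterior (quadForm 𝕜 η)).symm (CliffordAlgebra.contractLeft
      ((-QuadraticMap.associated (R := 𝕜) (-quadForm 𝕜 η)) v) X)
      = CliffordAlgebra.contractLeft ((-QuadraticMap.associated (R := 𝕜) (-quadForm 𝕜 η)) v)
          ((CliffordAlgebra.equivExterior (quadForm 𝕜 η)).symm X) :=
    CliffordAlgebra.changeForm_contractLeft toQuadraticMap_neg_associated _ X
  rw [h1, h2, map_sub, map_mul, CliffordAlgebra.lift_ι_apply]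

lemma gamLin_single (a : Fin n) : gamLin ρ (Pi.single a (1 : 𝕜)) = gamUp ρ a := by
  unfold gamLin
  rw [LinearMap.sum_apply, Finset.sum_eq_single a]
  · simp
  · intro b _ hb; simp [hb]
  · simp

lemma gam_eq (a : Fin n) : gam ρ a = sgn 𝕜 η a • gamUp ρ a := by
  rw [gamUp, smul_smul, sgn_mul_self, one_smul]

lemma cliff_coE_mul (a : Fin n) (X : Lam 𝕜 n) : cliff ρ (coE a * X)
    = gamUp ρ a * cliff ρ X - sgn 𝕜 η a • cliff ρ (contr a X) := by
  rw [coE, cliff_ι_mul, gamLin_single, contrSharp_single, LinearMap.smul_apply, map_smul]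

lemma gamUp_mul_cliff (a : Fin n) (X : Lam 𝕜 n) : gamUp ρ a * cliff ρ X
    = cliff ρ (coE a * X + sgn 𝕜 η a • contr a X) := by
  rw [map_add, cliff_coE_mul, map_smul, sub_add_cancel]

/-- Induction on exterior forms, by left Clifford multiplication with coframe elements. -/
lemma lam_induction_clifford (η : Fin n → ℤˣ) {P : Lam 𝕜 n → Prop} (one : P 1)
    (add : ∀ X Y, P X → P Y → P (X + Y)) (smul : ∀ (c : 𝕜) X, P X → P (c • X))
    (mul : ∀ a X, P X → P (coE a * X + sgn 𝕜 η a • contr a X)) (X : Lam 𝕜 n) : P X := by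
  let : Invertible (2 : 𝕜) := invertibleOfNonzero two_ne_zero
  obtain ⟨y, rfl⟩ := (CliffordAlgebra.equivExterior (quadForm 𝕜 η)).surjective X
  induction y using CliffordAlgebra.left_induction with
  | algebraMap r =>
    have : CliffordAlgebra.equivExterior (quadForm 𝕜 η) (algebraMap 𝕜 _ r)
        = algebraMap 𝕜 (Lam 𝕜 n) r :=
      CliffordAlgebra.changeForm_algebraMap CliffordAlgebra.changeForm.associated_neg_proof r
    rw [this, Algebra.algebraMap_eq_smul_one]
    exact smul _ _ one
  | add x y hx hy => rw [map_add]; exact add _ _ hx hy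
  | ι_mul x v hx =>
    have : CliffordAlgebra.equivExterior (quadForm 𝕜 η) (CliffordAlgebra.ι _ v * x)
        = ExteriorAlgebra.ι 𝕜 v * CliffordAlgebra.equivExterior (quadForm 𝕜 η) x
          - CliffordAlgebra.contractLeft (QuadraticMap.associated (R := 𝕜) (-quadForm 𝕜 η) v)
            (CliffordAlgebra.equivExterior (quadForm 𝕜 η) x) :=
      CliffordAlgebra.changeForm_ι_mul CliffordAlgebra.changeForm.associated_neg_proof v x
    have e2 : CliffordAlgebra.equivExterior (quadForm 𝕜 η) (CliffordAlgebra.ι _ v * x)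
        = ∑ a, v a • (coE a * CliffordAlgebra.equivExterior (quadForm 𝕜 η) x
          + sgn 𝕜 η a • contr a (CliffordAlgebra.equivExterior (quadForm 𝕜 η) x)) := by
      rw [this, sub_eq_add_neg, ← LinearMap.neg_apply, ← map_neg, ← LinearMap.neg_apply,
        ← contrSharp_eq_neg_associated, ι_eq_sum, Finset.sum_mul]
      simp [contrSharp, LinearMap.sum_apply, Finset.sum_add_distrib]
    rw [e2]
    refine Finset.sum_induction _ P add ?_ fun a _ => smul _ _ (mul _ _ hx)
    simpa using smul 0 _ one

/-- Left and right Clifford multiplications commute, so Clifford induction on `X` reduces the rule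
for right multiplication to the case `X = 1`. -/
lemma cliff_mul_gamUp (a : Fin n) (X : Lam 𝕜 n) : cliff ρ X * gamUp ρ a
    = cliff ρ (coE a * hat X - sgn 𝕜 η a • contr a (hat X)) := by
  induction X using lam_induction_clifford η with
  | one =>
    have := gamUp_mul_cliff ρ a (1 : Lam 𝕜 n)
    simp only [contr_one, smul_zero, add_zero, cliff_one, mul_one] at this
    simp [this]
  | add X Y hX hY => simp only [map_add, add_mul, mul_add, hX, hY, smul_add, map_sub]; abel
  | smul c X hX =>
    simp only [map_smul, smul_mul_assoc, hX, mul_smul_comm, map_sub, smul_sub, smul_comm c]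
  | mul c X hX =>
    rw [← gamUp_mul_cliff, mul_assoc, hX, gamUp_mul_cliff]
    congr 1
    have e : hat (coE c * X + sgn 𝕜 η c • contr c X)
        = -(coE c * hat X) - sgn 𝕜 η c • contr c (hat X) := by
      rw [map_add, map_mul, hat_coE, map_smul, contr_hat, smul_neg]; simp
    rw [e]
    simp only [mul_sub, map_sub, map_neg, map_smul, mul_neg, mul_smul_comm, contr_coE_mul,
      coE_mul_coE_mul a c, contr_contr a c, smul_sub, smul_neg, neg_neg, smul_comm (sgn 𝕜 η a)]
    by_cases h : a = c
    · subst h; simp only [if_true]; abel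
    · rw [if_neg h, if_neg (Ne.symm h)]; simp only [smul_zero]; abel

lemma gam_mul_cliff (a : Fin n) (X : Lam 𝕜 n) : gam ρ a * cliff ρ X
    = cliff ρ (sgn 𝕜 η a • (coE a * X) + contr a X) := by
  rw [gam_eq, smul_mul_assoc, gamUp_mul_cliff, ← map_smul, smul_add, smul_smul, sgn_mul_self,
    one_smul]

lemma cliff_mul_gam (a : Fin n) (X : Lam 𝕜 n) : cliff ρ X * gam ρ a
    = cliff ρ (sgn 𝕜 η a • (coE a * hat X) - contr a (hat X)) := by
  rw [gam_eq, mul_smul_comm, cliff_mul_gamUp, ← map_smul, smul_sub, smul_smul, sgn_mul_self,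
    one_smul]

/-- The action on spinors of the infinitesimal rotation with matrix `m`. -/
def spinRot (m : Fin n → Fin n → 𝕜) : Module.End 𝕜 S :=
  (1 / 4 : 𝕜) • ∑ b, ∑ c, m b c • (gamUp ρ b * gam ρ c)

/-- The algebraic identity behind the compatibility of the spin connection with the connection on
forms. -/
lemma IsSkew.four_rot_eq {m : Fin n → Fin n → 𝕜} (h : IsSkew η m) (X : Lam 𝕜 n) :
    ∑ b, ∑ c, m b c • ((coE b * (sgn 𝕜 η c • (coE c * X) + contr c X)
        + sgn 𝕜 η b • contr b (sgn 𝕜 η c • (coE c * X) + contr c X))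
      + (sgn 𝕜 η c • (coE c * (coE b * X - sgn 𝕜 η b • contr b X))
        - contr c (coE b * X - sgn 𝕜 η b • contr b X))) = (4 : 𝕜) • rot m X := by
  have key : ∀ b c, (coE b * (sgn 𝕜 η c • (coE c * X) + contr c X)
        + sgn 𝕜 η b • contr b (sgn 𝕜 η c • (coE c * X) + contr c X))
      + (sgn 𝕜 η c • (coE c * (coE b * X - sgn 𝕜 η b • contr b X))
        - contr c (coE b * X - sgn 𝕜 η b • contr b X))
      = (2 : 𝕜) • (coE b * contr c X)
        - (2 * (sgn 𝕜 η b * sgn 𝕜 η c)) • (coE c * contr b X) := fun b c => by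
    simp only [mul_add, mul_sub, map_add, map_sub, map_smul, mul_smul_comm, contr_coE_mul,
      coE_mul_coE_mul c b, contr_contr c b, smul_add, smul_sub, smul_neg, mul_smul, two_smul,
      smul_comm (sgn 𝕜 η c)]
    by_cases hbc : b = c
    · subst hbc
      simp only [if_true, ← mul_smul, sgn_mul_self, one_smul]; abel
    · rw [if_neg hbc, if_neg (Ne.symm hbc)]; simp only [smul_zero]; abel
  simp only [key, smul_sub, Finset.sum_sub_distrib]
  -- Relabelling the indices and using skewness turns the second term into another `2 rot m X`,
  -- whence the total factor 4.
  have e : ∑ b, ∑ c, m b c • (2 * (sgn 𝕜 η b * sgn 𝕜 η c)) • (coE c * contr b X)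
      = -((2 : 𝕜) • rot m X) := by
    rw [Finset.sum_comm, rot_apply, Finset.smul_sum, ← Finset.sum_neg_distrib]
    refine Finset.sum_congr rfl fun c _ => ?_
    rw [Finset.smul_sum, ← Finset.sum_neg_distrib]
    refine Finset.sum_congr rfl fun b _ => ?_
    rw [smul_smul, smul_smul, ← neg_smul]
    congr 1
    linear_combination (2 * sgn 𝕜 η b) * h b c - 2 * m c b * sgn_mul_self 𝕜 η b
  rw [e, rot_apply]
  simp only [Finset.smul_sum, smul_comm (m _ _)]
  rw [sub_neg_eq_add, ← Finset.sum_add_distrib]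
  refine Finset.sum_congr rfl fun b _ => ?_
  rw [← Finset.sum_add_distrib]
  refine Finset.sum_congr rfl fun c _ => ?_
  rw [← add_smul]
  norm_num

/-- The factor `1/4` in `spinRot` is exactly what makes this commutator equal to `rot m`. The
Leibniz rule for the Clifford action and the covariance of currents both rest on it. -/
lemma IsSkew.spinRot_cliff {m : Fin n → Fin n → 𝕜} (h : IsSkew η m) (X : Lam 𝕜 n) :
    spinRot ρ m * cliff ρ X - cliff ρ X * spinRot ρ m = cliff ρ (rot m X) := by
  have e1 : ∀ b c, gamUp ρ b * gam ρ c * cliff ρ X - cliff ρ X * (gamUp ρ b * gam ρ c)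
      = cliff ρ ((coE b * (sgn 𝕜 η c • (coE c * X) + contr c X)
        + sgn 𝕜 η b • contr b (sgn 𝕜 η c • (coE c * X) + contr c X))
      + (sgn 𝕜 η c • (coE c * (coE b * X - sgn 𝕜 η b • contr b X))
        - contr c (coE b * X - sgn 𝕜 η b • contr b X))) := fun b c => by
    have e : hat (coE b * hat X - sgn 𝕜 η b • contr b (hat X))
        = -(coE b * X - sgn 𝕜 η b • contr b X) := by
      rw [map_sub, map_mul, hat_coE, hat_hat, map_smul, contr_hat, map_neg, hat_hat]
      simp only [neg_mul, smul_neg]; abel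
    rw [mul_assoc, gam_mul_cliff, gamUp_mul_cliff, ← mul_assoc, cliff_mul_gamUp, cliff_mul_gam,
      e, ← map_sub]
    congr 1
    simp only [mul_neg, smul_neg, map_neg]
    abel
  have e2 : spinRot ρ m * cliff ρ X - cliff ρ X * spinRot ρ m = (1 / 4 : 𝕜) •
      ∑ b, ∑ c, m b c • (gamUp ρ b * gam ρ c * cliff ρ X
        - cliff ρ X * (gamUp ρ b * gam ρ c)) := by
    simp only [spinRot, smul_mul_assoc, mul_smul_comm, Finset.sum_mul, Finset.mul_sum, smul_sub,
      Finset.sum_sub_distrib]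
  have e3 : ∑ b, ∑ c, m b c • (gamUp ρ b * gam ρ c * cliff ρ X
      - cliff ρ X * (gamUp ρ b * gam ρ c)) = cliff ρ ((4 : 𝕜) • rot m X) := by
    rw [← h.four_rot_eq, map_sum]
    refine Finset.sum_congr rfl fun b _ => ?_
    rw [map_sum]
    refine Finset.sum_congr rfl fun c _ => ?_
    rw [map_smul, e1]
  rw [e2, e3, map_smul, smul_smul]
  norm_num

end Clifford

/-! ### Dirac currents of all degrees and their transposition rules. -/

section Currents

variable {n : ℕ} {𝕜 : Type*} [RCLike 𝕜] {η : Fin n → ℤˣ}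
  {S : Type*} [NormedAddCommGroup S] [NormedSpace ℝ S] [NormedSpace 𝕜 S] [IsScalarTower ℝ 𝕜 S]
  (ρ : CliffordAlgebra (quadForm ℝ η) →ₐ[ℝ] Module.End 𝕜 S)

lemma IsSkew.diag_eq_zero {m : Fin n → Fin n → 𝕜} (h : IsSkew η m) (b : Fin n) : m b b = 0 := by
  have := h b b
  rw [eq_neg_iff_add_eq_zero, ← two_mul] at this
  simpa [sgn_ne_zero] using this

lemma cliff_coE (a : Fin n) : cliff ρ (coE a : Lam 𝕜 n) = gamUp ρ a := by
  have := cliff_coE_mul ρ a (1 : Lam 𝕜 n)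
  simpa using this

lemma IsSkew.spinRot_gamUp {m : Fin n → Fin n → 𝕜} (h : IsSkew η m) (a : Fin n) :
    spinRot ρ m * gamUp ρ a - gamUp ρ a * spinRot ρ m = ∑ b, m b a • gamUp ρ b := by
  rw [← cliff_coE, h.spinRot_cliff, rot_coE, map_sum]
  simp only [map_smul, cliff_coE]

lemma IsSkew.spinRot_gam {m : Fin n → Fin n → 𝕜} (h : IsSkew η m) (a : Fin n) :
    spinRot ρ m * gam ρ a - gam ρ a * spinRot ρ m = -∑ b, m a b • gam ρ b := by
  rw [gam_eq ρ a, mul_smul_comm, smul_mul_assoc, ← smul_sub, h.spinRot_gamUp, Finset.smul_sum,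
    ← Finset.sum_neg_distrib]
  refine Finset.sum_congr rfl fun b _ => ?_
  rw [gamUp, smul_smul, smul_smul, ← neg_smul]
  congr 1
  linear_combination (sgn 𝕜 η a) * h.mul_eq b a - m a b * sgn_mul_self 𝕜 η a

/-- The commutator with `spinRot m` is a derivation, so it acts on each product in `spinRot m'`
factor by factor. This is the hypothesis of the Ricci identity for spinors. -/
lemma IsSkew.spinRot_spinRot {m : Fin n → Fin n → 𝕜} (h : IsSkew η m) (m' : Fin n → Fin n → 𝕜) :
    spinRot ρ m * spinRot ρ m' - spinRot ρ m' * spinRot ρ m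
      = spinRot ρ (fun b c => ∑ f, (m b f * m' f c - m' b f * m f c)) := by
  have e1 : ∀ b c, spinRot ρ m * (gamUp ρ b * gam ρ c) - gamUp ρ b * gam ρ c * spinRot ρ m
      = ∑ f, m f b • (gamUp ρ f * gam ρ c) - ∑ f, m c f • (gamUp ρ b * gam ρ f) := fun b c => by
    have : spinRot ρ m * (gamUp ρ b * gam ρ c) - gamUp ρ b * gam ρ c * spinRot ρ m
        = (spinRot ρ m * gamUp ρ b - gamUp ρ b * spinRot ρ m) * gam ρ c
          + gamUp ρ b * (spinRot ρ m * gam ρ c - gam ρ c * spinRot ρ m) := by noncomm_ring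
    rw [this, h.spinRot_gamUp, h.spinRot_gam]
    simp only [Finset.sum_mul, Finset.mul_sum, smul_mul_assoc, mul_smul_comm, mul_neg,
      sub_eq_add_neg]
  have e2 : spinRot ρ m * spinRot ρ m' - spinRot ρ m' * spinRot ρ m
      = (1 / 4 : 𝕜) • ∑ b, ∑ c, m' b c • (spinRot ρ m * (gamUp ρ b * gam ρ c)
        - gamUp ρ b * gam ρ c * spinRot ρ m) := by
    conv_lhs => rw [show spinRot ρ m' = (1 / 4 : 𝕜) • ∑ b, ∑ c, m' b c • (gamUp ρ b * gam ρ c)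
      from rfl]
    simp only [smul_mul_assoc, mul_smul_comm, Finset.sum_mul, Finset.mul_sum, smul_sub,
      Finset.sum_sub_distrib]
  rw [e2, show spinRot ρ (fun b c => ∑ f, (m b f * m' f c - m' b f * m f c))
    = (1 / 4 : 𝕜) • ∑ b, ∑ c, (∑ f, (m b f * m' f c - m' b f * m f c)) •
      (gamUp ρ b * gam ρ c) from rfl]
  congr 1
  simp only [e1, smul_sub, Finset.sum_sub_distrib, Finset.smul_sum, smul_smul, sub_smul,
    Finset.sum_smul]
  congr 1
  · rw [Finset.sum_comm]
    rw [Finset.sum_comm (f := fun b c => ∑ f, (m b f * m' f c) • (gamUp ρ b * gam ρ c))]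
    refine Finset.sum_congr rfl fun c _ => ?_
    rw [Finset.sum_comm]
    exact Finset.sum_congr rfl fun f _ => Finset.sum_congr rfl fun b _ => by rw [mul_comm]
  · refine Finset.sum_congr rfl fun b _ => ?_
    rw [Finset.sum_comm]

/-! ### The total current -/

variable {ρ} {σ : 𝕜 →+* 𝕜} (B : SpinorInner ρ σ)

lemma SpinorInner.map_ofReal (B : SpinorInner ρ σ) (r : ℝ) : σ (r : 𝕜) = r := by
  rcases B.conj_type with h | h
  · rw [h]; rfl
  · rw [h]; exact RCLike.conj_ofReal r

lemma SpinorInner.adjoint_gamUp (a : Fin n) (ψ φ : S) :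
    B.form (gamUp ρ a ψ) φ = ((B.ε : ℤ) : 𝕜) * B.form ψ (gamUp ρ a φ) := by
  have : σ (sgn 𝕜 η a) = sgn 𝕜 η a := by simp [sgn]
  rw [gamUp, LinearMap.smul_apply, map_smulₛₗ, LinearMap.smul_apply, B.adjoint, this,
    LinearMap.smul_apply, map_smul, smul_eq_mul, smul_eq_mul]
  ring

lemma SpinorInner.ε_mul_self : ((B.ε : ℤ) : 𝕜) * ((B.ε : ℤ) : 𝕜) = 1 := by
  rw [← Int.cast_mul, Int.units_coe_mul_self, Int.cast_one]

/-- The inhomogeneous Dirac current. -/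
def totalCurrent (ψ φ : S) : Lam 𝕜 n :=
  ∑ A : Finset (Fin n), B.form ψ (((A.sort (· ≥ ·)).map (gam ρ)).prod φ) • coEProd A

lemma lamProj_totalCurrent (p : ℕ) (ψ φ : S) :
    lamProj p (totalCurrent B ψ φ) = currentLam B p ψ φ := by
  unfold totalCurrent currentLam
  rw [map_sum, Finset.powersetCard_eq_filter, Finset.powerset_univ, Finset.sum_filter]
  refine Finset.sum_congr rfl fun A _ => ?_
  rw [map_smul, lamProj_of_mem (coEProd_mem A), smul_ite, smul_zero]
  rfl

/-- For distinct indices every contraction term vanishes and the exterior product acts as the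
Clifford product; the signs come from `gamUp` against `gam`. -/
lemma cliff_rev_list_prod {l : List (Fin n)} (hl : l.Nodup) :
    cliff ρ (rev ((l.map coE).prod : Lam 𝕜 n))
      = (l.map (sgn 𝕜 η)).prod • (l.reverse.map (gam ρ)).prod := by
  induction l with
  | nil => simp
  | cons a l ih =>
    rw [List.nodup_cons] at hl
    have h1 := cliff_mul_gamUp ρ a (rev ((l.map coE).prod : Lam 𝕜 n))
    rw [contr_hat_rev, contr_list_prod hl.1, map_zero, neg_zero, smul_zero, sub_zero, ← mul_coE,
      ← rev_coE_mul, ih hl.2] at h1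
    rw [List.map_cons, List.prod_cons, ← h1, List.reverse_cons, List.map_append, List.prod_append,
      List.map_cons, List.prod_cons, gamUp, mul_smul_comm, smul_mul_assoc, smul_smul]
    simp

lemma sort_ge_eq_reverse (A : Finset (Fin n)) :
    A.sort (· ≥ ·) = (A.sort (· ≤ ·)).reverse := by
  refine List.Perm.eq_of_pairwise (le := (· ≥ ·)) (fun a b _ _ h h' => le_antisymm h' h)
    (A.pairwise_sort (· ≥ ·)) ?_ ?_
  · rw [List.pairwise_reverse]; exact A.pairwise_sort (· ≤ ·)
  · exact ((A.sort_perm_toList _).trans (A.sort_perm_toList _).symm).trans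
      (List.reverse_perm _).symm

/-- By non-degeneracy of `pair` this characterises the current without a basis. Operations on the
spinors can then be transposed to operations on the test form `X`. -/
lemma pair_totalCurrent (X : Lam 𝕜 n) (ψ φ : S) :
    pair η X (totalCurrent B ψ φ) = B.form ψ (cliff ρ (rev X) φ) := by
  let f : Lam 𝕜 n →ₗ[𝕜] 𝕜 :=
    { toFun := fun X => pair η X (totalCurrent B ψ φ)
      map_add' := fun X Y => pair_add_left X Y _
      map_smul' := fun c X => pair_smul_left c X _ }
  let g : Lam 𝕜 n →ₗ[𝕜] 𝕜 :=
    { toFun := fun X => B.form ψ (cliff ρ (rev X) φ)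
      map_add' := fun X Y => by simp
      map_smul' := fun c X => by simp }
  have : f = g := by
    refine (lamBasis 𝕜 n).ext fun A => ?_
    change pair η (lamBasis 𝕜 n A) _ = B.form ψ (cliff ρ (rev (lamBasis 𝕜 n A)) φ)
    rw [lamBasis_apply, totalCurrent, pair_coEProd_sum, coEProd,
      cliff_rev_list_prod (A.sort_nodup _), sort_ge_eq_reverse, LinearMap.smul_apply, map_smul,
      smul_eq_mul]
  exact LinearMap.congr_fun this X

lemma pair_hat (X Y : Lam 𝕜 n) : pair η (hat X) Y = pair η X (hat Y) := by
  induction X using lam_induction generalizing Y with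
  | one =>
    rw [map_one, pair_one, pair_one]
    have : (ExteriorAlgebra.algebraMapInv (R := 𝕜)).comp hat
        = (ExteriorAlgebra.algebraMapInv : Lam 𝕜 n →ₐ[𝕜] 𝕜) := by
      refine ExteriorAlgebra.hom_ext (LinearMap.ext fun v => ?_)
      have e : hat (ExteriorAlgebra.ι 𝕜 v) = -ExteriorAlgebra.ι 𝕜 v :=
        CliffordAlgebra.involute_ι v
      simp only [LinearMap.comp_apply, AlgHom.toLinearMap_apply, AlgHom.comp_apply, e, map_neg]
      simp [ExteriorAlgebra.algebraMapInv]
    exact (DFunLike.congr_fun this Y).symm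
  | add X Z hX hZ => rw [map_add, pair_add_left, pair_add_left, hX, hZ]
  | smul c X hX => rw [map_smul, pair_smul_left, pair_smul_left, hX]
  | mul b X hX =>
    rw [map_mul, hat_coE, neg_mul, ← neg_one_smul 𝕜, pair_smul_left, pair_coE_mul, pair_coE_mul,
      hX, contr_hat, map_neg]
    ring

/-- Clifford multiplication on `φ` becomes right multiplication on `rev Z`, that is, left
multiplication on the test form `Z`. The latter is self-adjoint for `pair`. -/
lemma totalCurrent_gamUp (b : Fin n) (ψ φ : S) : totalCurrent B ψ (gamUp ρ b φ)
    = coE b * totalCurrent B ψ φ + sgn 𝕜 η b • contr b (totalCurrent B ψ φ) := by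
  refine eq_of_pair_eq (η := η) fun Z => ?_
  have e : cliff ρ (rev Z) * gamUp ρ b = cliff ρ (rev (coE b * Z + sgn 𝕜 η b • contr b Z)) := by
    rw [cliff_mul_gamUp, map_add, map_smul, contr_hat_rev, rev_coE_mul, mul_coE, smul_neg,
      sub_neg_eq_add]
  rw [pair_totalCurrent, ← Module.End.mul_apply, e, ← pair_totalCurrent, pair_add_left,
    pair_smul_left, pair_coE_mul, pair_contr, map_add, map_smul, smul_eq_mul]
  linear_combination (pair η Z (coE b * totalCurrent B ψ φ)) * sgn_mul_self 𝕜 η b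

/-- The adjoint moves the Clifford factor to the other slot at the cost of `ε`. It then multiplies
`rev Z` from the left, which is right multiplication on `Z` and hence involves `hat`. -/
lemma totalCurrent_gamUp_left (b : Fin n) (ψ φ : S) : totalCurrent B (gamUp ρ b ψ) φ
    = ((B.ε : ℤ) : 𝕜) • (coE b * hat (totalCurrent B ψ φ)
      - sgn 𝕜 η b • contr b (hat (totalCurrent B ψ φ))) := by
  refine eq_of_pair_eq (η := η) fun Z => ?_
  have e : gamUp ρ b * cliff ρ (rev Z)
      = cliff ρ (rev (coE b * hat Z + (-sgn 𝕜 η b) • contr b (hat Z))) := by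
    have e1 : rev (coE b * hat Z) = coE b * rev Z := by rw [rev_coE_mul, rev_hat, hat_mul_coE]
    simp only [gamUp_mul_cliff, contr_rev, map_add, map_smul, e1, neg_smul, smul_neg, map_neg]
  rw [pair_totalCurrent, B.adjoint_gamUp, ← Module.End.mul_apply, e, ← pair_totalCurrent,
    pair_add_left, pair_smul_left, pair_coE_mul, pair_contr, pair_hat, pair_hat]
  simp only [map_smul, map_sub, map_mul, hat_coE, neg_mul, map_neg, contr_hat, smul_eq_mul]
  linear_combination (((B.ε : ℤ) : 𝕜) * pair η Z (coE b * hat (totalCurrent B ψ φ))) *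
    sgn_mul_self 𝕜 η b

lemma algebraMapInv_rot (m : Fin n → Fin n → 𝕜) (X : Lam 𝕜 n) :
    ExteriorAlgebra.algebraMapInv (rot m X) = (0 : 𝕜) := by
  simp [rot_apply, coE, ExteriorAlgebra.algebraMapInv]

lemma IsSkew.pair_rot {m : Fin n → Fin n → 𝕜} (h : IsSkew η m) (X Y : Lam 𝕜 n) :
    pair η (rot m X) Y = -pair η X (rot m Y) := by
  rw [eq_neg_iff_add_eq_zero]
  simp only [pair, LinearMap.comp_apply, AlgHom.toLinearMap_apply, ← rot_rev]
  rw [← map_add, ← h.rot_contrForm, algebraMapInv_rot]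

/-- Two adjoints give `ε² = 1`, and reversing two anticommuting factors gives the sign. So the
spinor inner product is invariant under infinitesimal rotations for either value of `ε`. -/
lemma IsSkew.adjoint_spinRot {m : Fin n → Fin n → 𝕜} (h : IsSkew η m) (hm : ∀ b c, σ (m b c) = m b c)
    (ψ φ : S) : B.form (spinRot ρ m ψ) φ = -B.form ψ (spinRot ρ m φ) := by
  have h4 : σ (1 / 4) = 1 / 4 := by
    rw [map_div₀, map_one, map_ofNat]
  have hterm : ∀ b c, m b c * B.form (gamUp ρ b (gam ρ c ψ)) φ
      = -(m b c * B.form ψ (gamUp ρ b (gam ρ c φ))) := fun b c => by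
    by_cases hbc : b = c
    · rw [hbc, h.diag_eq_zero]; simp
    · have h1 : gam ρ c (gamUp ρ b φ) = -gamUp ρ b (gam ρ c φ) := by
        have := LinearMap.congr_fun (gam_anticomm ρ b c) φ
        rw [if_neg hbc] at this
        simp only [LinearMap.add_apply, Module.End.mul_apply, LinearMap.zero_apply] at this
        rw [gamUp, LinearMap.smul_apply, LinearMap.smul_apply, map_smul, ← smul_neg,
          eq_neg_of_add_eq_zero_right this]
      rw [B.adjoint_gamUp, B.adjoint, h1, map_neg]
      linear_combination (-m b c * B.form ψ (gamUp ρ b (gam ρ c φ))) * B.ε_mul_self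
  simp only [spinRot, LinearMap.smul_apply, LinearMap.sum_apply, Module.End.mul_apply,
    map_smulₛₗ, map_sum, h4, hm, smul_eq_mul, RingHom.id_apply, hterm, Finset.sum_neg_distrib,
    mul_neg]

lemma IsSkew.totalCurrent_spinRot {m : Fin n → Fin n → 𝕜} (h : IsSkew η m)
    (hm : ∀ b c, σ (m b c) = m b c) (ψ φ : S) :
    totalCurrent B (spinRot ρ m ψ) φ + totalCurrent B ψ (spinRot ρ m φ)
      = rot m (totalCurrent B ψ φ) := by
  refine eq_of_pair_eq (η := η) fun Z => ?_
  have e := LinearMap.congr_fun (h.spinRot_cliff ρ (rev Z)) φ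
  simp only [LinearMap.sub_apply, Module.End.mul_apply] at e
  rw [← neg_neg (pair η Z (rot m _)), ← h.pair_rot, map_add, pair_totalCurrent, pair_totalCurrent,
    pair_totalCurrent, h.adjoint_spinRot B hm, ← rot_rev, ← e, map_sub]
  ring

lemma totalCurrent_add_left (ψ ψ' φ : S) :
    totalCurrent B (ψ + ψ') φ = totalCurrent B ψ φ + totalCurrent B ψ' φ := by
  simp [totalCurrent, add_smul, Finset.sum_add_distrib]

lemma totalCurrent_add_right (ψ φ φ' : S) :
    totalCurrent B ψ (φ + φ') = totalCurrent B ψ φ + totalCurrent B ψ φ' := by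
  simp [totalCurrent, add_smul, Finset.sum_add_distrib]

lemma totalCurrent_smul_left (c : 𝕜) (ψ φ : S) :
    totalCurrent B (c • ψ) φ = σ c • totalCurrent B ψ φ := by
  simp [totalCurrent, mul_smul, Finset.smul_sum, map_smulₛₗ]

lemma totalCurrent_smul_right (c : 𝕜) (ψ φ : S) :
    totalCurrent B ψ (c • φ) = c • totalCurrent B ψ φ := by
  simp [totalCurrent, mul_smul, Finset.smul_sum]

/-- The derivative of the Dirac current of two Killing spinors. -/
lemma totalCurrent_killing (lam : 𝕜) (b : Fin n) (ψ φ : S) :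
    totalCurrent B (lam • gamUp ρ b ψ) φ + totalCurrent B ψ (lam • gamUp ρ b φ)
      = coE b * (lam • totalCurrent B ψ φ
          + (((B.ε : ℤ) : 𝕜) * σ lam) • hat (totalCurrent B ψ φ))
        + sgn 𝕜 η b • contr b (lam • totalCurrent B ψ φ
          - (((B.ε : ℤ) : 𝕜) * σ lam) • hat (totalCurrent B ψ φ)) := by
  rw [totalCurrent_smul_left, totalCurrent_smul_right, totalCurrent_gamUp, totalCurrent_gamUp_left]
  simp only [mul_add, map_sub, map_smul, smul_add, smul_sub, mul_smul_comm, smul_smul]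
  rw [mul_comm (σ lam), mul_comm lam, mul_comm (sgn 𝕜 η b) (_ * _), mul_right_comm]
  ac_nf
  abel

end Currents

/-! ### Changes of frame covered by the spin group; invariance of the volume form. -/

section FrameChange

variable {n : ℕ} {𝕜 : Type*} [RCLike 𝕜] {η : Fin n → ℤˣ}
  {S : Type*} [NormedAddCommGroup S] [NormedSpace ℝ S] [NormedSpace 𝕜 S] [IsScalarTower ℝ 𝕜 S]
  (ρ : CliffordAlgebra (quadForm ℝ η) →ₐ[ℝ] Module.End 𝕜 S)

/-- The change from one orthonormal frame to another, with matrix `A`, covered by `u ∈ Spin`. -/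
structure IsFrameChange (η : Fin n → ℤˣ) (A : Fin n → Fin n → ℝ)
    (u : CliffordAlgebra (quadForm ℝ η)) : Prop where
  orth : ∀ b c, ∑ a, sgn ℝ η a * A a b * A a c = if b = c then sgn ℝ η b else 0
  mem : u ∈ spinGroup (quadForm ℝ η)
  intertwine : ∀ b, CliffordAlgebra.ι (quadForm ℝ η) (fun a => A a b) * u
    = u * CliffordAlgebra.ι (quadForm ℝ η) (Pi.single b 1)

/-- The transformation of the components of covectors under a change of frames. -/
def coMap (𝕜 : Type*) [RCLike 𝕜] (η : Fin n → ℤˣ) (A : Fin n → Fin n → ℝ) :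
    (Fin n → 𝕜) →ₗ[𝕜] (Fin n → 𝕜) :=
  LinearMap.pi fun a => ∑ b, (sgn 𝕜 η a * (A a b : 𝕜) * sgn 𝕜 η b) •
    (LinearMap.proj b : (Fin n → 𝕜) →ₗ[𝕜] 𝕜)

lemma coMap_apply (A : Fin n → Fin n → ℝ) (v : Fin n → 𝕜) (a : Fin n) :
    coMap 𝕜 η A v a = ∑ b, sgn 𝕜 η a * (A a b : 𝕜) * sgn 𝕜 η b * v b := by
  simp [coMap, LinearMap.sum_apply]

lemma coMap_single (A : Fin n → Fin n → ℝ) (b : Fin n) :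
    coMap 𝕜 η A (Pi.single b 1) = fun a => sgn 𝕜 η a * (A a b : 𝕜) * sgn 𝕜 η b := by
  funext a
  rw [coMap_apply, Finset.sum_eq_single b]
  · simp
  · intro c _ hc; simp [hc]
  · simp

namespace IsFrameChange

variable {A : Fin n → Fin n → ℝ} {u : CliffordAlgebra (quadForm ℝ η)}

lemma isIsom (h : IsFrameChange η A u) : IsIsom η (coMap 𝕜 η A) := by
  intro v w
  have ho : ∀ b c, ∑ a, sgn 𝕜 η a * (A a b : 𝕜) * (A a c : 𝕜) = if b = c then sgn 𝕜 η b else 0 :=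
    fun b c => by
      have := congrArg (fun r : ℝ => (r : 𝕜)) (h.orth b c)
      simpa [ofReal_sgn, apply_ite] using this
  have e : ∀ a, sgn 𝕜 η a * coMap 𝕜 η A v a * coMap 𝕜 η A w a
      = ∑ b, ∑ c, (sgn 𝕜 η b * v b * (sgn 𝕜 η c * w c)) *
        (sgn 𝕜 η a * (A a b : 𝕜) * (A a c : 𝕜)) := fun a => by
    rw [coMap_apply, coMap_apply, mul_assoc, Finset.sum_mul_sum, Finset.mul_sum]
    refine Finset.sum_congr rfl fun b _ => ?_
    rw [Finset.mul_sum]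
    refine Finset.sum_congr rfl fun c _ => ?_
    linear_combination (sgn 𝕜 η a * (A a b : 𝕜) * sgn 𝕜 η b * v b * (A a c : 𝕜) * sgn 𝕜 η c * w c)
      * sgn_mul_self 𝕜 η a
  unfold bil
  simp only [e]
  rw [Finset.sum_comm]
  refine Finset.sum_congr rfl fun b _ => ?_
  rw [Finset.sum_comm]
  simp only [← Finset.mul_sum, ho, mul_ite, mul_zero, Finset.sum_ite_eq, Finset.mem_univ, if_true]
  linear_combination (sgn 𝕜 η b * v b * w b) * sgn_mul_self 𝕜 η b

/-- An isometry is injective, hence surjective in finite dimension. Test forms can therefore be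
taken in the image. -/
lemma map_surjective (h : IsFrameChange η A u) :
    Function.Surjective (ExteriorAlgebra.map (coMap 𝕜 η A)) := by
  rw [ExteriorAlgebra.map_surjective_iff, ← LinearMap.injective_iff_surjective,
    ← LinearMap.ker_eq_bot, LinearMap.ker_eq_bot']
  intro v hv
  funext a
  have h1 := h.isIsom (𝕜 := 𝕜) v (Pi.single a 1)
  rw [hv] at h1
  unfold bil at h1
  rw [Finset.sum_eq_zero (by simp), Finset.sum_eq_single a (by intro b _ hb; simp [hb]) (by simp)]
    at h1
  simpa [sgn_ne_zero] using h1.symm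

lemma ρ_ι (v : Fin n → ℝ) :
    ρ (CliffordAlgebra.ι (quadForm ℝ η) v) = ∑ a, (v a : 𝕜) • gam ρ a := by
  have : v = ∑ a, v a • (Pi.single a 1 : Fin n → ℝ) := by
    funext b; simp [Finset.sum_apply, Pi.single_apply]
  conv_lhs => rw [this]
  rw [map_sum, map_sum]
  refine Finset.sum_congr rfl fun a _ => ?_
  rw [map_smul, map_smul]
  refine LinearMap.ext fun x => ?_
  simp only [LinearMap.smul_apply]
  exact (algebraMap_smul 𝕜 (v a) _).symm

lemma gamLin_mul (h : IsFrameChange η A u) (v : Fin n → 𝕜) :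
    gamLin ρ (coMap 𝕜 η A v) * ρ u = ρ u * gamLin ρ v := by
  have : (LinearMap.mulRight 𝕜 (ρ u)).comp ((gamLin ρ).comp (coMap 𝕜 η A))
      = (LinearMap.mulLeft 𝕜 (ρ u)).comp (gamLin ρ) := by
    refine LinearMap.pi_ext' fun b => LinearMap.ext_ring ?_
    simp only [LinearMap.comp_apply, LinearMap.single_apply, LinearMap.mulRight_apply,
      LinearMap.mulLeft_apply, gamLin_single, coMap_single]
    have e1 : gamLin ρ (fun a => sgn 𝕜 η a * (A a b : 𝕜) * sgn 𝕜 η b)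
        = sgn 𝕜 η b • ρ (CliffordAlgebra.ι (quadForm ℝ η) (fun a => A a b)) := by
      rw [ρ_ι, Finset.smul_sum]
      simp only [gamLin, LinearMap.sum_apply, LinearMap.smulRight_apply, LinearMap.proj_apply,
        gamUp, smul_smul]
      refine Finset.sum_congr rfl fun a _ => ?_
      congr 1
      linear_combination ((A a b : 𝕜) * sgn 𝕜 η b) * sgn_mul_self 𝕜 η a
    rw [e1, smul_mul_assoc, ← map_mul, h.intertwine, map_mul, gamUp, mul_smul_comm]
    rfl
  exact LinearMap.congr_fun this v

lemma map_coE_mul_add (h : IsFrameChange η A u) (a : Fin n) (X : Lam 𝕜 n) :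
    ExteriorAlgebra.map (coMap 𝕜 η A) (coE a * X + sgn 𝕜 η a • contr a X)
      = ExteriorAlgebra.ι 𝕜 (coMap 𝕜 η A (Pi.single a 1)) * ExteriorAlgebra.map (coMap 𝕜 η A) X
        + contrSharp η (coMap 𝕜 η A (Pi.single a 1)) (ExteriorAlgebra.map (coMap 𝕜 η A) X) := by
  rw [h.isIsom.contrSharp_map, contrSharp_single, map_add, map_mul, coE,
    ExteriorAlgebra.map_apply_ι]
  rfl

/-- Clifford induction reduces the claim to covectors, where it is the covering relation `v u = u
w`. -/
lemma cliff_map_mul (h : IsFrameChange η A u) (X : Lam 𝕜 n) :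
    cliff ρ (ExteriorAlgebra.map (coMap 𝕜 η A) X) * ρ u = ρ u * cliff ρ X := by
  induction X using lam_induction_clifford η with
  | one => simp
  | add X Y hX hY => simp only [map_add, add_mul, mul_add, hX, hY]
  | smul c X hX => simp only [map_smul, smul_mul_assoc, mul_smul_comm, hX]
  | mul a X hX =>
    rw [h.map_coE_mul_add, map_add, cliff_ι_mul, sub_add_cancel, mul_assoc, hX, ← mul_assoc,
      h.gamLin_mul, mul_assoc, gamLin_single, gamUp_mul_cliff]

lemma cliff_map_apply (h : IsFrameChange η A u) (X : Lam 𝕜 n) (ψ : S) :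
    cliff ρ (ExteriorAlgebra.map (coMap 𝕜 η A) X) (ρ u ψ) = ρ u (cliff ρ X ψ) :=
  LinearMap.congr_fun (h.cliff_map_mul ρ X) ψ

end IsFrameChange

variable {ρ} {σ : 𝕜 →+* 𝕜} (B : SpinorInner ρ σ)

lemma SpinorInner.adjoint_ι (v : Fin n → ℝ) (ψ φ : S) :
    B.form (ρ (CliffordAlgebra.ι _ v) ψ) φ
      = ((B.ε : ℤ) : 𝕜) * B.form ψ (ρ (CliffordAlgebra.ι _ v) φ) := by
  simp only [IsFrameChange.ρ_ι, LinearMap.sum_apply, LinearMap.smul_apply, map_sum, map_smulₛₗ,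
    B.adjoint, B.map_ofReal, smul_eq_mul, Finset.mul_sum, RingHom.id_apply]
  exact Finset.sum_congr rfl fun a _ => by ring

/-- For even elements the signs `ε` cancel in pairs, so the adjoint is plain reversal. -/
lemma SpinorInner.adjoint_even {x : CliffordAlgebra (quadForm ℝ η)}
    (hx : x ∈ CliffordAlgebra.even (quadForm ℝ η)) (ψ φ : S) :
    B.form (ρ x ψ) φ = B.form ψ (ρ (CliffordAlgebra.reverse x) φ) := by
  induction x, hx using CliffordAlgebra.even_induction generalizing ψ φ with
  | algebraMap r =>
    have e : ∀ χ : S, ρ (algebraMap ℝ _ r) χ = (r : 𝕜) • χ := fun χ => by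
      rw [AlgHom.commutes]; exact (algebraMap_smul 𝕜 r χ).symm
    rw [CliffordAlgebra.reverse.commutes, e, e, map_smulₛₗ, LinearMap.smul_apply, map_smul,
      B.map_ofReal]
  | add x y hx hy ihx ihy => simp only [map_add, LinearMap.add_apply, ihx, ihy]
  | ι_mul_ι_mul m₁ m₂ x hx ih =>
    rw [map_mul, map_mul, Module.End.mul_apply, Module.End.mul_apply, B.adjoint_ι, B.adjoint_ι, ih,
      CliffordAlgebra.reverse.map_mul, CliffordAlgebra.reverse.map_mul, CliffordAlgebra.reverse_ι,
      CliffordAlgebra.reverse_ι, map_mul, map_mul, Module.End.mul_apply, Module.End.mul_apply]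
    rw [← mul_assoc, B.ε_mul_self, one_mul]

namespace IsFrameChange

variable {A : Fin n → Fin n → ℝ} {u : CliffordAlgebra (quadForm ℝ η)}

/-- An element of the spin group is even, so its adjoint is its reversal. This agrees with `star` on
even elements, and `star u * u = 1`. -/
lemma form_apply (h : IsFrameChange η A u) (ψ φ : S) :
    B.form (ρ u ψ) (ρ u φ) = B.form ψ φ := by
  have he := spinGroup.mem_even h.mem
  have h1 := spinGroup.star_mul_self_of_mem h.mem
  rw [CliffordAlgebra.star_def, CliffordAlgebra.involute_eq_of_mem_even he] at h1
  rw [B.adjoint_even he, ← Module.End.mul_apply, ← map_mul, h1, map_one]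
  rfl

lemma totalCurrent_apply (h : IsFrameChange η A u) (ψ φ : S) : totalCurrent B (ρ u ψ) (ρ u φ)
    = ExteriorAlgebra.map (coMap 𝕜 η A) (totalCurrent B ψ φ) := by
  refine eq_of_pair_eq (η := η) fun Z => ?_
  obtain ⟨X, rfl⟩ := h.map_surjective (𝕜 := 𝕜) Z
  rw [h.isIsom.pair_map, pair_totalCurrent, rev_map, h.cliff_map_apply, h.form_apply,
    pair_totalCurrent]

lemma ρ_mul_star (h : IsFrameChange η A u) : ρ u * ρ (star u) = 1 := by
  rw [← map_mul, spinGroup.mul_star_self_of_mem h.mem, map_one]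

end IsFrameChange

/-! ### The volume form -/

/-- The coordinates of a form. -/
def lamCoord (𝕜 : Type*) [RCLike 𝕜] (n : ℕ) : Lam 𝕜 n ≃ₗ[𝕜] (Finset (Fin n) → 𝕜) :=
  (lamBasis 𝕜 n).equivFun

/-- Clifford multiplication of forms by a covector. -/
def cliffordMul (η : Fin n → ℤˣ) : (Fin n → 𝕜) →ₗ[𝕜] Module.End 𝕜 (Lam 𝕜 n) :=
  LinearMap.mul 𝕜 (Lam 𝕜 n) ∘ₗ ExteriorAlgebra.ι 𝕜 + contrSharp η

lemma cliffordMul_apply (v : Fin n → 𝕜) (X : Lam 𝕜 n) :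
    cliffordMul η v X = ExteriorAlgebra.ι 𝕜 v * X + contrSharp η v X := rfl

lemma cliffordMul_cliffordMul (v : Fin n → 𝕜) (X : Lam 𝕜 n) :
    cliffordMul η v (cliffordMul η v X) = bil η v v • X := by
  have h2 : ExteriorAlgebra.ι 𝕜 v * (ExteriorAlgebra.ι 𝕜 v * X) = 0 := by
    rw [← mul_assoc, ExteriorAlgebra.ι_sq_zero, zero_mul]
  have h3 := LinearMap.congr_fun (contrSharp_sq (η := η) v) X
  simp only [Module.End.mul_apply, LinearMap.zero_apply] at h3
  simp only [cliffordMul_apply, map_add, h2, h3, contrSharp_ι_mul]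
  abel

/-- Clifford multiplication by a real vector, on the coordinates of forms. -/
def regVec (𝕜 : Type*) [RCLike 𝕜] (η : Fin n → ℤˣ) :
    (Fin n → ℝ) →ₗ[ℝ] Module.End 𝕜 (Finset (Fin n) → 𝕜) where
  toFun v := (lamCoord 𝕜 n).conj (cliffordMul η (fun a => (v a : 𝕜) * sgn 𝕜 η a))
  map_add' v w := by
    rw [← map_add, ← map_add]
    congr 2
    funext a
    simp [add_mul]
  map_smul' c v := by
    have : (fun a => ((c • v) a : 𝕜) * sgn 𝕜 η a)
        = (c : 𝕜) • fun a => (v a : 𝕜) * sgn 𝕜 η a := by funext a; simp [mul_assoc]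
    rw [this, map_smul, map_smul]
    exact LinearMap.ext fun x => algebraMap_smul 𝕜 c _

lemma regVec_apply (v : Fin n → ℝ) (X : Lam 𝕜 n) : regVec 𝕜 η v (lamCoord 𝕜 n X)
    = lamCoord 𝕜 n (cliffordMul η (fun a => (v a : 𝕜) * sgn 𝕜 η a) X) := by
  simp [regVec]

/-- The regular representation, on the coordinates of forms. -/
def regRep (𝕜 : Type*) [RCLike 𝕜] (η : Fin n → ℤˣ) :
    CliffordAlgebra (quadForm ℝ η) →ₐ[ℝ] Module.End 𝕜 (Finset (Fin n) → 𝕜) :=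
  CliffordAlgebra.lift (quadForm ℝ η) ⟨regVec 𝕜 η, fun v => by
    refine LinearMap.ext fun x => ?_
    obtain ⟨X, rfl⟩ := (lamCoord 𝕜 n).surjective x
    have e : bil η (fun a => (v a : 𝕜) * sgn 𝕜 η a) (fun a => (v a : 𝕜) * sgn 𝕜 η a)
        = ((quadForm ℝ η v : ℝ) : 𝕜) := by
      simp only [bil, quadForm, QuadraticMap.weightedSumSquares_apply, smul_eq_mul, map_sum,
        map_mul, ofReal_sgn]
      refine Finset.sum_congr rfl fun a _ => ?_
      linear_combination (sgn 𝕜 η a * (v a : 𝕜) * (v a : 𝕜)) * sgn_mul_self 𝕜 η a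
    rw [Module.End.mul_apply, regVec_apply, regVec_apply, cliffordMul_cliffordMul, e, map_smul]
    exact algebraMap_smul 𝕜 _ _⟩

lemma regRep_gamUp (a : Fin n) (X : Lam 𝕜 n) : gamUp (regRep 𝕜 η) a (lamCoord 𝕜 n X)
    = lamCoord 𝕜 n (coE a * X + sgn 𝕜 η a • contr a X) := by
  have e : (fun b => (((Pi.single a 1 : Fin n → ℝ) b : ℝ) : 𝕜) * sgn 𝕜 η b)
      = sgn 𝕜 η a • (Pi.single a 1 : Fin n → 𝕜) := by
    funext b
    by_cases h : b = a
    · subst h; simp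
    · simp [h]
  rw [gamUp, gam, regRep, CliffordAlgebra.lift_ι_apply, LinearMap.smul_apply, regVec_apply, e,
    map_smul, LinearMap.smul_apply, map_smul, smul_smul, sgn_mul_self, one_smul,
    cliffordMul_apply, contrSharp_single]
  rfl

/-- The unit form recovers `X` from its action, so the regular representation separates forms. It is
realised on coordinates because these carry the norm required of a spinor space. -/
lemma cliff_regRep (X : Lam 𝕜 n) :
    cliff (regRep 𝕜 η) X (lamCoord 𝕜 n 1) = lamCoord 𝕜 n X := by
  induction X using lam_induction_clifford η with
  | one => simp
  | add X Y hX hY => simp only [map_add, LinearMap.add_apply, hX, hY]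
  | smul c X hX => simp only [map_smul, LinearMap.smul_apply, hX]
  | mul a X hX => rw [← gamUp_mul_cliff, Module.End.mul_apply, hX, regRep_gamUp]

variable (ρ)

lemma cliff_vol_mul_gam (a : Fin n) : cliff ρ vol * gam ρ a
    = (-(-1 : 𝕜) ^ n) • (gam ρ a * cliff ρ vol) := by
  rw [cliff_mul_gam, gam_mul_cliff, hat_of_degree vol_mem, ← map_smul]
  congr 1
  rw [mul_smul_comm, coE_mul_vol, map_smul]
  simp

lemma cliff_vol_mul_ι (v : Fin n → ℝ) : cliff ρ vol * ρ (CliffordAlgebra.ι _ v)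
    = (-(-1 : 𝕜) ^ n) • (ρ (CliffordAlgebra.ι _ v) * cliff ρ vol) := by
  simp only [IsFrameChange.ρ_ι, Finset.mul_sum, Finset.sum_mul, Finset.smul_sum, mul_smul_comm,
    smul_mul_assoc, cliff_vol_mul_gam]
  exact Finset.sum_congr rfl fun a _ => smul_comm _ _ _

lemma cliff_vol_mul_even {x : CliffordAlgebra (quadForm ℝ η)}
    (hx : x ∈ CliffordAlgebra.even (quadForm ℝ η)) :
    cliff ρ vol * ρ x = ρ x * cliff ρ (vol : Lam 𝕜 n) := by
  induction x, hx using CliffordAlgebra.even_induction with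
  | algebraMap r => rw [AlgHom.commutes]; exact (Algebra.commutes r _).symm
  | add x y hx hy ihx ihy => rw [map_add, mul_add, add_mul, ihx, ihy]
  | ι_mul_ι_mul m₁ m₂ x hx ih =>
    have h1 : (-(-1 : 𝕜) ^ n) * -(-1) ^ n = 1 := by
      rw [neg_mul_neg, ← pow_add]; exact Even.neg_one_pow ⟨n, rfl⟩
    rw [map_mul, map_mul, ← mul_assoc, ← mul_assoc, cliff_vol_mul_ι, smul_mul_assoc,
      mul_assoc (ρ _) (cliff ρ vol), cliff_vol_mul_ι, mul_smul_comm, smul_smul, h1, one_smul,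
      mul_assoc, mul_assoc, ih]
    simp only [mul_assoc]

/-- The transformed volume form acts as `u vol u⁻¹`. The volume form commutes with even elements,
and the regular representation is faithful on forms. No determinant is needed. -/
lemma IsFrameChange.map_vol {A : Fin n → Fin n → ℝ} {u : CliffordAlgebra (quadForm ℝ η)}
    (h : IsFrameChange η A u) : ExteriorAlgebra.map (coMap 𝕜 η A) vol = (vol : Lam 𝕜 n) := by
  apply (lamCoord 𝕜 n).injective
  rw [← cliff_regRep (η := η) (ExteriorAlgebra.map _ _), ← cliff_regRep (η := η) vol]
  have h1 := h.cliff_map_mul (regRep 𝕜 η) (vol : Lam 𝕜 n)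
  rw [← cliff_vol_mul_even _ (spinGroup.mem_even h.mem)] at h1
  have h2 := congrArg (· * regRep 𝕜 η (star u)) h1
  simp only [mul_assoc, h.ρ_mul_star, mul_one] at h2
  rw [h2]

end FrameChange

/-! ### Exchanging the two spinors in a current. -/

section Exchange

variable {n : ℕ} {𝕜 : Type*} [RCLike 𝕜] {η : Fin n → ℤˣ}
  {S : Type*} [NormedAddCommGroup S] [NormedSpace ℝ S] [NormedSpace 𝕜 S] [IsScalarTower ℝ 𝕜 S]
  {ρ : CliffordAlgebra (quadForm ℝ η) →ₐ[ℝ] Module.End 𝕜 S} {σ : 𝕜 →+* 𝕜}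

lemma list_prod_gam_mul_gam {a : Fin n} {l : List (Fin n)} (h : a ∉ l) :
    (l.map (gam ρ)).prod * gam ρ a = (-1 : 𝕜) ^ l.length • (gam ρ a * (l.map (gam ρ)).prod) := by
  induction l with
  | nil => simp
  | cons b l ih =>
    rw [List.mem_cons, not_or] at h
    have h1 := gam_anticomm ρ b a
    rw [if_neg (Ne.symm h.1), ← eq_neg_iff_add_eq_zero] at h1
    rw [List.map_cons, List.prod_cons, mul_assoc, ih h.2, mul_smul_comm, ← mul_assoc, h1,
      List.length_cons, pow_succ, mul_neg_one, neg_smul, neg_mul, smul_neg, mul_assoc]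

/-- The first factor passes all the others; the exponents accumulate to a triangular number. -/
lemma list_prod_gam_reverse {l : List (Fin n)} (hl : l.Nodup) : (l.reverse.map (gam ρ)).prod
    = (-1 : 𝕜) ^ (l.length * (l.length - 1) / 2) • (l.map (gam ρ)).prod := by
  induction l with
  | nil => simp
  | cons a l ih =>
    rw [List.nodup_cons] at hl
    rw [List.reverse_cons, List.map_append, List.prod_append, List.map_singleton,
      List.prod_singleton, ih hl.2, smul_mul_assoc, list_prod_gam_mul_gam hl.1, smul_smul,
      List.length_cons, Nat.triangle_succ, pow_add, List.map_cons, List.prod_cons]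

variable (B : SpinorInner ρ σ)

lemma SpinorInner.adjoint_list_prod (l : List (Fin n)) (ψ φ : S) :
    B.form ((l.map (gam ρ)).prod ψ) φ
      = ((B.ε : ℤ) : 𝕜) ^ l.length * B.form ψ ((l.reverse.map (gam ρ)).prod φ) := by
  induction l generalizing φ with
  | nil => simp
  | cons a l ih =>
    rw [List.map_cons, List.prod_cons, Module.End.mul_apply, B.adjoint, ih, List.reverse_cons,
      List.map_append, List.prod_append, List.map_singleton, List.prod_singleton,
      Module.End.mul_apply, List.length_cons]
    ring

/-- Symmetry of the form contributes `s`, the `p` adjoints contribute `ε ^ p`, and restoring the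
order of the Clifford factors contributes the triangular sign. -/
lemma currentLam_exchange (hσ : σ = RingHom.id 𝕜) (p : ℕ) (ψ φ : S) :
    currentLam B p φ ψ = ((B.exchangeSign p : ℤ) : 𝕜) • currentLam B p ψ φ := by
  subst hσ
  unfold currentLam
  rw [Finset.smul_sum]
  refine Finset.sum_congr rfl fun A hA => ?_
  rw [smul_smul]
  congr 1
  have hc : (A.sort (· ≤ ·)).length = p := by
    rw [Finset.length_sort]; exact (Finset.mem_powersetCard.1 hA).2
  rw [sort_ge_eq_reverse, list_prod_gam_reverse (A.sort_nodup _), LinearMap.smul_apply, map_smul,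
    B.symm, B.adjoint_list_prod, list_prod_gam_reverse (A.sort_nodup _), hc,
    SpinorInner.exchangeSign, LinearMap.smul_apply, map_smul]
  simp only [RingHom.id_apply, smul_eq_mul, Units.val_mul, Units.val_pow_eq_pow_val, Int.cast_mul,
    Int.cast_pow, Units.val_neg, Units.val_one, Int.cast_neg, Int.cast_one]
  ring

end Exchange

/-! ### Calculus for functions with values in finite-dimensional spaces. -/

section Calculus

variable {n : ℕ} {𝕜 : Type*} [RCLike 𝕜]

/-- A norm transported from coordinates, so that form-valued functions can be differentiated as a
whole. -/
instance : NormedAddCommGroup (Lam 𝕜 n) :=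
  NormedAddCommGroup.induced _ _ (lamCoord 𝕜 n) (lamCoord 𝕜 n).injective

instance : NormedSpace ℝ (Lam 𝕜 n) :=
  NormedSpace.induced ℝ _ _ ((lamCoord 𝕜 n).toLinearMap.restrictScalars ℝ)

instance : IsScalarTower ℝ 𝕜 (Lam 𝕜 n) := inferInstance

instance : FiniteDimensional ℝ (Lam 𝕜 n) := 
  have : Module.Finite 𝕜 (Lam 𝕜 n) := Module.Finite.of_basis (lamBasis 𝕜 n)
  Module.Finite.trans 𝕜 _

variable {M : Type*} [TopologicalSpace M]
  [ChartedSpace (EuclideanSpace ℝ (Fin n)) M] [IsManifold (𝓡 n) ∞ M]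
  {η : Fin n → ℤˣ} {g : PseudoMetric n M} {ι : Type*} (P : SpinStructure η g ι)
  {W₁ W₂ W₃ : Type*} [NormedAddCommGroup W₁] [NormedSpace ℝ W₁] [NormedAddCommGroup W₂]
  [NormedSpace ℝ W₂] [NormedAddCommGroup W₃] [NormedSpace ℝ W₃]

namespace SpinStructure

/-- Smoothness of a function on a member of the cover. -/
def SmoothOn (i : ι) (f : M → W₁) : Prop := ContMDiffOn (𝓡 n) 𝓘(ℝ, W₁) ∞ f (P.U i)

variable {P} {i : ι} {x : M}

lemma SmoothOn.mdifferentiableAt {f : M → W₁} (hf : P.SmoothOn i f) (hx : x ∈ P.U i) :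
    MDifferentiableAt (𝓡 n) 𝓘(ℝ, W₁) f x :=
  (hf.contMDiffAt ((P.isOpen i).mem_nhds hx)).mdifferentiableAt (by simp)

lemma SmoothOn.congr {f h : M → W₁} (hf : P.SmoothOn i f) (e : ∀ y ∈ P.U i, h y = f y) :
    P.SmoothOn i h := ContMDiffOn.congr hf e

lemma SmoothOn.linear [FiniteDimensional ℝ W₁] {f : M → W₁} (hf : P.SmoothOn i f)
    (L : W₁ →ₗ[ℝ] W₂) : P.SmoothOn i (fun y => L (f y)) :=
  (LinearMap.toContinuousLinearMap L).contMDiff.comp_contMDiffOn hf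

/-- A bilinear map on finite-dimensional spaces as a continuous bilinear map. -/
def toCLM₂ [FiniteDimensional ℝ W₁] [FiniteDimensional ℝ W₂] (β : W₁ →ₗ[ℝ] W₂ →ₗ[ℝ] W₃) :
    W₁ →L[ℝ] W₂ →L[ℝ] W₃ :=
  LinearMap.toContinuousLinearMap
    ((LinearMap.toContinuousLinearMap (𝕜 := ℝ) (E := W₂) (F' := W₃)).toLinearMap ∘ₗ β)

lemma SmoothOn.bilin [FiniteDimensional ℝ W₁] [FiniteDimensional ℝ W₂] {f : M → W₁} {h : M → W₂}
    (hf : P.SmoothOn i f) (hh : P.SmoothOn i h) (β : W₁ →ₗ[ℝ] W₂ →ₗ[ℝ] W₃) :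
    P.SmoothOn i (fun y => β (f y) (h y)) :=
  ContMDiffOn.clm_apply ((toCLM₂ β).contMDiff.comp_contMDiffOn hf) hh

lemma SmoothOn.sum {κ : Type*} {s : Finset κ} {f : κ → M → W₁} (h : ∀ k ∈ s, P.SmoothOn i (f k)) :
    P.SmoothOn i (fun y => ∑ k ∈ s, f k y) := contMDiffOn_finsetSum h

lemma SmoothOn.add {f h : M → W₁} (hf : P.SmoothOn i f) (hh : P.SmoothOn i h) :
    P.SmoothOn i (fun y => f y + h y) := ContMDiffOn.add hf hh

lemma SmoothOn.sub {f h : M → W₁} (hf : P.SmoothOn i f) (hh : P.SmoothOn i h) :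
    P.SmoothOn i (fun y => f y - h y) := ContMDiffOn.sub hf hh

lemma smoothOn_const (c : W₁) : P.SmoothOn i (fun _ => c) := contMDiffOn_const

lemma dirDeriv_congr {f h : M → W₁} (e : ∀ y ∈ P.U i, f y = h y) (hx : x ∈ P.U i) (a : Fin n) :
    P.dirDeriv i a f x = P.dirDeriv i a h x := by
  unfold dirDeriv
  rw [Filter.EventuallyEq.mfderiv_eq (Filter.eventuallyEq_of_mem ((P.isOpen i).mem_nhds hx) e)]
  rfl

lemma dirDeriv_linear' [FiniteDimensional ℝ W₁] {f : M → W₁}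
    (hf : MDifferentiableAt (𝓡 n) 𝓘(ℝ, W₁) f x) (a : Fin n) (L : W₁ →ₗ[ℝ] W₂) :
    P.dirDeriv i a (fun y => L (f y)) x = L (P.dirDeriv i a f x) := by
  have h2 : HasMFDerivAt (𝓡 n) 𝓘(ℝ, W₂) (fun y => L (f y)) x
      ((LinearMap.toContinuousLinearMap L).comp (mfderiv (𝓡 n) 𝓘(ℝ, W₁) f x)) :=
    HasMFDerivAt.comp (I' := 𝓘(ℝ, W₁)) (g := LinearMap.toContinuousLinearMap L) x
      ((LinearMap.toContinuousLinearMap L).hasMFDerivAt (x := f x)) hf.hasMFDerivAt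
  unfold dirDeriv
  rw [h2.mfderiv]
  rfl

lemma dirDeriv_linear [FiniteDimensional ℝ W₁] {f : M → W₁} (hf : P.SmoothOn i f) (hx : x ∈ P.U i)
    (a : Fin n) (L : W₁ →ₗ[ℝ] W₂) :
    P.dirDeriv i a (fun y => L (f y)) x = L (P.dirDeriv i a f x) :=
  dirDeriv_linear' (hf.mdifferentiableAt hx) a L

/-- One product rule for wedge products, Clifford action, rotations and currents. All of them are
real bilinear, including the current, which is only `σ`-linear over `𝕜`. -/
lemma hasMFDerivAt_bilin [FiniteDimensional ℝ W₁] [FiniteDimensional ℝ W₂] {f : M → W₁}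
    {h : M → W₂} (hf : MDifferentiableAt (𝓡 n) 𝓘(ℝ, W₁) f x)
    (hh : MDifferentiableAt (𝓡 n) 𝓘(ℝ, W₂) h x) (β : W₁ →ₗ[ℝ] W₂ →ₗ[ℝ] W₃) :
    ∃ L : TangentSpace (𝓡 n) x →L[ℝ] W₃,
      HasMFDerivAt (𝓡 n) 𝓘(ℝ, W₃) (fun y => β (f y) (h y)) x L ∧
      ∀ v, L v = β (mfderiv (𝓡 n) 𝓘(ℝ, W₁) f x v) (h x)
        + β (f x) (mfderiv (𝓡 n) 𝓘(ℝ, W₂) h x v) := by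
  have hf' := hf.hasMFDerivAt
  have hh' := hh.hasMFDerivAt
  have h2 : HasMFDerivAt (𝓡 n) 𝓘(ℝ, W₃) (fun y => toCLM₂ β (f y) (h y)) x
      ((toCLM₂ β).precompR _ (f x) (mfderiv (𝓡 n) 𝓘(ℝ, W₂) h x)
        + (toCLM₂ β).precompL _ (mfderiv (𝓡 n) 𝓘(ℝ, W₁) f x) (h x)) :=
    ⟨((toCLM₂ β).continuous.continuousAt.comp hf'.1).clm_apply hh'.1, by
      have h3 := (toCLM₂ β).hasFDerivWithinAt_of_bilinear hf'.2 hh'.2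
      simpa only [mfld_simps] using! h3⟩
  exact ⟨_, h2, fun v => add_comm _ _⟩

lemma dirDeriv_bilin' [FiniteDimensional ℝ W₁] [FiniteDimensional ℝ W₂] {f : M → W₁} {h : M → W₂}
    (hf : MDifferentiableAt (𝓡 n) 𝓘(ℝ, W₁) f x) (hh : MDifferentiableAt (𝓡 n) 𝓘(ℝ, W₂) h x)
    (a : Fin n) (β : W₁ →ₗ[ℝ] W₂ →ₗ[ℝ] W₃) :
    P.dirDeriv i a (fun y => β (f y) (h y)) x
      = β (P.dirDeriv i a f x) (h x) + β (f x) (P.dirDeriv i a h x) := by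
  obtain ⟨L, hL, hL'⟩ := hasMFDerivAt_bilin hf hh β
  unfold dirDeriv
  rw [hL.mfderiv]
  exact hL' _

lemma dirDeriv_bilin [FiniteDimensional ℝ W₁] [FiniteDimensional ℝ W₂] {f : M → W₁} {h : M → W₂}
    (hf : P.SmoothOn i f) (hh : P.SmoothOn i h) (hx : x ∈ P.U i) (a : Fin n)
    (β : W₁ →ₗ[ℝ] W₂ →ₗ[ℝ] W₃) :
    P.dirDeriv i a (fun y => β (f y) (h y)) x
      = β (P.dirDeriv i a f x) (h x) + β (f x) (P.dirDeriv i a h x) :=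
  dirDeriv_bilin' (hf.mdifferentiableAt hx) (hh.mdifferentiableAt hx) a β

lemma dirDeriv_const (c : W₁) (a : Fin n) (x : M) : P.dirDeriv i a (fun _ => c) x = 0 := by
  unfold dirDeriv; rw [mfderiv_const]; rfl

lemma dirDeriv_sub {f h : M → W₁} (hf : P.SmoothOn i f) (hh : P.SmoothOn i h) (hx : x ∈ P.U i)
    (a : Fin n) :
    P.dirDeriv i a (fun y => f y - h y) x = P.dirDeriv i a f x - P.dirDeriv i a h x := by
  have e := mfderiv_sub (hf.mdifferentiableAt hx) (hh.mdifferentiableAt hx)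
  exact DFunLike.congr_fun e (P.frame i a x)

lemma mdifferentiableAt_sum {κ : Type*} {s : Finset κ} {f : κ → M → W₁}
    (h : ∀ k ∈ s, MDifferentiableAt (𝓡 n) 𝓘(ℝ, W₁) (f k) x) :
    MDifferentiableAt (𝓡 n) 𝓘(ℝ, W₁) (fun y => ∑ k ∈ s, f k y) x := by
  classical
  induction s using Finset.induction_on with
  | empty => simpa using mdifferentiableAt_const
  | insert k s hk ih =>
    simp only [Finset.sum_insert hk]
    exact (h k (Finset.mem_insert_self _ _)).add (ih fun l hl => h l (Finset.mem_insert_of_mem hl))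

lemma dirDeriv_sum' {κ : Type*} {s : Finset κ} {f : κ → M → W₁}
    (h : ∀ k ∈ s, MDifferentiableAt (𝓡 n) 𝓘(ℝ, W₁) (f k) x) (a : Fin n) :
    P.dirDeriv i a (fun y => ∑ k ∈ s, f k y) x = ∑ k ∈ s, P.dirDeriv i a (f k) x := by
  classical
  induction s using Finset.induction_on with
  | empty => simp [dirDeriv_const]
  | insert k s hk ih =>
    simp only [Finset.sum_insert hk]
    rw [← ih fun l hl => h l (Finset.mem_insert_of_mem hl)]
    exact DFunLike.congr_fun (mfderiv_add (h k (Finset.mem_insert_self _ _))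
      (mdifferentiableAt_sum fun l hl => h l (Finset.mem_insert_of_mem hl))) (P.frame i a x)

lemma dirDeriv_sum {κ : Type*} {s : Finset κ} {f : κ → M → W₁} (h : ∀ k ∈ s, P.SmoothOn i (f k))
    (hx : x ∈ P.U i) (a : Fin n) :
    P.dirDeriv i a (fun y => ∑ k ∈ s, f k y) x = ∑ k ∈ s, P.dirDeriv i a (f k) x :=
  dirDeriv_sum' (fun k hk => (h k hk).mdifferentiableAt hx) a

/-- Smoothness of a vector field on a member of the cover. -/
def SmoothField (P : SpinStructure η g ι) (i : ι) (X : (x : M) → TangentSpace (𝓡 n) x) : Prop :=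
  ContMDiffOn (𝓡 n) (𝓡 n).tangent ∞ (fun x ↦ (⟨x, X x⟩ : TangentBundle (𝓡 n) M)) (P.U i)

/-- The derivative along `X` is the fibre component of the tangent map of `f` composed with the
section `X`. -/
lemma SmoothOn.mfderiv_apply {f : M → W₁} (hf : P.SmoothOn i f)
    {X : (x : M) → TangentSpace (𝓡 n) x} (hX : P.SmoothField i X) :
    P.SmoothOn i (fun y => (mfderiv (𝓡 n) 𝓘(ℝ, W₁) f y (X y) : W₁)) := by
  have h1 := ContMDiffOn.contMDiffOn_tangentMapWithin (m := ∞) hf (by simp)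
    (P.isOpen i).uniqueMDiffOn
  have h2 := h1.comp hX (fun y hy => hy)
  have h3 := (contMDiff_snd_tangentBundle_modelSpace W₁ 𝓘(ℝ, W₁) (n := ∞)).comp_contMDiffOn h2
  refine ContMDiffOn.congr h3 fun y hy => ?_
  change _ = mfderivWithin (𝓡 n) 𝓘(ℝ, W₁) f (P.U i) y (X y)
  rw [mfderivWithin_of_isOpen (P.isOpen i) hy]

lemma SmoothOn.dirDeriv {f : M → W₁} (hf : P.SmoothOn i f) (a : Fin n) :
    P.SmoothOn i (P.dirDeriv i a f) := hf.mfderiv_apply (P.frame_smooth i a)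

lemma smoothForm_iff {θ : FormField n M 𝕜} :
    P.SmoothForm θ ↔ ∀ i, P.SmoothOn i (P.toFrame i θ) := by
  refine forall_congr' fun i => ⟨fun h => ?_, fun h A => ?_⟩
  · have h2 : P.SmoothOn i (fun y => lamCoord 𝕜 n (P.toFrame i θ y)) := contMDiffOn_pi_space.2 h
    exact (h2.linear ((lamCoord 𝕜 n).symm.toLinearMap.restrictScalars ℝ)).congr
      fun y _ => ((lamCoord 𝕜 n).symm_apply_apply _).symm
  · exact h.linear (((LinearMap.proj A : (Finset (Fin n) → 𝕜) →ₗ[𝕜] 𝕜) ∘ₗ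
      (lamCoord 𝕜 n).toLinearMap).restrictScalars ℝ)

lemma lamDeriv_eq' {F : M → Lam 𝕜 n} (hF : MDifferentiableAt (𝓡 n) 𝓘(ℝ, Lam 𝕜 n) F x)
    (a : Fin n) :
    P.lamDeriv i a F x = P.dirDeriv i a F x := by
  unfold lamDeriv
  rw [← (lamBasis 𝕜 n).sum_repr (P.dirDeriv i a F x)]
  refine Finset.sum_congr rfl fun A _ => ?_
  congr 1
  exact dirDeriv_linear' hF a (((LinearMap.proj A : (Finset (Fin n) → 𝕜) →ₗ[𝕜] 𝕜) ∘ₗ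
      (lamCoord 𝕜 n).toLinearMap).restrictScalars ℝ)

lemma lamDeriv_eq {F : M → Lam 𝕜 n} (hF : P.SmoothOn i F) (hx : x ∈ P.U i) (a : Fin n) :
    P.lamDeriv i a F x = P.dirDeriv i a F x :=
  lamDeriv_eq' (hF.mdifferentiableAt hx) a

end SpinStructure

end Calculus

/-! ### Orthonormal frames, the Koszul coefficients, and commutators of derivatives. -/

section Frames

variable {n : ℕ} {M : Type*} [TopologicalSpace M]
  [ChartedSpace (EuclideanSpace ℝ (Fin n)) M] [IsManifold (𝓡 n) ∞ M]
  {η : Fin n → ℤˣ} {g : PseudoMetric n M} {ι : Type*} (P : SpinStructure η g ι)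
  {W : Type*} [NormedAddCommGroup W] [NormedSpace ℝ W]

namespace SpinStructure

variable {P} {i : ι} {x : M}

/-! ### Orthonormal frames -/

lemma sum_smul_frame (hx : x ∈ P.U i) (v : TangentSpace (𝓡 n) x) :
    ∑ c, (sgn ℝ η c * g.val x v (P.frame i c x)) • P.frame i c x = v := by
  have hg : ∀ (w : Fin n → ℝ) b, g.val x (∑ a, w a • P.frame i a x) (P.frame i b x)
      = w b * sgn ℝ η b := fun w b => by
    rw [map_sum, sum_apply, Finset.sum_eq_single b]
    · rw [map_smul, smul_apply, P.orthonormal i x hx, if_pos rfl, smul_eq_mul]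
    · intro a _ hab
      rw [map_smul, smul_apply, P.orthonormal i x hx, if_neg hab, smul_zero]
    · simp
  have hli : LinearIndependent ℝ (fun a => P.frame i a x) := by
    rw [Fintype.linearIndependent_iff]
    intro w hw b
    have := hg w b
    rw [hw, map_zero, zero_apply] at this
    exact (mul_eq_zero.1 this.symm).resolve_right (sgn_ne_zero (𝕜 := ℝ) η b)
  have hspan : v ∈ Submodule.span ℝ (Set.range fun a => P.frame i a x) := by
    have hfr : Module.finrank ℝ (TangentSpace (𝓡 n) x) = n := finrank_euclideanSpace_fin
    have : FiniteDimensional ℝ (TangentSpace (𝓡 n) x) :=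
      inferInstanceAs (FiniteDimensional ℝ (EuclideanSpace ℝ (Fin n)))
    rw [hli.span_eq_top_of_card_eq_finrank' (by rw [hfr, Fintype.card_fin])]
    trivial
  obtain ⟨w, rfl⟩ := (Submodule.mem_span_range_iff_exists_fun ℝ).1 hspan
  refine Finset.sum_congr rfl fun c _ => ?_
  rw [hg]
  congr 1
  linear_combination (w c) * sgn_mul_self ℝ η c

lemma contMDiffWithinAt_inner {s : Set M} {X Y : (x : M) → TangentSpace (𝓡 n) x}
    (hX : ContMDiffWithinAt (𝓡 n) (𝓡 n).tangent ∞
      (fun x ↦ (⟨x, X x⟩ : TangentBundle (𝓡 n) M)) s x)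
    (hY : ContMDiffWithinAt (𝓡 n) (𝓡 n).tangent ∞
      (fun x ↦ (⟨x, Y x⟩ : TangentBundle (𝓡 n) M)) s x) :
    ContMDiffWithinAt (𝓡 n) 𝓘(ℝ, ℝ) ∞ (fun y => g.val y (X y) (Y y)) s x := by
  have := ContMDiffWithinAt.clm_bundle_apply₂ (F₁ := EuclideanSpace ℝ (Fin n))
    (F₂ := EuclideanSpace ℝ (Fin n)) (g.contMDiff.contMDiffAt.contMDiffWithinAt (s := s) (x := x))
    hX hY
  simp only [Bundle.contMDiffWithinAt_totalSpace] at this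
  exact this.2

lemma SmoothField.inner {X Y : (x : M) → TangentSpace (𝓡 n) x} (hX : P.SmoothField i X)
    (hY : P.SmoothField i Y) : P.SmoothOn i (fun y => g.val y (X y) (Y y)) :=
  fun y hy => contMDiffWithinAt_inner (hX y hy) (hY y hy)

lemma SmoothField.contMDiffAt {X : (x : M) → TangentSpace (𝓡 n) x} (hX : P.SmoothField i X)
    (hx : x ∈ P.U i) : ContMDiffAt (𝓡 n) (𝓡 n).tangent ∞
      (fun x ↦ (⟨x, X x⟩ : TangentBundle (𝓡 n) M)) x :=
  ContMDiffOn.contMDiffAt hX ((P.isOpen i).mem_nhds hx)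

lemma SmoothField.mdifferentiableAt {X : (x : M) → TangentSpace (𝓡 n) x} (hX : P.SmoothField i X)
    (hx : x ∈ P.U i) : MDifferentiableAt (𝓡 n) (𝓡 n).tangent
      (fun x ↦ (⟨x, X x⟩ : TangentBundle (𝓡 n) M)) x :=
  (hX.contMDiffAt hx).mdifferentiableAt (by simp)

open VectorField in
lemma SmoothField.mlieBracket {X Y : (x : M) → TangentSpace (𝓡 n) x} (hX : P.SmoothField i X)
    (hY : P.SmoothField i Y) : P.SmoothField i (VectorField.mlieBracket (𝓡 n) X Y) := by
  intro y hy
  have : IsManifold (𝓡 n) (((⊤ : ℕ∞) : WithTop ℕ∞) + 1) M := by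
    have e : (((⊤ : ℕ∞) : WithTop ℕ∞) + 1) = ∞ := by simp
    rw [e]; infer_instance
  have : IsManifold (𝓡 n) (minSmoothness ℝ 2) M := by
    rw [minSmoothness_of_isRCLikeNormedField]; infer_instance
  exact (ContMDiffAt.mlieBracket_vectorField (m := ⊤) (n := ⊤) (hX.contMDiffAt hy)
    (hY.contMDiffAt hy) (by simp)).contMDiffWithinAt

lemma bracketCoeff_smooth (a b c : Fin n) : P.SmoothOn i (P.bracketCoeff i a b c) :=
  SmoothField.inner (SmoothField.mlieBracket (P.frame_smooth i a) (P.frame_smooth i b))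
    (P.frame_smooth i c)

lemma connCoeff_smooth (a b c : Fin n) : P.SmoothOn i (P.connCoeff i a b c) := by
  have := ((bracketCoeff_smooth (P := P) (i := i) a b c).sub (bracketCoeff_smooth b c a)).add
    (bracketCoeff_smooth c a b)
  exact this.linear (LinearMap.mulRight ℝ (1 / 2 : ℝ)) |>.congr fun y _ => by
    rw [LinearMap.mulRight_apply, connCoeff]; ring

lemma connUp_smooth (a b c : Fin n) : P.SmoothOn i (P.connUp i a b c) :=
  (connCoeff_smooth a b c).linear (LinearMap.mulLeft ℝ (sgn ℝ η c))

lemma bracketCoeff_swap (a b c : Fin n) (x : M) :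
    P.bracketCoeff i b a c x = -P.bracketCoeff i a b c x := by
  unfold bracketCoeff
  rw [VectorField.mlieBracket_swap_apply, map_neg, neg_apply]

/-- Metric compatibility, since the inner products of frame vectors are constant. -/
lemma connCoeff_swap (a b c : Fin n) (x : M) :
    P.connCoeff i a c b x = -P.connCoeff i a b c x := by
  unfold connCoeff
  rw [bracketCoeff_swap c a b, bracketCoeff_swap b c a, bracketCoeff_swap a b c]
  ring

/-- Vanishing torsion. -/
lemma connCoeff_sub (a b c : Fin n) (x : M) :
    P.connCoeff i a b c x - P.connCoeff i b a c x = P.bracketCoeff i a b c x := by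
  unfold connCoeff
  rw [bracketCoeff_swap a b c, bracketCoeff_swap c b a, bracketCoeff_swap a c b]
  ring

lemma connUp_sub (a b c : Fin n) (x : M) :
    P.connUp i a b c x - P.connUp i b a c x = P.bracketUp i a b c x := by
  unfold connUp bracketUp
  rw [← mul_sub, connCoeff_sub]

lemma mlieBracket_frame (hx : x ∈ P.U i) (a b : Fin n) :
    VectorField.mlieBracket (𝓡 n) (P.frame i a) (P.frame i b) x
      = ∑ c, P.bracketUp i a b c x • P.frame i c x := (sum_smul_frame hx _).symm

lemma SmoothField.smul {f : M → ℝ} {X : (x : M) → TangentSpace (𝓡 n) x} (hf : P.SmoothOn i f)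
    (hX : P.SmoothField i X) : P.SmoothField i (f • X) := ContMDiffOn.smul_section hf hX

/-! ### Derivatives along vector fields -/

/-- The derivative of a function along a vector field. -/
def fieldDeriv (X : (x : M) → TangentSpace (𝓡 n) x) (f : M → W) (x : M) : W :=
  mfderiv (𝓡 n) 𝓘(ℝ, W) f x (X x)

lemma SmoothOn.fieldDeriv {f : M → W} (hf : P.SmoothOn i f)
    {X : (x : M) → TangentSpace (𝓡 n) x} (hX : P.SmoothField i X) :
    P.SmoothOn i (fieldDeriv X f) := hf.mfderiv_apply hX

lemma fieldDeriv_linear {W' : Type*} [NormedAddCommGroup W'] [NormedSpace ℝ W']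
    [FiniteDimensional ℝ W] {f : M → W} (hf : P.SmoothOn i f) (hx : x ∈ P.U i)
    (X : (x : M) → TangentSpace (𝓡 n) x) (L : W →ₗ[ℝ] W') :
    fieldDeriv X (fun y => L (f y)) x = L (fieldDeriv X f x) := by
  have h2 : HasMFDerivAt (𝓡 n) 𝓘(ℝ, W') (fun y => L (f y)) x
      ((LinearMap.toContinuousLinearMap L).comp (mfderiv (𝓡 n) 𝓘(ℝ, W) f x)) :=
    HasMFDerivAt.comp (I' := 𝓘(ℝ, W)) (g := LinearMap.toContinuousLinearMap L) x
      ((LinearMap.toContinuousLinearMap L).hasMFDerivAt (x := f x))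
      (hf.mdifferentiableAt hx).hasMFDerivAt
  unfold SpinStructure.fieldDeriv
  rw [h2.mfderiv]
  rfl

lemma fieldDeriv_congr {f h : M → W} (e : ∀ y ∈ P.U i, f y = h y) (hx : x ∈ P.U i)
    (X : (x : M) → TangentSpace (𝓡 n) x) : fieldDeriv X f x = fieldDeriv X h x := by
  unfold SpinStructure.fieldDeriv
  rw [Filter.EventuallyEq.mfderiv_eq (Filter.eventuallyEq_of_mem ((P.isOpen i).mem_nhds hx) e)]
  rfl

lemma mlieBracket_smul_field {f : M → ℝ} (hf : P.SmoothOn i f)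
    (V : (x : M) → TangentSpace (𝓡 n) x) {Z : (x : M) → TangentSpace (𝓡 n) x}
    (hZ : P.SmoothField i Z) (hx : x ∈ P.U i) :
    VectorField.mlieBracket (𝓡 n) V (f • Z) x
      = fieldDeriv V f x • Z x + f x • VectorField.mlieBracket (𝓡 n) V Z x :=
  VectorField.mlieBracket_smul_right (hf.mdifferentiableAt hx) (hZ.mdifferentiableAt hx)

/-- The bracket of vector fields is the commutator of derivations. -/
lemma fieldDeriv_mlieBracket_real {f : M → ℝ} (hf : P.SmoothOn i f)
    {X Y Z : (x : M) → TangentSpace (𝓡 n) x} (hX : P.SmoothField i X) (hY : P.SmoothField i Y)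
    (hZ : P.SmoothField i Z) (hx : x ∈ P.U i) (hZx : Z x ≠ 0) :
    fieldDeriv (VectorField.mlieBracket (𝓡 n) X Y) f x
      = fieldDeriv X (fieldDeriv Y f) x - fieldDeriv Y (fieldDeriv X f) x := by
  have : IsManifold (𝓡 n) (minSmoothness ℝ 3) M := by
    rw [minSmoothness_of_isRCLikeNormedField]; infer_instance
  have h2 : minSmoothness ℝ 2 ≤ ∞ := by
    rw [minSmoothness_of_isRCLikeNormedField]; exact ENat.LEInfty.out
  have hU := (P.isOpen i).mem_nhds hx
  -- The Leibniz identity for `X`, `Y` and `f Z` is compared with `f` times the one for `X`, `Y` and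
  -- `Z`. What remains is the claimed identity times `Z x`, which can be cancelled because `Z x ≠
  -- 0`.
  have key := VectorField.leibniz_identity_mlieBracket_apply ((hX.contMDiffAt hx).of_le h2)
    ((hY.contMDiffAt hx).of_le h2) (((hZ.smul hf).contMDiffAt hx).of_le h2)
  have key2 := VectorField.leibniz_identity_mlieBracket_apply ((hX.contMDiffAt hx).of_le h2)
    ((hY.contMDiffAt hx).of_le h2) ((hZ.contMDiffAt hx).of_le h2)
  have aux : ∀ {V V' : (x : M) → TangentSpace (𝓡 n) x}, P.SmoothField i V → P.SmoothField i V' →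
      VectorField.mlieBracket (𝓡 n) V (VectorField.mlieBracket (𝓡 n) V' (f • Z)) x
      = fieldDeriv V (fieldDeriv V' f) x • Z x
        + fieldDeriv V' f x • VectorField.mlieBracket (𝓡 n) V Z x
        + (fieldDeriv V f x • VectorField.mlieBracket (𝓡 n) V' Z x
        + f x • VectorField.mlieBracket (𝓡 n) V (VectorField.mlieBracket (𝓡 n) V' Z) x) := by
    intro V V' hV hV'
    have e1 : VectorField.mlieBracket (𝓡 n) V' (f • Z) =ᶠ[nhds x]
        (SpinStructure.fieldDeriv V' f • Z + f • VectorField.mlieBracket (𝓡 n) V' Z) := by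
      filter_upwards [hU] with y hy
      exact mlieBracket_smul_field hf V' hZ hy
    refine (Filter.EventuallyEq.mlieBracket_vectorField_eq (V := V) (V₁ := V)
      Filter.EventuallyEq.rfl e1).trans ?_
    rw [VectorField.mlieBracket_add_right ((hZ.smul (hf.fieldDeriv hV')).mdifferentiableAt hx)
        (((hV'.mlieBracket hZ).smul hf).mdifferentiableAt hx),
      mlieBracket_smul_field (hf.fieldDeriv hV') V hZ hx,
      mlieBracket_smul_field hf V (hV'.mlieBracket hZ) hx]
  rw [aux hX hY, aux hY hX, mlieBracket_smul_field hf _ hZ hx, key2] at key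
  refine smul_left_injective ℝ hZx ?_
  simp only [sub_smul]
  rw [smul_add] at key
  linear_combination (norm := module) -key

lemma fieldDeriv_mlieBracket [FiniteDimensional ℝ W] {f : M → W} (hf : P.SmoothOn i f)
    {X Y Z : (x : M) → TangentSpace (𝓡 n) x} (hX : P.SmoothField i X) (hY : P.SmoothField i Y)
    (hZ : P.SmoothField i Z) (hx : x ∈ P.U i) (hZx : Z x ≠ 0) :
    fieldDeriv (VectorField.mlieBracket (𝓡 n) X Y) f x
      = fieldDeriv X (fieldDeriv Y f) x - fieldDeriv Y (fieldDeriv X f) x := by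
  rw [← sub_eq_zero]
  refine (Module.forall_dual_apply_eq_zero_iff ℝ _).1 fun L => ?_
  have h1 := fieldDeriv_mlieBracket_real (hf.linear L) hX hY hZ hx hZx
  rw [fieldDeriv_congr (fun y hy => fieldDeriv_linear hf hy Y L) hx,
    fieldDeriv_congr (fun y hy => fieldDeriv_linear hf hy X L) hx,
    fieldDeriv_linear hf hx, fieldDeriv_linear (hf.fieldDeriv hY) hx,
    fieldDeriv_linear (hf.fieldDeriv hX) hx] at h1
  rw [map_sub, map_sub, h1, sub_self]

lemma frame_ne_zero (hx : x ∈ P.U i) (a : Fin n) : P.frame i a x ≠ 0 := fun h => by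
  have := P.orthonormal i x hx a a
  rw [if_pos rfl, h, map_zero] at this
  exact sgn_ne_zero (𝕜 := ℝ) η a this.symm

lemma dirDeriv_dirDeriv_sub [FiniteDimensional ℝ W] {f : M → W} (hf : P.SmoothOn i f)
    (hx : x ∈ P.U i) (a b : Fin n) :
    P.dirDeriv i a (P.dirDeriv i b f) x - P.dirDeriv i b (P.dirDeriv i a f) x
      = ∑ c, P.bracketUp i a b c x • P.dirDeriv i c f x := by
  -- The auxiliary nonvanishing field is the frame vector `e_a` itself.
  refine (fieldDeriv_mlieBracket hf (P.frame_smooth i a) (P.frame_smooth i b) (P.frame_smooth i a)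
    hx (frame_ne_zero hx a)).symm.trans ?_
  unfold SpinStructure.fieldDeriv SpinStructure.dirDeriv
  rw [mlieBracket_frame hx, map_sum]
  exact Finset.sum_congr rfl fun c _ => map_smul _ _ _

end SpinStructure

end Frames

/-! ### Independence of the exterior derivative from the frame. -/

section Covariance

variable {n : ℕ} {𝕜 : Type*} [RCLike 𝕜] {M : Type*} [TopologicalSpace M]
  [ChartedSpace (EuclideanSpace ℝ (Fin n)) M] [IsManifold (𝓡 n) ∞ M]
  {η : Fin n → ℤˣ} {g : PseudoMetric n M} {ι : Type*} (P : SpinStructure η g ι)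
  {W : Type*} [NormedAddCommGroup W] [NormedSpace ℝ W]

lemma hat_map (T : (Fin n → 𝕜) →ₗ[𝕜] (Fin n → 𝕜)) (X : Lam 𝕜 n) :
    hat (ExteriorAlgebra.map T X) = ExteriorAlgebra.map T (hat X) := by
  have : hat.comp (ExteriorAlgebra.map T) = (ExteriorAlgebra.map T).comp (hat : Lam 𝕜 n →ₐ[𝕜] _) := by
    refine ExteriorAlgebra.hom_ext (LinearMap.ext fun v => ?_)
    have e : ∀ v, hat (ExteriorAlgebra.ι 𝕜 v : Lam 𝕜 n) = -ExteriorAlgebra.ι 𝕜 v :=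
      CliffordAlgebra.involute_ι
    simp only [LinearMap.comp_apply, AlgHom.toLinearMap_apply, AlgHom.comp_apply, e, map_neg,
      ExteriorAlgebra.map_apply_ι]
  exact DFunLike.congr_fun this X

namespace SpinStructure

/-- The coefficients of the frame `j` in the frame `i`. -/
def frameMat (i j : ι) (x : M) (a b : Fin n) : ℝ :=
  sgn ℝ η a * g.val x (P.frame j b x) (P.frame i a x)

variable {P} {i j : ι} {x : M}

lemma sum_frameMat_smul (hi : x ∈ P.U i) (b : Fin n) :
    ∑ a, P.frameMat i j x a b • P.frame i a x = P.frame j b x := sum_smul_frame hi _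

lemma isFrameChange (hi : x ∈ P.U i) (hj : x ∈ P.U j) :
    IsFrameChange η (P.frameMat i j x) (P.trans i j x) where
  mem := P.trans_mem i j x ⟨hi, hj⟩
  orth b c := by
    rw [← P.orthonormal j x hj b c]
    conv_rhs => rw [← sum_frameMat_smul (i := i) (j := j) hi c]
    rw [map_sum]
    refine Finset.sum_congr rfl fun a _ => ?_
    rw [map_smul, smul_eq_mul, frameMat]
    linear_combination (g.val x (P.frame j b x) (P.frame i a x) * P.frameMat i j x a c) *
      sgn_mul_self ℝ η a
  intertwine b := by
    refine P.covers i j x ⟨hi, hj⟩ _ _ ?_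
    rw [sum_frameMat_smul hi, Finset.sum_eq_single b]
    · simp
    · intro c _ hc; simp [hc]
    · simp

variable (P) in
/-- The change of components of covectors from the frame `j` to the frame `i`. -/
def coTrans (𝕜 : Type*) [RCLike 𝕜] (i j : ι) (x : M) : (Fin n → 𝕜) →ₗ[𝕜] (Fin n → 𝕜) :=
  coMap 𝕜 η (P.frameMat i j x)

variable (P) in
/-- The coefficients of the frame `i` in the frame `j`. -/
def coMat (i j : ι) (b a : Fin n) (x : M) : ℝ :=
  sgn ℝ η b * g.val x (P.frame i a x) (P.frame j b x)

lemma sum_coMat_smul (hj : x ∈ P.U j) (a : Fin n) :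
    ∑ b, P.coMat i j b a x • P.frame j b x = P.frame i a x := sum_smul_frame hj _

lemma coTrans_apply (v : Fin n → 𝕜) (x : M) (a : Fin n) :
    P.coTrans 𝕜 i j x v a = ∑ b, (P.coMat i j b a x : 𝕜) * v b := by
  rw [coTrans, coMap_apply]
  refine Finset.sum_congr rfl fun b _ => ?_
  have e : P.coMat i j b a x = sgn ℝ η a * P.frameMat i j x a b * sgn ℝ η b := by
    rw [coMat, frameMat, g.symm]
    linear_combination (-sgn ℝ η b * g.val x (P.frame j b x) (P.frame i a x)) * sgn_mul_self ℝ η a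
  rw [e]
  simp [ofReal_sgn]

lemma coTrans_single (b : Fin n) (x : M) :
    P.coTrans 𝕜 i j x (Pi.single b 1) = fun a => (P.coMat i j b a x : 𝕜) := by
  funext a
  rw [coTrans_apply, Finset.sum_eq_single b]
  · simp
  · intro c _ hc; simp [hc]
  · simp

lemma frameEval_eq (hj : x ∈ P.U j) (i : ι) :
    P.frameEval (𝕜 := 𝕜) i x = P.coTrans 𝕜 i j x ∘ₗ P.frameEval j x := by
  refine LinearMap.ext fun α => funext fun a => ?_
  rw [LinearMap.comp_apply, coTrans_apply]
  simp only [frameEval, LinearMap.coe_mk, AddHom.coe_mk]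
  conv_lhs => rw [← sum_coMat_smul (i := i) hj a, map_sum]
  refine Finset.sum_congr rfl fun b _ => ?_
  rw [map_smul, RCLike.real_smul_eq_coe_mul]

lemma toFrame_eq (hj : x ∈ P.U j) (i : ι) (θ : FormField n M 𝕜) :
    P.toFrame i θ x = ExteriorAlgebra.map (P.coTrans 𝕜 i j x) (P.toFrame j θ x) := by
  rw [toFrame, frameEval_eq hj, ← ExteriorAlgebra.map_comp_map]
  rfl

lemma frameEval_comp_coframeComb (hx : x ∈ P.U i) :
    P.frameEval (𝕜 := 𝕜) i x ∘ₗ P.coframeComb i x = LinearMap.id := by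
  refine LinearMap.pi_ext' fun b => LinearMap.ext_ring (funext fun a => ?_)
  simp only [LinearMap.comp_apply, LinearMap.single_apply, frameEval, coframeComb,
    LinearMap.sum_apply, LinearMap.smulRight_apply, LinearMap.proj_apply, LinearMap.coe_mk,
    AddHom.coe_mk, LinearMap.id_apply]
  rw [Finset.sum_eq_single b]
  · simp only [Pi.single_eq_same, one_smul]
    change sgn 𝕜 η b • ((g.val x (P.frame i b x) (P.frame i a x) : ℝ) : 𝕜) = _
    rw [P.orthonormal i x hx]
    by_cases h : b = a
    · subst h; simp [ofReal_sgn, sgn_mul_self]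
    · rw [if_neg h, Pi.single_eq_of_ne (Ne.symm h)]; simp
  · intro c _ hc; simp [hc]
  · simp

lemma toFrame_ofFrame (hi : x ∈ P.U i) (F : M → Lam 𝕜 n) :
    P.toFrame i (fun y => P.ofFrame i y (F y)) x = F x := by
  rw [toFrame, ofFrame, ← AlgHom.comp_apply, ExteriorAlgebra.map_comp_map,
    frameEval_comp_coframeComb hi, ExteriorAlgebra.map_id]
  rfl

/-- Applied with `j = P.idx x`. The chosen index may jump from point to point, so smoothness and
derivatives only make sense after passing to a fixed frame `i`. -/
lemma toFrame_idx {θ : FormField n M 𝕜} {F : Lam 𝕜 n} (hj : x ∈ P.U j)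
    (h : θ x = P.ofFrame j x F) : P.toFrame i θ x
      = ExteriorAlgebra.map (P.coTrans 𝕜 i j x) F := by
  rw [toFrame_eq hj, ← toFrame_ofFrame hj (fun _ => F), toFrame, h]
  rfl

/-! ### Covariance of the exterior derivative -/

lemma sum_section_apply {κ : Type*} (s : Finset κ) (E : κ → (x : M) → TangentSpace (𝓡 n) x) (y : M) :
    (∑ k ∈ s, E k) y = ∑ k ∈ s, E k y := by
  classical
  induction s using Finset.induction_on with
  | empty => rfl
  | insert k s hk ih => rw [Finset.sum_insert hk, Finset.sum_insert hk, ← ih]; rfl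

lemma mlieBracket_sum_smul {κ : Type*} {s : Finset κ} {f : κ → M → ℝ}
    {E : κ → (x : M) → TangentSpace (𝓡 n) x} (V : (x : M) → TangentSpace (𝓡 n) x)
    (hf : ∀ k ∈ s, MDifferentiableAt (𝓡 n) 𝓘(ℝ, ℝ) (f k) x)
    (hE : ∀ k ∈ s, MDifferentiableAt (𝓡 n) (𝓡 n).tangent
      (fun x ↦ (⟨x, E k x⟩ : TangentBundle (𝓡 n) M)) x) :
    VectorField.mlieBracket (𝓡 n) V (∑ k ∈ s, f k • E k) x
      = ∑ k ∈ s, (fieldDeriv V (f k) x • E k x + f k x • VectorField.mlieBracket (𝓡 n) V (E k) x)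
      := by
  classical
  induction s using Finset.induction_on with
  | empty => simp
  | insert k s hk ih =>
    rw [Finset.sum_insert hk, Finset.sum_insert hk, ← ih (fun l hl => hf l (Finset.mem_insert_of_mem hl))
      (fun l hl => hE l (Finset.mem_insert_of_mem hl)), VectorField.mlieBracket_add_right,
      VectorField.mlieBracket_smul_right (hf k (Finset.mem_insert_self _ _))
        (hE k (Finset.mem_insert_self _ _))]
    · rfl
    · exact MDifferentiableAt.smul_section (hf k (Finset.mem_insert_self _ _))
        (hE k (Finset.mem_insert_self _ _))
    · have := MDifferentiableAt.sum_section (s := s) (t := fun k => f k • E k) (x₀ := x) fun l hl =>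
        MDifferentiableAt.smul_section (hf l (Finset.mem_insert_of_mem hl))
          (hE l (Finset.mem_insert_of_mem hl))
      simpa using this

lemma coMat_mdifferentiableAt (hi : x ∈ P.U i) (hj : x ∈ P.U j) (b a : Fin n) :
    MDifferentiableAt (𝓡 n) 𝓘(ℝ, ℝ) (P.coMat i j b a) x := by
  have h1 := contMDiffWithinAt_inner (g := g) (s := Set.univ)
    (SmoothField.contMDiffAt (P.frame_smooth i a) hi).contMDiffWithinAt
    (SmoothField.contMDiffAt (P.frame_smooth j b) hj).contMDiffWithinAt
  have h2 := h1.contMDiffAt Filter.univ_mem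
  exact (h2.mdifferentiableAt (by simp)).const_smul (sgn ℝ η b)

lemma dirDeriv_eq_sum (hj : x ∈ P.U j) (i : ι) (a : Fin n) (f : M → W) :
    P.dirDeriv i a f x = ∑ b, P.coMat i j b a x • P.dirDeriv j b f x := by
  unfold SpinStructure.dirDeriv
  rw [← sum_coMat_smul (i := i) hj a, map_sum]
  exact Finset.sum_congr rfl fun b _ => map_smul _ _ _

lemma mul_inner_frame (hx : x ∈ P.U i) (b d : Fin n) :
    sgn ℝ η b * g.val x (P.frame i d x) (P.frame i b x) = if d = b then 1 else 0 := by
  rw [P.orthonormal i x hx]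
  split_ifs with h
  · subst h; exact sgn_mul_self ℝ η d
  · rw [mul_zero]

/-- The bracket `[e_a, e_c]` of the frame `i` is computed in two ways, by its own structure
functions and by expanding both fields in the frame `j`; the coefficients of the `b`-th vector of
`j` are compared. -/
lemma coMat_structure (hi : x ∈ P.U i) (hj : x ∈ P.U j) (a c b : Fin n) :
    P.dirDeriv i a (P.coMat i j b c) x - P.dirDeriv i c (P.coMat i j b a) x
        + ∑ d, ∑ e, P.bracketUp j d e b x * (P.coMat i j d a x * P.coMat i j e c x)
      = ∑ f, P.bracketUp i a c f x * P.coMat i j b f x := by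
  have hU := Filter.inter_mem ((P.isOpen i).mem_nhds hi) ((P.isOpen j).mem_nhds hj)
  have hfr : ∀ c, P.frame i c =ᶠ[nhds x]
      ∑ e, (P.coMat i j e c • P.frame j e : (x : M) → TangentSpace (𝓡 n) x) := fun c => by
    filter_upwards [hU] with y hy
    exact (sum_coMat_smul hy.2 c).symm.trans
      (sum_section_apply Finset.univ (fun e => P.coMat i j e c • P.frame j e) y).symm
  have hE : ∀ e, MDifferentiableAt (𝓡 n) (𝓡 n).tangent
      (fun x ↦ (⟨x, P.frame j e x⟩ : TangentBundle (𝓡 n) M)) x := fun e =>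
    SmoothField.mdifferentiableAt (P.frame_smooth j e) hj
  have h1 : ∀ (V : (x : M) → TangentSpace (𝓡 n) x) c,
      VectorField.mlieBracket (𝓡 n) V (P.frame i c) x = ∑ e, (fieldDeriv V (P.coMat i j e c) x
        • P.frame j e x + P.coMat i j e c x • VectorField.mlieBracket (𝓡 n) V (P.frame j e) x) :=
    fun V c => by
      refine (Filter.EventuallyEq.mlieBracket_vectorField_eq (V := V) (V₁ := V)
        Filter.EventuallyEq.rfl (hfr c)).trans ?_
      exact mlieBracket_sum_smul V (fun e _ => coMat_mdifferentiableAt hi hj e c) fun e _ => hE e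
  have h2 := mlieBracket_frame hi a c
  rw [h1] at h2
  simp only [VectorField.mlieBracket_swap_apply (V := P.frame i a) (W := P.frame j _), h1,
    mlieBracket_frame hj] at h2
  let L : TangentSpace (𝓡 n) x →ₗ[ℝ] ℝ :=
    { toFun := fun v => sgn ℝ η b * g.val x v (P.frame j b x)
      map_add' := fun v w => by rw [map_add, add_apply, mul_add]
      map_smul' := fun c v => by
        rw [map_smul, smul_apply, smul_eq_mul, RingHom.id_apply, smul_eq_mul, mul_left_comm] }
  have hL : ∀ d, L (P.frame j d x) = if d = b then 1 else 0 := fun d => mul_inner_frame hj b d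
  have hL' : ∀ f, L (P.frame i f x) = P.coMat i j b f x := fun f => rfl
  have h3 := congrArg L h2
  simp only [map_sum, map_add, map_smul, map_neg, hL, hL', smul_eq_mul, mul_ite, mul_one, mul_zero,
    Finset.sum_add_distrib, Finset.sum_ite_eq', Finset.mem_univ, if_true, mul_neg, mul_add,
    Finset.sum_neg_distrib, neg_add] at h3
  have h4 : P.dirDeriv i c (P.coMat i j b a) x
      = ∑ e, P.coMat i j e c x * fieldDeriv (P.frame j e) (P.coMat i j b a) x :=
    dirDeriv_eq_sum hj i c _
  have h5 : ∑ d, ∑ e, P.bracketUp j d e b x * (P.coMat i j d a x * P.coMat i j e c x)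
      = -∑ e, P.coMat i j e c x * ∑ d, P.coMat i j d a x * P.bracketUp j e d b x := by
    rw [Finset.sum_comm, ← Finset.sum_neg_distrib]
    refine Finset.sum_congr rfl fun e _ => ?_
    rw [Finset.mul_sum, ← Finset.sum_neg_distrib]
    refine Finset.sum_congr rfl fun d _ => ?_
    rw [bracketUp, bracketUp, bracketCoeff_swap e d b]
    ring
  rw [h4, h5, ← h3]
  change fieldDeriv (P.frame i a) (P.coMat i j b c) x - _ + _ = _
  ring

/-! The exterior derivative is an antiderivation. -/

variable (P) in
/-- The zeroth order part of the exterior derivative. -/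
def strOp (𝕜 : Type*) [RCLike 𝕜] (i : ι) (x : M) : Lam 𝕜 n →ₗ[𝕜] Lam 𝕜 n :=
  (1 / 2 : 𝕜) • ∑ a, ∑ b, ∑ c, (P.bracketUp i a b c x : 𝕜) •
    (LinearMap.mulLeft 𝕜 (coE a * coE b) ∘ₗ contr c)

lemma strOp_apply (i : ι) (x : M) (X : Lam 𝕜 n) : P.strOp 𝕜 i x X
    = (1 / 2 : 𝕜) • ∑ a, ∑ b, ∑ c, (P.bracketUp i a b c x : 𝕜) • (coE a * coE b * contr c X) := by
  simp [strOp, LinearMap.sum_apply, mul_assoc]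

lemma extD_eq' {F : M → Lam 𝕜 n} (hF : MDifferentiableAt (𝓡 n) 𝓘(ℝ, Lam 𝕜 n) F x) (i : ι) :
    P.extD i F x = ∑ a, coE a * P.dirDeriv i a F x - P.strOp 𝕜 i x (F x) := by
  simp only [extD, lamDeriv_eq' hF, strOp_apply]

lemma strOp_mul (i : ι) (x : M) (X Y : Lam 𝕜 n) :
    P.strOp 𝕜 i x (X * Y) = P.strOp 𝕜 i x X * Y + hat X * P.strOp 𝕜 i x Y := by
  have e : ∀ a b c, coE a * coE b * contr c (X * Y)
      = coE a * coE b * contr c X * Y + hat X * (coE a * coE b * contr c Y) := fun a b c => by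
    have e2 : coE a * coE b * hat X = hat X * (coE a * coE b) := by
      rw [mul_assoc, ← mul_coE, ← mul_assoc, ← hat_mul_coE, mul_assoc]
    rw [contr_mul, mul_add, ← mul_assoc, ← mul_assoc, e2, mul_assoc (hat X)]
  simp only [strOp_apply, e, smul_mul_assoc, mul_smul_comm, Finset.sum_mul, Finset.mul_sum,
    ← smul_add, ← Finset.sum_add_distrib]

lemma MDifferentiableAt.lam_mul {F G : M → Lam 𝕜 n}
    (hF : MDifferentiableAt (𝓡 n) 𝓘(ℝ, Lam 𝕜 n) F x)
    (hG : MDifferentiableAt (𝓡 n) 𝓘(ℝ, Lam 𝕜 n) G x) :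
    MDifferentiableAt (𝓡 n) 𝓘(ℝ, Lam 𝕜 n) (fun y => F y * G y) x := by
  obtain ⟨L, hL, -⟩ := hasMFDerivAt_bilin hF hG (LinearMap.mul ℝ (Lam 𝕜 n))
  exact hL.mdifferentiableAt

lemma extD_mul {F G : M → Lam 𝕜 n} (hF : MDifferentiableAt (𝓡 n) 𝓘(ℝ, Lam 𝕜 n) F x)
    (hG : MDifferentiableAt (𝓡 n) 𝓘(ℝ, Lam 𝕜 n) G x) (i : ι) :
    P.extD i (fun y => F y * G y) x = P.extD i F x * G x + hat (F x) * P.extD i G x := by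
  have e : ∀ a, P.dirDeriv i a (fun y => F y * G y) x
      = P.dirDeriv i a F x * G x + F x * P.dirDeriv i a G x := fun a =>
    dirDeriv_bilin' hF hG a (LinearMap.mul ℝ (Lam 𝕜 n))
  rw [extD_eq' hF, extD_eq' hG, extD_eq' (MDifferentiableAt.lam_mul hF hG), strOp_mul]
  simp only [e, mul_add, Finset.sum_add_distrib, sub_mul, mul_sub, Finset.sum_mul, Finset.mul_sum,
    ← mul_assoc, hat_mul_coE]
  abel

variable (P) in
/-- Covariance of the exterior derivative at a point, for a field of forms in the frame `j`. -/
def ExtDCovariant (i j : ι) (x : M) (F : M → Lam 𝕜 n) : Prop :=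
  MDifferentiableAt (𝓡 n) 𝓘(ℝ, Lam 𝕜 n) F x ∧
  MDifferentiableAt (𝓡 n) 𝓘(ℝ, Lam 𝕜 n)
    (fun y => ExteriorAlgebra.map (P.coTrans 𝕜 i j y) (F y)) x ∧
  P.extD i (fun y => ExteriorAlgebra.map (P.coTrans 𝕜 i j y) (F y)) x
    = ExteriorAlgebra.map (P.coTrans 𝕜 i j x) (P.extD j F x)

/-- The exterior derivative is an antiderivation in either frame and the change of frame is
multiplicative, so it suffices to check covariance on functions and coframe elements. The
differentiability clauses of `ExtDCovariant` are what the product rule needs. -/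
lemma ExtDCovariant.mul {F G : M → Lam 𝕜 n} (hF : P.ExtDCovariant i j x F)
    (hG : P.ExtDCovariant i j x G) : P.ExtDCovariant i j x (fun y => F y * G y) := by
  refine ⟨MDifferentiableAt.lam_mul hF.1 hG.1, ?_, ?_⟩
  · simp only [map_mul]; exact MDifferentiableAt.lam_mul hF.2.1 hG.2.1
  · simp only [map_mul]
    rw [extD_mul hF.2.1 hG.2.1, extD_mul hF.1 hG.1, hF.2.2, hG.2.2, map_add, map_mul, map_mul,
      hat_map]

lemma extD_sum' {κ : Type*} {s : Finset κ} {F : κ → M → Lam 𝕜 n}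
    (h : ∀ k ∈ s, MDifferentiableAt (𝓡 n) 𝓘(ℝ, Lam 𝕜 n) (F k) x) (i : ι) :
    P.extD i (fun y => ∑ k ∈ s, F k y) x = ∑ k ∈ s, P.extD i (F k) x := by
  rw [extD_eq' (mdifferentiableAt_sum h), map_sum, Finset.sum_congr rfl fun k hk => extD_eq' (h k hk) i,
    Finset.sum_sub_distrib]
  simp only [dirDeriv_sum' h, Finset.mul_sum]
  rw [Finset.sum_comm]

lemma ExtDCovariant.sum {κ : Type*} {s : Finset κ} {F : κ → M → Lam 𝕜 n}
    (h : ∀ k ∈ s, P.ExtDCovariant i j x (F k)) :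
    P.ExtDCovariant i j x (fun y => ∑ k ∈ s, F k y) := by
  refine ⟨mdifferentiableAt_sum fun k hk => (h k hk).1, ?_, ?_⟩
  · simp only [map_sum]; exact mdifferentiableAt_sum fun k hk => (h k hk).2.1
  · simp only [map_sum]
    rw [extD_sum' (fun k hk => (h k hk).2.1), extD_sum' (fun k hk => (h k hk).1), map_sum]
    exact Finset.sum_congr rfl fun k hk => (h k hk).2.2

lemma mdifferentiableAt_linear {W' : Type*} [NormedAddCommGroup W'] [NormedSpace ℝ W']
    [FiniteDimensional ℝ W] {f : M → W} (hf : MDifferentiableAt (𝓡 n) 𝓘(ℝ, W) f x)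
    (L : W →ₗ[ℝ] W') : MDifferentiableAt (𝓡 n) 𝓘(ℝ, W') (fun y => L (f y)) x :=
  MDifferentiableAt.comp (I' := 𝓘(ℝ, W)) (g := LinearMap.toContinuousLinearMap L) x
    (LinearMap.toContinuousLinearMap L).differentiableAt.mdifferentiableAt hf

lemma extDCovariant_function (hj : x ∈ P.U j) {c : M → 𝕜}
    (hc : MDifferentiableAt (𝓡 n) 𝓘(ℝ, 𝕜) c x) :
    P.ExtDCovariant i j x (fun y => c y • (1 : Lam 𝕜 n)) := by
  let L : 𝕜 →ₗ[ℝ] Lam 𝕜 n := (LinearMap.toSpanSingleton 𝕜 (Lam 𝕜 n) 1).restrictScalars ℝ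
  have h1 : MDifferentiableAt (𝓡 n) 𝓘(ℝ, Lam 𝕜 n) (fun y => c y • (1 : Lam 𝕜 n)) x :=
    mdifferentiableAt_linear hc L
  have h2 : ∀ i a, P.dirDeriv i a (fun y => c y • (1 : Lam 𝕜 n)) x
      = P.dirDeriv i a c x • (1 : Lam 𝕜 n) := fun i a => dirDeriv_linear' hc a L
  have h3 : ∀ i, P.extD i (fun y => c y • (1 : Lam 𝕜 n)) x
      = ∑ a, P.dirDeriv i a c x • (coE a : Lam 𝕜 n) := fun i => by
    rw [extD_eq' h1, map_smul, strOp_apply]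
    simp [h2]
  refine ⟨h1, by simpa only [map_smul, map_one] using h1, ?_⟩
  simp only [map_smul, map_one, h3, map_sum]
  have h4 : ∀ b, ExteriorAlgebra.map (P.coTrans 𝕜 i j x) (coE b)
      = ∑ a, (P.coMat i j b a x : 𝕜) • (coE a : Lam 𝕜 n) := fun b => by
    rw [coE, ExteriorAlgebra.map_apply_ι, coTrans_single, ι_eq_sum]
  simp only [h4, Finset.smul_sum]
  rw [Finset.sum_comm]
  refine Finset.sum_congr rfl fun a _ => ?_
  rw [dirDeriv_eq_sum hj i a, Finset.sum_smul]
  refine Finset.sum_congr rfl fun b _ => ?_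
  rw [smul_smul, RCLike.real_smul_eq_coe_mul, mul_comm]

lemma sum_comm_comm {κ V : Type*} [Fintype κ] [AddCommMonoid V] (f : κ → κ → κ → κ → V) :
    ∑ d, ∑ e, ∑ a, ∑ c, f d e a c = ∑ a, ∑ c, ∑ d, ∑ e, f d e a c :=
  calc _ = ∑ d, ∑ a, ∑ e, ∑ c, f d e a c := Finset.sum_congr rfl fun _ _ => Finset.sum_comm
    _ = ∑ a, ∑ d, ∑ e, ∑ c, f d e a c := Finset.sum_comm
    _ = ∑ a, ∑ d, ∑ c, ∑ e, f d e a c := Finset.sum_congr rfl fun _ _ =>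
      Finset.sum_congr rfl fun _ _ => Finset.sum_comm
    _ = _ := Finset.sum_congr rfl fun _ _ => Finset.sum_comm

/-- Both sides express `d e^b` in the frame `i`; antisymmetrized in the two wedge indices, their
equality is `coMat_structure`. -/
lemma extDCovariant_coE (hi : x ∈ P.U i) (hj : x ∈ P.U j) (b : Fin n) :
    P.ExtDCovariant i j x (fun _ => (coE b : Lam 𝕜 n)) := by
  have h4 : ∀ b y, ExteriorAlgebra.map (P.coTrans 𝕜 i j y) (coE b)
      = ∑ a, P.coMat i j b a y • (coE a : Lam 𝕜 n) := fun b y => by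
    rw [coE, ExteriorAlgebra.map_apply_ι, coTrans_single, ι_eq_sum]
    exact Finset.sum_congr rfl fun a _ => algebraMap_smul 𝕜 _ _
  have h5 : ∀ a, MDifferentiableAt (𝓡 n) 𝓘(ℝ, Lam 𝕜 n)
      (fun y => P.coMat i j b a y • (coE a : Lam 𝕜 n)) x := fun a =>
    mdifferentiableAt_linear (coMat_mdifferentiableAt hi hj b a)
      (LinearMap.toSpanSingleton ℝ (Lam 𝕜 n) (coE a))
  have h6 : ∀ a c, P.dirDeriv i c (fun y => P.coMat i j b a y • (coE a : Lam 𝕜 n)) x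
      = P.dirDeriv i c (P.coMat i j b a) x • (coE a : Lam 𝕜 n) := fun a c =>
    dirDeriv_linear' (coMat_mdifferentiableAt hi hj b a) c
      (LinearMap.toSpanSingleton ℝ (Lam 𝕜 n) (coE a))
  refine ⟨mdifferentiableAt_const, ?_, ?_⟩
  · simp only [h4]; exact mdifferentiableAt_sum fun a _ => h5 a
  have hc : ∀ a b, contr a (coE b : Lam 𝕜 n) = if a = b then 1 else 0 := fun a b => by
    have := contr_coE_mul a b (1 : Lam 𝕜 n)
    simpa using this
  simp only [h4]
  rw [extD_eq' (mdifferentiableAt_sum fun a _ => h5 a), extD_eq' mdifferentiableAt_const]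
  simp only [dirDeriv_sum' (fun a _ => h5 a), h6, dirDeriv_const, mul_zero, Finset.sum_const_zero,
    zero_sub, map_neg]
  have hs : ∀ (r : ℝ) (X : Lam 𝕜 n), (r : 𝕜) • X = r • X := fun r X => algebraMap_smul 𝕜 r X
  have hhalf : ∀ X : Lam 𝕜 n, (1 / 2 : 𝕜) • X = (1 / 2 : ℝ) • X := fun X => by
    rw [← hs, RCLike.ofReal_div, RCLike.ofReal_one, RCLike.ofReal_ofNat]
  have hstr : ∀ i b, P.strOp 𝕜 i x (coE b)
      = (1 / 2 : ℝ) • ∑ a, ∑ c, P.bracketUp i a c b x • (coE a * coE c : Lam 𝕜 n) := fun i b => by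
    rw [strOp_apply, hhalf]
    simp only [hc, hs, mul_ite, mul_one, mul_zero, smul_ite, smul_zero, Finset.sum_ite_eq',
      Finset.mem_univ, if_true]
  have e1 : P.strOp 𝕜 i x (∑ a, P.coMat i j b a x • (coE a : Lam 𝕜 n))
      = (1 / 2 : ℝ) • ∑ a, ∑ c, (∑ f, P.bracketUp i a c f x * P.coMat i j b f x) •
        (coE a * coE c : Lam 𝕜 n) := by
    simp only [← hs, map_sum, map_smul]
    simp only [hs, hstr, Finset.smul_sum, Finset.sum_smul, smul_smul]
    rw [Finset.sum_comm]
    refine Finset.sum_congr rfl fun a _ => ?_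
    rw [Finset.sum_comm]
    refine Finset.sum_congr rfl fun c _ => Finset.sum_congr rfl fun f _ => ?_
    congr 1
    ring
  have e2 : ExteriorAlgebra.map (P.coTrans 𝕜 i j x) (P.strOp 𝕜 j x (coE b))
      = (1 / 2 : ℝ) • ∑ a, ∑ c, (∑ d, ∑ e, P.bracketUp j d e b x *
        (P.coMat i j d a x * P.coMat i j e c x)) • (coE a * coE c : Lam 𝕜 n) := by
    rw [hstr]
    simp only [← hs, map_smul, map_sum, map_mul, h4]
    simp only [hs, Finset.sum_mul_sum, smul_mul_smul_comm, Finset.smul_sum, Finset.sum_smul,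
      smul_smul]
    rw [sum_comm_comm]
    refine Finset.sum_congr rfl fun a _ => Finset.sum_congr rfl fun c _ =>
      Finset.sum_congr rfl fun d _ => Finset.sum_congr rfl fun e _ => ?_
    module
  -- Only the antisymmetric part of the derivative of `coMat` contributes against `e^a ∧ e^c`; the
  -- factor `1/2` compensates for counting each pair twice.
  have e3 : (1 / 2 : ℝ) • ∑ a, ∑ c, (P.dirDeriv i a (P.coMat i j b c) x
        - P.dirDeriv i c (P.coMat i j b a) x) • (coE a * coE c : Lam 𝕜 n)
      = ∑ a, coE a * ∑ c, P.dirDeriv i a (P.coMat i j b c) x • (coE c : Lam 𝕜 n) := by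
    simp only [sub_smul, Finset.sum_sub_distrib, Finset.mul_sum, mul_smul_comm]
    rw [Finset.sum_comm (f := fun a c => P.dirDeriv i c (P.coMat i j b a) x • (coE a * coE c))]
    have e : ∑ c, ∑ a, P.dirDeriv i c (P.coMat i j b a) x • (coE a * coE c : Lam 𝕜 n)
        = -∑ c, ∑ a, P.dirDeriv i c (P.coMat i j b a) x • (coE c * coE a : Lam 𝕜 n) := by
      rw [← Finset.sum_neg_distrib]
      refine Finset.sum_congr rfl fun c _ => ?_
      rw [← Finset.sum_neg_distrib]
      exact Finset.sum_congr rfl fun a _ => by rw [coE_mul_coE, smul_neg]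
    rw [e, sub_neg_eq_add, ← two_smul ℝ, smul_smul]
    norm_num
  rw [e1, e2, ← e3]
  simp only [← coMat_structure hi hj, add_smul, Finset.sum_add_distrib, smul_add]
  abel

/-- Every form is a sum of functions times products of coframe elements, and covariance passes to
sums and products. -/
lemma extDCovariant_of_mdifferentiableAt (hi : x ∈ P.U i) (hj : x ∈ P.U j) {F : M → Lam 𝕜 n}
    (hF : MDifferentiableAt (𝓡 n) 𝓘(ℝ, Lam 𝕜 n) F x) : P.ExtDCovariant i j x F := by
  have h1 : F = fun y => ∑ A, ((lamBasis 𝕜 n).repr (F y) A • (1 : Lam 𝕜 n)) * coEProd A := by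
    funext y
    conv_lhs => rw [← (lamBasis 𝕜 n).sum_repr (F y)]
    simp only [lamBasis_apply, smul_mul_assoc, one_mul]
  have h2 : ∀ l : List (Fin n), P.ExtDCovariant i j x (fun _ => ((l.map coE).prod : Lam 𝕜 n)) := by
    intro l
    induction l with
    | nil => simpa using extDCovariant_function hj (mdifferentiableAt_const (c := (1 : 𝕜)))
    | cons b l ih =>
      simp only [List.map_cons, List.prod_cons]
      exact (extDCovariant_coE hi hj b).mul ih
  rw [h1]
  refine ExtDCovariant.sum fun A _ => ExtDCovariant.mul (extDCovariant_function hj ?_) (h2 _)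
  exact mdifferentiableAt_linear hF (((LinearMap.proj A : (Finset (Fin n) → 𝕜) →ₗ[𝕜] 𝕜) ∘ₗ
      (lamCoord 𝕜 n).toLinearMap).restrictScalars ℝ)

lemma extD_toFrame {θ : FormField n M 𝕜} (hθ : P.SmoothForm θ) (hi : x ∈ P.U i) (hj : x ∈ P.U j) :
    P.extD i (P.toFrame i θ) x
      = ExteriorAlgebra.map (P.coTrans 𝕜 i j x) (P.extD j (P.toFrame j θ) x) := by
  have hs := smoothForm_iff.1 hθ
  have hev : (fun y => ExteriorAlgebra.map (P.coTrans 𝕜 i j y) (P.toFrame j θ y))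
      =ᶠ[nhds x] P.toFrame i θ := by
    filter_upwards [(P.isOpen j).mem_nhds hj] with y hy
    exact (toFrame_eq hy i θ).symm
  obtain ⟨-, h1, h2⟩ := extDCovariant_of_mdifferentiableAt hi hj ((hs j).mdifferentiableAt hj)
  rw [← h2, extD_eq' h1, extD_eq' ((hs i).mdifferentiableAt hi), hev.eq_of_nhds]
  congr 1
  refine Finset.sum_congr rfl fun a _ => ?_
  congr 1
  unfold SpinStructure.dirDeriv
  rw [hev.mfderiv_eq]
  rfl

end SpinStructure

end Covariance

/-! ### The Levi-Civita connection on forms and the Ricci identity. -/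

section FormConnection

variable {n : ℕ} {𝕜 : Type*} [RCLike 𝕜] {M : Type*} [TopologicalSpace M]
  [ChartedSpace (EuclideanSpace ℝ (Fin n)) M] [IsManifold (𝓡 n) ∞ M]
  {η : Fin n → ℤˣ} {g : PseudoMetric n M} {ι : Type*} (P : SpinStructure η g ι)

/-- A real matrix with entries in `𝕜`. -/
def realMat (𝕜 : Type*) [RCLike 𝕜] (m : Fin n → Fin n → ℝ) : Fin n → Fin n → 𝕜 :=
  fun b c => (m b c : 𝕜)

/-- The derivation of the exterior algebra induced by a real matrix. -/
def rotReal (𝕜 : Type*) [RCLike 𝕜] : (Fin n → Fin n → ℝ) →ₗ[ℝ] Lam 𝕜 n →ₗ[ℝ] Lam 𝕜 n :=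
  LinearMap.mk₂ ℝ (fun m X => rot (realMat 𝕜 m) X)
    (fun m m' X => by
      simp only [rot_apply, realMat, Pi.add_apply, RCLike.ofReal_add, add_smul,
        Finset.sum_add_distrib])
    (fun r m X => by
      simp only [rot_apply, realMat, Pi.smul_apply, smul_eq_mul, RCLike.ofReal_mul, mul_smul,
        ← Finset.smul_sum]
      exact algebraMap_smul 𝕜 r _)
    (fun m X Y => map_add _ _ _)
    (fun r m X => ((rot (realMat 𝕜 m)).restrictScalars ℝ).map_smul r X)

lemma rotReal_apply (m : Fin n → Fin n → ℝ) (X : Lam 𝕜 n) :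
    rotReal 𝕜 m X = rot (realMat 𝕜 m) X := rfl

namespace SpinStructure

/-- The matrix of the connection in direction `e_a`. -/
def connMat (i : ι) (a : Fin n) (x : M) : Fin n → Fin n → ℝ := fun b c => P.connUp i a b c x

variable {P} {i : ι} {x : M} {F F' : M → Lam 𝕜 n}

lemma connMat_smooth (i : ι) (a : Fin n) : P.SmoothOn i (P.connMat i a) :=
  contMDiffOn_pi_space.2 fun b => contMDiffOn_pi_space.2 fun c => connUp_smooth a b c

lemma dirDeriv_connMat (hx : x ∈ P.U i) (a b : Fin n) (c d : Fin n) :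
    P.dirDeriv i a (P.connMat i b) x c d = P.dirDeriv i a (P.connUp i b c d) x :=
  (dirDeriv_linear (connMat_smooth i b) hx a
    ((LinearMap.proj d : (Fin n → ℝ) →ₗ[ℝ] ℝ) ∘ₗ
      (LinearMap.proj c : (Fin n → Fin n → ℝ) →ₗ[ℝ] (Fin n → ℝ)))).symm

lemma isSkew_connMat (i : ι) (a : Fin n) (x : M) : IsSkew η (realMat 𝕜 (P.connMat i a x)) := by
  intro b c
  have h : sgn ℝ η c * P.connUp i a b c x = -(sgn ℝ η b * P.connUp i a c b x) := by
    rw [connUp, connUp, ← mul_assoc, ← mul_assoc, sgn_mul_self, sgn_mul_self, one_mul, one_mul,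
      connCoeff_swap a c b]
  have := congrArg (fun r : ℝ => (r : 𝕜)) h
  simpa [realMat, connMat, ofReal_sgn] using this

lemma covForm_eq (hF : P.SmoothOn i F) (hx : x ∈ P.U i) (a : Fin n) :
    P.covForm i a F x = P.dirDeriv i a F x - rotReal 𝕜 (P.connMat i a x) (F x) := by
  rw [covForm, lamDeriv_eq hF hx, rotReal_apply, rot_apply]
  rfl

lemma SmoothOn.covForm (hF : P.SmoothOn i F) (a : Fin n) : P.SmoothOn i (P.covForm i a F) :=
  ((hF.dirDeriv a).sub ((connMat_smooth i a).bilin hF (rotReal 𝕜))).congr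
    fun _ hy => covForm_eq hF hy a

lemma SmoothOn.lam_mul (hF : P.SmoothOn i F) (hF' : P.SmoothOn i F') :
    P.SmoothOn i (fun y => F y * F' y) := hF.bilin hF' (LinearMap.mul ℝ (Lam 𝕜 n))

lemma SmoothOn.lam (hF : P.SmoothOn i F) (L : Lam 𝕜 n →ₗ[𝕜] Lam 𝕜 n) :
    P.SmoothOn i (fun y => L (F y)) := hF.linear (L.restrictScalars ℝ)

lemma dirDeriv_lam (hF : P.SmoothOn i F) (hx : x ∈ P.U i) (a : Fin n)
    (L : Lam 𝕜 n →ₗ[𝕜] Lam 𝕜 n) :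
    P.dirDeriv i a (fun y => L (F y)) x = L (P.dirDeriv i a F x) :=
  dirDeriv_linear hF hx a (L.restrictScalars ℝ)

lemma covForm_congr (hF : P.SmoothOn i F) (h : ∀ y ∈ P.U i, F' y = F y) (hx : x ∈ P.U i)
    (a : Fin n) : P.covForm i a F' x = P.covForm i a F x := by
  rw [covForm_eq (hF.congr h) hx, covForm_eq hF hx, h x hx, dirDeriv_congr h hx]

lemma covForm_sub' (hF : P.SmoothOn i F) (hF' : P.SmoothOn i F') (hx : x ∈ P.U i) (a : Fin n) :
    P.covForm i a (fun y => F y - F' y) x = P.covForm i a F x - P.covForm i a F' x := by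
  rw [covForm_eq (hF.sub hF') hx, covForm_eq hF hx, covForm_eq hF' hx, dirDeriv_sub hF hF' hx,
    map_sub]
  abel

lemma covForm_commute (hF : P.SmoothOn i F) (hx : x ∈ P.U i) (a : Fin n)
    (L : Lam 𝕜 n →ₗ[𝕜] Lam 𝕜 n)
    (hL : ∀ X, L (rotReal 𝕜 (P.connMat i a x) X) = rotReal 𝕜 (P.connMat i a x) (L X)) :
    P.covForm i a (fun y => L (F y)) x = L (P.covForm i a F x) := by
  rw [covForm_eq (hF.lam L) hx, covForm_eq hF hx, dirDeriv_lam hF hx, map_sub, hL]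

/-- The extra sum is contraction with `∇_{e_a} e_b`: the frame vector is not parallel. -/
lemma covForm_contr (hF : P.SmoothOn i F) (hx : x ∈ P.U i) (a b : Fin n) :
    P.covForm i a (fun y => contr b (F y)) x = contr b (P.covForm i a F x)
      + ∑ c, (P.connUp i a b c x : 𝕜) • contr c (F x) := by
  rw [covForm_eq (hF.lam (contr b)) hx, covForm_eq hF hx, dirDeriv_lam hF hx, map_sub,
    rotReal_apply, rotReal_apply, contr_rot]
  simp only [realMat, connMat]
  abel

lemma SmoothOn.contrProd (hF : P.SmoothOn i F) (hF' : P.SmoothOn i F') :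
    P.SmoothOn i (fun y => contrProd η (F y) (F' y)) :=
  SmoothOn.sum fun a _ => ((hF.lam (contr a)).lam_mul (hF'.lam (contr a))).lam
    (sgn 𝕜 η a • LinearMap.id)

lemma dirDeriv_contrProd (hF : P.SmoothOn i F) (hF' : P.SmoothOn i F') (hx : x ∈ P.U i)
    (a : Fin n) : P.dirDeriv i a (fun y => SpinGeom.contrProd η (F y) (F' y)) x
      = SpinGeom.contrProd η (P.dirDeriv i a F x) (F' x)
        + SpinGeom.contrProd η (F x) (P.dirDeriv i a F' x) := by
  have h1 : ∀ b, P.SmoothOn i (fun y => contr b (F y) * contr b (F' y)) := fun b =>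
    (hF.lam (contr b)).lam_mul (hF'.lam (contr b))
  have h2 : ∀ b, P.dirDeriv i a (fun y => contr b (F y) * contr b (F' y)) x
      = contr b (P.dirDeriv i a F x) * contr b (F' x)
        + contr b (F x) * contr b (P.dirDeriv i a F' x) := fun b => by
    rw [← dirDeriv_lam hF hx, ← dirDeriv_lam hF' hx]
    exact dirDeriv_bilin (hF.lam (contr b)) (hF'.lam (contr b)) hx a (LinearMap.mul ℝ (Lam 𝕜 n))
  have h3 := dirDeriv_sum (s := Finset.univ)
    (f := fun b y => (sgn 𝕜 η b • LinearMap.id : Lam 𝕜 n →ₗ[𝕜] Lam 𝕜 n)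
      (contr b (F y) * contr b (F' y))) (fun b _ => (h1 b).lam _) hx a
  have h4 : ∀ b, P.dirDeriv i a (fun y => (sgn 𝕜 η b • LinearMap.id : Lam 𝕜 n →ₗ[𝕜] Lam 𝕜 n)
      (contr b (F y) * contr b (F' y))) x = sgn 𝕜 η b • (contr b (P.dirDeriv i a F x) *
        contr b (F' x)) + sgn 𝕜 η b • (contr b (F x) * contr b (P.dirDeriv i a F' x)) := fun b => by
    rw [dirDeriv_lam (h1 b) hx, h2, LinearMap.smul_apply, LinearMap.id_apply, smul_add]
  simp only [h4, Finset.sum_add_distrib] at h3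
  exact h3

lemma covForm_contrProd (hF : P.SmoothOn i F) (hF' : P.SmoothOn i F') (hx : x ∈ P.U i)
    (a : Fin n) : P.covForm i a (fun y => contrProd η (F y) (F' y)) x
      = contrProd η (P.covForm i a F x) (F' x) + contrProd η (F x) (P.covForm i a F' x) := by
  rw [covForm_eq (hF.contrProd hF') hx, covForm_eq hF hx, covForm_eq hF' hx,
    dirDeriv_contrProd hF hF' hx, rotReal_apply, (isSkew_connMat i a x).rot_contrProd]
  simp only [rotReal_apply, contrProd, map_sub, sub_mul, mul_sub, smul_sub, Finset.sum_sub_distrib]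
  abel

/-- Torsion-freeness writes the structure functions as antisymmetrized connection coefficients, so
the zeroth order parts agree. -/
lemma extD_eq_sum_covForm (hF : P.SmoothOn i F) (hx : x ∈ P.U i) :
    P.extD i F x = ∑ a, coE a * P.covForm i a F x := by
  rw [extD_eq' (hF.mdifferentiableAt hx)]
  simp only [covForm_eq hF hx, mul_sub, Finset.sum_sub_distrib]
  congr 1
  simp only [strOp_apply, rotReal_apply, rot_apply, Finset.mul_sum, mul_smul_comm, ← mul_assoc,
    realMat, connMat, ← connUp_sub, RCLike.ofReal_sub, sub_smul, Finset.sum_sub_distrib]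
  have e : ∑ a, ∑ b, ∑ c, (P.connUp i b a c x : 𝕜) • (coE a * coE b * contr c (F x))
      = -∑ a, ∑ b, ∑ c, (P.connUp i a b c x : 𝕜) • (coE a * coE b * contr c (F x)) := by
    rw [Finset.sum_comm]
    simp only [← Finset.sum_neg_distrib]
    refine Finset.sum_congr rfl fun a _ => Finset.sum_congr rfl fun b _ =>
      Finset.sum_congr rfl fun c _ => ?_
    rw [coE_mul_coE, neg_mul, smul_neg]
  rw [e, sub_neg_eq_add, ← two_smul 𝕜, smul_smul, one_div, inv_mul_cancel₀ two_ne_zero, one_smul]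

lemma SmoothOn.extD (hF : P.SmoothOn i F) : P.SmoothOn i (P.extD i F) :=
  (SmoothOn.sum fun a _ => (hF.covForm a).lam (LinearMap.mulLeft 𝕜 (coE a))).congr
    fun _ hy => extD_eq_sum_covForm hF hy

/-- On `U i` the form equals its own projection to degree `p`, and this constant linear map commutes
with derivatives. -/
lemma dirDeriv_mem {p : ℕ} (hF : P.SmoothOn i F) (hp : ∀ y ∈ P.U i, F y ∈ ⋀[𝕜]^p (Fin n → 𝕜))
    (hx : x ∈ P.U i) (a : Fin n) : P.dirDeriv i a F x ∈ ⋀[𝕜]^p (Fin n → 𝕜) := by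
  have h : ∀ y ∈ P.U i, F y = lamProj p (F y) := fun y hy => by
    rw [lamProj_of_mem (hp y hy), if_pos rfl]
  rw [dirDeriv_congr h hx, dirDeriv_lam hF hx]
  exact lamProj_mem p _

lemma covForm_mem {p : ℕ} (hF : P.SmoothOn i F) (hp : ∀ y ∈ P.U i, F y ∈ ⋀[𝕜]^p (Fin n → 𝕜))
    (hx : x ∈ P.U i) (a : Fin n) : P.covForm i a F x ∈ ⋀[𝕜]^p (Fin n → 𝕜) := by
  rw [covForm_eq hF hx]
  exact Submodule.sub_mem _ (dirDeriv_mem hF hp hx a) (rot_mem _ (hp x hx))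

lemma extD_mem {p : ℕ} (hF : P.SmoothOn i F) (hp : ∀ y ∈ P.U i, F y ∈ ⋀[𝕜]^p (Fin n → 𝕜))
    (hx : x ∈ P.U i) : P.extD i F x ∈ ⋀[𝕜]^(p + 1) (Fin n → 𝕜) := by
  rw [extD_eq_sum_covForm hF hx]
  exact Submodule.sum_mem _ fun a _ => coE_mul_mem a (covForm_mem hF hp hx a)

/-- The Ricci identity, for a connection induced by a representation `r` of the orthogonal Lie
algebra. -/
lemma ricci_identity {W : Type*} [NormedAddCommGroup W] [NormedSpace ℝ W] [FiniteDimensional ℝ W]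
    (r : (Fin n → Fin n → ℝ) →ₗ[ℝ] W →ₗ[ℝ] W) {f : M → W} (hf : P.SmoothOn i f) (hx : x ∈ P.U i)
    {D : Fin n → M → W}
    (hD : ∀ a, ∀ y ∈ P.U i, D a y = P.dirDeriv i a f y - r (P.connMat i a y) (f y)) (a b : Fin n)
    (hr : r (P.connMat i a x) (r (P.connMat i b x) (f x))
      - r (P.connMat i b x) (r (P.connMat i a x) (f x))
      = r (fun c d => ∑ e, (P.connMat i a x c e * P.connMat i b x e d
        - P.connMat i b x c e * P.connMat i a x e d)) (f x)) :
    (P.dirDeriv i a (D b) x - r (P.connMat i a x) (D b x))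
        - (P.dirDeriv i b (D a) x - r (P.connMat i b x) (D a x))
      = ∑ c, P.bracketUp i a b c x • D c x - r (fun c d => P.riem i a b c d x) (f x) := by
  have h1 : ∀ a b, P.dirDeriv i a (D b) x = P.dirDeriv i a (P.dirDeriv i b f) x
      - r (P.dirDeriv i a (P.connMat i b) x) (f x)
      - r (P.connMat i b x) (P.dirDeriv i a f x) := fun a b => by
    rw [dirDeriv_congr (hD b) hx, dirDeriv_sub (hf.dirDeriv b) ((connMat_smooth i b).bilin hf r) hx,
      dirDeriv_bilin (connMat_smooth i b) hf hx]
    abel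
  -- The lower index of the connection coefficients is the row of `connMat`, so the products in
  -- `riem` appear in reversed order and the commutator enters with a minus sign.
  have h3 : (fun c d => P.riem i a b c d x) = P.dirDeriv i a (P.connMat i b) x
      - P.dirDeriv i b (P.connMat i a) x
      - (fun c d => ∑ f, (P.connMat i a x c f * P.connMat i b x f d
        - P.connMat i b x c f * P.connMat i a x f d))
      - ∑ f, P.bracketUp i a b f x • P.connMat i f x := by
    funext c d
    simp only [Pi.sub_apply, Finset.sum_apply, Pi.smul_apply, smul_eq_mul, dirDeriv_connMat hx,
      riem, connMat, Finset.sum_sub_distrib]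
    ring
  rw [h1, h1, h3]
  simp only [map_sub, LinearMap.sub_apply, ← hr]
  simp only [hD _ x hx, map_sub, map_sum, LinearMap.sum_apply, map_smul, LinearMap.smul_apply,
    smul_sub, Finset.sum_sub_distrib, ← dirDeriv_dirDeriv_sub hf hx a b]
  abel

lemma covForm_covForm_sub (hF : P.SmoothOn i F) (hx : x ∈ P.U i) (a b : Fin n) :
    P.covForm i a (P.covForm i b F) x - P.covForm i b (P.covForm i a F) x
      = ∑ c, (P.bracketUp i a b c x : 𝕜) • P.covForm i c F x
        - rotReal 𝕜 (fun c d => P.riem i a b c d x) (F x) := by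
  have hs : ∀ (r : ℝ) (X : Lam 𝕜 n), (r : 𝕜) • X = r • X := fun r X => algebraMap_smul 𝕜 r X
  rw [covForm_eq (hF.covForm b) hx, covForm_eq (hF.covForm a) hx]
  simp only [hs]
  refine ricci_identity (rotReal 𝕜) hF hx (fun a y hy => covForm_eq hF hy a) a b ?_
  simp only [rotReal_apply, rot_rot]
  congr 2
  funext c d
  simp only [realMat, map_sum, RCLike.ofReal_sub, RCLike.ofReal_mul]

end SpinStructure

end FormConnection

/-! ### KY forms as pairs `(F, G)`, and their bracket. -/

section KillingYano

variable {n : ℕ} {𝕜 : Type*} [RCLike 𝕜] {M : Type*} [TopologicalSpace M]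
  [ChartedSpace (EuclideanSpace ℝ (Fin n)) M] [IsManifold (𝓡 n) ∞ M]
  {η : Fin n → ℤˣ} {g : PseudoMetric n M} {ι : Type*} (P : SpinStructure η g ι)

namespace SpinStructure

/-- In the frame `i`, `F` is a `p`-form and `G` a `(p+1)`-form such that `∇_a F = i_a G`; then
`F` is a KY form and `(p+1) G` is its exterior derivative. -/
structure IsKYPair (i : ι) (p : ℕ) (F G : M → Lam 𝕜 n) : Prop where
  smooth : P.SmoothOn i F
  smooth_next : P.SmoothOn i G
  degree : ∀ x ∈ P.U i, F x ∈ ⋀[𝕜]^p (Fin n → 𝕜)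
  degree_next : ∀ x ∈ P.U i, G x ∈ ⋀[𝕜]^(p + 1) (Fin n → 𝕜)
  eqn : ∀ x ∈ P.U i, ∀ a, P.covForm i a F x = contr a (G x)

variable {P} {i : ι} {x : M} {p q : ℕ} {F G F' G' : M → Lam 𝕜 n}

lemma coframeComb_comp_frameEval (hx : x ∈ P.U i) :
    P.coframeComb (𝕜 := 𝕜) i x ∘ₗ P.frameEval i x = LinearMap.id := by
  refine LinearMap.ext fun α => ContinuousLinearMap.ext fun v => ?_
  rw [LinearMap.id_apply, LinearMap.comp_apply]
  conv_rhs => rw [← sum_smul_frame hx v, map_sum]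
  simp only [coframeComb, LinearMap.sum_apply, LinearMap.smulRight_apply, LinearMap.proj_apply]
  rw [sum_apply]
  refine Finset.sum_congr rfl fun a _ => ?_
  change α (P.frame i a x) • sgn 𝕜 η a • ((g.val x (P.frame i a x) v : ℝ) : 𝕜) = _
  rw [map_smul, RCLike.real_smul_eq_coe_mul, g.symm, RCLike.ofReal_mul, ofReal_sgn, smul_eq_mul,
    smul_eq_mul]
  ring

lemma ofFrame_toFrame (hx : x ∈ P.U i) (θ : FormField n M 𝕜) :
    P.ofFrame i x (P.toFrame i θ x) = θ x := by
  rw [toFrame, ofFrame, ← AlgHom.comp_apply, ExteriorAlgebra.map_comp_map,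
    coframeComb_comp_frameEval hx, ExteriorAlgebra.map_id]
  rfl

lemma eq_of_toFrame_eq {θ θ' : FormField n M 𝕜} (h : ∀ x, P.toFrame (P.idx x) θ x
    = P.toFrame (P.idx x) θ' x) : θ = θ' := by
  funext x
  rw [← ofFrame_toFrame (P.mem_idx x) θ, h, ofFrame_toFrame (P.mem_idx x)]

lemma add_one_ne_zero' (p : ℕ) : (p : 𝕜) + 1 ≠ 0 := Nat.cast_add_one_ne_zero p

lemma IsKYPair.extD_eq (h : P.IsKYPair i p F G) (hx : x ∈ P.U i) :
    P.extD i F x = ((p : 𝕜) + 1) • G x := by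
  rw [extD_eq_sum_covForm h.smooth hx]
  simp only [h.eqn x hx, sum_coE_mul_contr (h.degree_next x hx)]
  push_cast
  rfl

/-- The normalized exterior derivative of a KY `p`-form, in the frame `i`. -/
def kyNext (P : SpinStructure η g ι) (i : ι) (p : ℕ) (θ : FormField n M 𝕜) (x : M) : Lam 𝕜 n :=
  (1 / ((p : 𝕜) + 1)) • P.extD i (P.toFrame i θ) x

lemma IsKY.isKYPair {θ : FormField n M 𝕜} (h : P.IsKY p θ) (i : ι) :
    P.IsKYPair i p (P.toFrame i θ) (P.kyNext i p θ) := by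
  have hs := smoothForm_iff.1 h.smooth i
  have hd : ∀ y ∈ P.U i, P.toFrame i θ y ∈ ⋀[𝕜]^p (Fin n → 𝕜) := fun y _ =>
    map_mem_degree _ (h.degree y)
  exact ⟨hs, hs.extD.lam ((1 / ((p : 𝕜) + 1)) • LinearMap.id), hd,
    fun y hy => Submodule.smul_mem _ _ (extD_mem hs hd hy), fun y hy a => by
      rw [h.eqn i y hy a, kyNext, map_smul]⟩

/-- Any `G` is enough, since the equation already forces `dF = (p + 1) G`. -/
lemma isKY_of_isKYPair {θ : FormField n M 𝕜}
    (hd : ∀ x, θ x ∈ ⋀[𝕜]^p (TangentSpace (𝓡 n) x →L[ℝ] 𝕜))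
    (h : ∀ i, ∃ G, P.IsKYPair i p (P.toFrame i θ) G) : P.IsKY p θ := by
  refine ⟨hd, smoothForm_iff.2 fun i => ?_, fun i x hx a => ?_⟩
  · obtain ⟨G, hG⟩ := h i
    exact hG.smooth
  · obtain ⟨G, hG⟩ := h i
    rw [hG.eqn x hx, hG.extD_eq hx, map_smul, smul_smul, one_div,
      inv_mul_cancel₀ (add_one_ne_zero' p), one_smul]

lemma IsKYPair.congr (h : P.IsKYPair i p F G) (e : ∀ y ∈ P.U i, F' y = F y) :
    P.IsKYPair i p F' G :=
  ⟨h.smooth.congr e, h.smooth_next, fun x hx => e x hx ▸ h.degree x hx, h.degree_next,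
    fun x hx a => by rw [covForm_congr h.smooth e hx, h.eqn x hx]⟩

lemma rotReal_riem {k : ℝ} (hk : P.HasConstantCurvature k) (hx : x ∈ P.U i) (a b : Fin n)
    (X : Lam 𝕜 n) : rotReal 𝕜 (fun c d => P.riem i a b c d x) X
      = ((k : 𝕜) * sgn 𝕜 η b) • (coE b * contr a X)
        - ((k : 𝕜) * sgn 𝕜 η a) • (coE a * contr b X) := by
  rw [rotReal_apply, rot_apply]
  have e : ∀ c d, realMat 𝕜 (fun c d => P.riem i a b c d x) c d • (coE c * contr d X)
      = (if b = c then if a = d then ((k : 𝕜) * sgn 𝕜 η c) • (coE c * contr d X) else 0 else 0)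
        - (if a = c then if b = d then ((k : 𝕜) * sgn 𝕜 η c) • (coE c * contr d X) else 0 else 0) :=
    fun c d => by
      rw [realMat, hk i x hx]
      split_ifs <;> simp_all [ofReal_sgn]
  simp only [e, Finset.sum_sub_distrib, Finset.sum_ite_eq, Finset.mem_univ, if_true,
    Finset.sum_ite_irrel, Finset.sum_const_zero]

/-- For a KY pair on a space of constant curvature, `∇_a G = -k e_a ∧ F`. -/
lemma IsKYPair.covForm_next {k : ℝ} (hk : P.HasConstantCurvature k) (h : P.IsKYPair i p F G)
    (hp : 0 < p) (hx : x ∈ P.U i) (a : Fin n) :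
    P.covForm i a G x = -((k : 𝕜) * sgn 𝕜 η a) • (coE a * F x) := by
  -- The Ricci identity for `F` with `∇_b F = i_b G` inserted. The terms contracting with `∇_{e_a}
  -- e_b` cancel against the bracket term by torsion-freeness.
  have h1 : ∀ a b, contr b (P.covForm i a G x) - contr a (P.covForm i b G x)
      = ((k : 𝕜) * sgn 𝕜 η a) • (coE a * contr b (F x))
        - ((k : 𝕜) * sgn 𝕜 η b) • (coE b * contr a (F x)) := fun a b => by
    have e := covForm_covForm_sub h.smooth hx a b
    have e1 : ∀ a b, P.covForm i a (P.covForm i b F) x = contr b (P.covForm i a G x)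
        + ∑ c, (P.connUp i a b c x : 𝕜) • contr c (G x) := fun a b => by
      rw [← covForm_contr h.smooth_next hx]
      exact covForm_congr (h.smooth_next.lam (contr b)) (fun y hy => h.eqn y hy b) hx a
    rw [e1, e1, rotReal_riem hk hx] at e
    simp only [h.eqn x hx, ← connUp_sub, RCLike.ofReal_sub, sub_smul, Finset.sum_sub_distrib] at e
    linear_combination (norm := module) e
  -- By `h1` the contractions of `∇_a G + k e_a ∧ F` are symmetric in the two indices, which forces
  -- these forms to vanish when `p > 0`.
  have h2 := eq_zero_of_contr_symm hp
    (Q := fun a => P.covForm i a G x + ((k : 𝕜) * sgn 𝕜 η a) • (coE a * F x))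
    (fun a => Submodule.add_mem _ (covForm_mem h.smooth_next h.degree_next hx a)
      (Submodule.smul_mem _ _ (coE_mul_mem a (h.degree x hx)))) (fun a b => by
        rw [← sub_eq_zero]
        simp only [map_add, map_smul, contr_coE_mul]
        have e := h1 a b
        rw [sub_eq_iff_eq_add] at e
        rw [e]
        by_cases hab : a = b
        · subst hab; simp
        · simp only [if_neg hab, if_neg (Ne.symm hab)]; module) a
  rw [neg_smul]
  exact eq_neg_of_add_eq_zero_left h2

lemma contrProd_mem {X Y : Lam 𝕜 n} (hX : X ∈ ⋀[𝕜]^(p + 1) (Fin n → 𝕜))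
    (hY : Y ∈ ⋀[𝕜]^(q + 1) (Fin n → 𝕜)) :
    SpinGeom.contrProd η X Y ∈ ⋀[𝕜]^(p + q) (Fin n → 𝕜) :=
  Submodule.sum_mem _ fun a _ => Submodule.smul_mem _ _
    (mul_mem_degree (contr_mem a hX) (contr_mem a hY))

lemma IsKYPair.hat_eq (h : P.IsKYPair i p F G) (hp : Odd p) (hx : x ∈ P.U i) :
    hat (F x) = -F x := hat_of_odd hp (h.degree x hx)

lemma IsKYPair.hat_next_eq (h : P.IsKYPair i p F G) (hp : Odd p) (hx : x ∈ P.U i) :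
    hat (G x) = G x := hat_of_even hp.add_one (h.degree_next x hx)

/-- The bracket of KY pairs is a KY pair. -/
lemma IsKYPair.bracket {k : ℝ} (hk : P.HasConstantCurvature k) (hp : Odd p) (hq : Odd q)
    (h : P.IsKYPair i p F G) (h' : P.IsKYPair i q F' G') :
    P.IsKYPair i (p + q - 1) (fun y => pairBracket η (F y) (G y) (F' y) (G' y))
      (fun y => pairBracketNext η (k : 𝕜) (F y) (G y) (F' y) (G' y)) := by
  obtain ⟨p, rfl⟩ : ∃ r, p = r + 1 := ⟨p - 1, by have := hp.pos; omega⟩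
  obtain ⟨q, rfl⟩ : ∃ r, q = r + 1 := ⟨q - 1, by have := hq.pos; omega⟩
  have hs : P.SmoothOn i (fun y => pairBracket η (F y) (G y) (F' y) (G' y)) :=
    (h.smooth.contrProd h'.smooth_next).sub (h'.smooth.contrProd h.smooth_next)
  refine ⟨hs, ?_, fun x hx => ?_, fun x hx => ?_, fun x hx a => ?_⟩
  · exact ((h.smooth_next.contrProd h'.smooth_next).lam (-LinearMap.id)).sub
      ((h.smooth.lam_mul h'.smooth).lam ((k : 𝕜) • LinearMap.id))
  · rw [show p + 1 + (q + 1) - 1 = p + (q + 1) by omega]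
    refine Submodule.sub_mem _ (contrProd_mem (h.degree x hx) (h'.degree_next x hx)) ?_
    rw [show p + (q + 1) = q + (p + 1) by omega]
    exact contrProd_mem (h'.degree x hx) (h.degree_next x hx)
  · rw [show p + 1 + (q + 1) - 1 + 1 = p + 1 + (q + 1) by omega]
    exact Submodule.sub_mem _ (Submodule.neg_mem _
      (contrProd_mem (h.degree_next x hx) (h'.degree_next x hx)))
      (Submodule.smul_mem _ _ (mul_mem_degree (h.degree x hx) (h'.degree x hx)))
  -- Replacing the algebraic expressions by the covariant derivatives they stand for reduces the KY
  -- equation to the Leibniz rule for `contrProd`.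
  · rw [← contr_pairBracketNext (k : 𝕜) (h.hat_eq hp hx) (h.hat_next_eq hp hx)
      (h'.hat_eq hq hx) (h'.hat_next_eq hq hx) a, ← h.covForm_next hk hp.pos hx,
      ← h'.covForm_next hk hq.pos hx, ← h.eqn x hx, ← h'.eqn x hx]
    have e := covForm_sub' (h.smooth.contrProd h'.smooth_next)
      (h'.smooth.contrProd h.smooth_next) hx a (η := η)
    rw [covForm_contrProd h.smooth h'.smooth_next hx, covForm_contrProd h'.smooth h.smooth_next hx]
      at e
    refine e.trans ?_
    simp only [pairBracket]
    abel

lemma pairBracket_map {T : (Fin n → 𝕜) →ₗ[𝕜] (Fin n → 𝕜)} (hT : IsIsom η T) (F G F' G' : Lam 𝕜 n) :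
    pairBracket η (ExteriorAlgebra.map T F) (ExteriorAlgebra.map T G) (ExteriorAlgebra.map T F')
      (ExteriorAlgebra.map T G') = ExteriorAlgebra.map T (pairBracket η F G F' G') := by
  rw [pairBracket, pairBracket, hT.contrProd_map, hT.contrProd_map, map_sub]

/-- For odd degrees `(-1)^{pq} = -1`, and the KY equation replaces each derivative by a contraction.
The resulting algebraic bracket is natural under isometries, so it can be evaluated in any frame. -/
lemma toFrame_snBracket {θ θ' : FormField n M 𝕜} (hp : Odd p) (hq : Odd q) (h : P.IsKY p θ)
    (h' : P.IsKY q θ') (hx : x ∈ P.U i) :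
    P.toFrame i (P.snBracket p q θ θ') x = pairBracket η (P.toFrame i θ x) (P.kyNext i p θ x)
      (P.toFrame i θ' x) (P.kyNext i q θ' x) := by
  set j := P.idx x with hj
  have hjx : x ∈ P.U j := P.mem_idx x
  have e : P.snBracket p q θ θ' x = P.ofFrame j x (pairBracket η (P.toFrame j θ x)
      (P.kyNext j p θ x) (P.toFrame j θ' x) (P.kyNext j q θ' x)) := by
    rw [snBracket, ← hj, (hp.mul hq).neg_one_pow]
    congr 1
    simp only [((IsKY.isKYPair h j).eqn x hjx), ((IsKY.isKYPair h' j).eqn x hjx), pairBracket,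
      contrProd, neg_smul, one_smul, smul_add, smul_neg, Finset.sum_add_distrib,
      Finset.sum_neg_distrib, sub_eq_add_neg]
  have hT : IsIsom η (P.coTrans 𝕜 i j x) := (isFrameChange hx hjx).isIsom
  rw [toFrame_idx hjx e, ← pairBracket_map hT]
  simp only [kyNext, extD_toFrame h.smooth hx hjx, extD_toFrame h'.smooth hx hjx,
    toFrame_eq hjx i θ, toFrame_eq hjx i θ', map_smul]

/-- The Schouten-Nijenhuis bracket of KY forms of odd degree is a KY form. -/
lemma IsKY.snBracket {k : ℝ} (hk : P.HasConstantCurvature k) {θ θ' : FormField n M 𝕜}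
    (hp : Odd p) (hq : Odd q) (h : P.IsKY p θ) (h' : P.IsKY q θ') :
    P.IsKY (p + q - 1) (P.snBracket p q θ θ') := by
  have hb := fun i => (IsKY.isKYPair h i).bracket hk hp hq (IsKY.isKYPair h' i)
  refine isKY_of_isKYPair (fun x => ?_) fun i => ⟨_, (hb i).congr fun y hy =>
    toFrame_snBracket hp hq h h' hy⟩
  have e := (hb (P.idx x)).degree x (P.mem_idx x)
  rw [← toFrame_snBracket hp hq h h' (P.mem_idx x)] at e
  rw [← ofFrame_toFrame (P.mem_idx x) (P.snBracket p q θ θ')]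
  exact map_mem_degree _ e

lemma kyNext_snBracket {k : ℝ} (hk : P.HasConstantCurvature k) {θ θ' : FormField n M 𝕜}
    (hp : Odd p) (hq : Odd q) (h : P.IsKY p θ) (h' : P.IsKY q θ') (hx : x ∈ P.U i) :
    P.kyNext i (p + q - 1) (P.snBracket p q θ θ') x = pairBracketNext η (k : 𝕜) (P.toFrame i θ x)
      (P.kyNext i p θ x) (P.toFrame i θ' x) (P.kyNext i q θ' x) := by
  have hb := ((IsKY.isKYPair h i).bracket hk hp hq (IsKY.isKYPair h' i)).congr fun y hy =>
    toFrame_snBracket hp hq h h' hy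
  rw [kyNext, hb.extD_eq hx, smul_smul, one_div, inv_mul_cancel₀ (add_one_ne_zero' _), one_smul]

end SpinStructure

end KillingYano

/-! ### The Lie algebra of KY forms of odd degree. -/

section EvenBracket

variable {n : ℕ} {𝕜 : Type*} [RCLike 𝕜] {M : Type*} [TopologicalSpace M]
  [ChartedSpace (EuclideanSpace ℝ (Fin n)) M] [IsManifold (𝓡 n) ∞ M]
  {η : Fin n → ℤˣ} {g : PseudoMetric n M} {ι : Type*} (P : SpinStructure η g ι)

lemma sum_lamProj (X : Lam 𝕜 n) : ∑ r ∈ Finset.range (n + 1), lamProj r X = X := by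
  have : ∑ r ∈ Finset.range (n + 1), lamProj r = (LinearMap.id : Lam 𝕜 n →ₗ[𝕜] Lam 𝕜 n) := by
    refine lam_hom_ext_degree fun q Y hY => ?_
    rw [LinearMap.sum_apply, LinearMap.id_apply]
    simp only [lamProj_of_mem hY, Finset.sum_ite_eq, Finset.mem_range]
    split_ifs with h
    · rfl
    · exact (eq_zero_of_lt_degree (by omega) hY).symm
  rw [← LinearMap.sum_apply, this, LinearMap.id_apply]

/-- The sum over the bidegrees `(p, q)` with `p + q = r + 1`, as a homogeneous component. -/
lemma sum_antidiagonal_eq_lamProj {f : ℕ → ℕ → Lam 𝕜 n} (e r : ℕ)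
    (h0 : ∀ p q, ¬(Odd p ∧ Odd q) → f p q = 0) (hl : ∀ p q, n < p ∨ n < q → f p q = 0)
    (hf : ∀ p q, Odd p → Odd q → f p q ∈ ⋀[𝕜]^(p + q - 1 + e) (Fin n → 𝕜)) :
    ∑ s ∈ Finset.HasAntidiagonal.antidiagonal (r + 1), f s.1 s.2
      = lamProj (r + e) (∑ p ∈ Finset.range (n + 1), ∑ q ∈ Finset.range (n + 1), f p q) := by
  have e1 : ∀ p q, lamProj (r + e) (f p q) = if p + q = r + 1 then f p q else 0 := fun p q => by
    by_cases h : Odd p ∧ Odd q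
    · rw [lamProj_of_mem (hf p q h.1 h.2)]
      have := h.1.pos
      exact if_congr (by omega) rfl rfl
    · rw [h0 p q h, map_zero, ite_self]
  simp only [map_sum, e1]
  rw [← Finset.sum_product', ← Finset.sum_filter]
  symm
  refine Finset.sum_subset (fun s hs => ?_) fun s hs hs' => ?_
  · rw [Finset.mem_filter] at hs
    exact Finset.HasAntidiagonal.mem_antidiagonal.2 hs.2
  · refine hl _ _ ?_
    rw [Finset.mem_filter, Finset.mem_product, Finset.mem_range, Finset.mem_range] at hs'
    by_contra! h
    exact hs' ⟨⟨by omega, by omega⟩, Finset.HasAntidiagonal.mem_antidiagonal.1 hs⟩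

lemma sum_lamProj_succ {X : Lam 𝕜 n} (h : lamProj 0 X = 0) :
    ∑ r ∈ Finset.range (n + 1), lamProj (r + 1) X = X := by
  have h1 : lamProj (n + 1) X = 0 := eq_zero_of_lt_degree (Nat.lt_succ_self n) (lamProj_mem _ X)
  have h2 := Finset.sum_range_succ' (fun r => lamProj r X) (n + 1)
  rw [Finset.sum_range_succ, sum_lamProj, h, h1, add_zero, add_zero] at h2
  exact h2.symm

section PairBracket

lemma contrProd_sum {κ : Type*} (s : Finset κ) (F F' : κ → Lam 𝕜 n) :
    contrProd η (∑ p ∈ s, F p) (∑ q ∈ s, F' q) = ∑ p ∈ s, ∑ q ∈ s, contrProd η (F p) (F' q) := by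
  simp only [contrProd, map_sum, Finset.sum_mul_sum, Finset.smul_sum]
  rw [Finset.sum_comm]
  refine Finset.sum_congr rfl fun p _ => Finset.sum_comm

lemma pairBracket_sum {κ : Type*} (s : Finset κ) (F G F' G' : κ → Lam 𝕜 n) :
    pairBracket η (∑ p ∈ s, F p) (∑ p ∈ s, G p) (∑ p ∈ s, F' p) (∑ p ∈ s, G' p)
      = ∑ p ∈ s, ∑ q ∈ s, pairBracket η (F p) (G p) (F' q) (G' q) := by
  simp only [pairBracket, contrProd_sum, Finset.sum_sub_distrib]
  rw [Finset.sum_comm (f := fun p q => contrProd η (F' p) (G q))]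

lemma pairBracketNext_sum {κ : Type*} (k : 𝕜) (s : Finset κ) (F G F' G' : κ → Lam 𝕜 n) :
    pairBracketNext η k (∑ p ∈ s, F p) (∑ p ∈ s, G p) (∑ p ∈ s, F' p) (∑ p ∈ s, G' p)
      = ∑ p ∈ s, ∑ q ∈ s, pairBracketNext η k (F p) (G p) (F' q) (G' q) := by
  simp only [pairBracketNext, contrProd_sum, Finset.sum_sub_distrib, Finset.sum_neg_distrib,
    Finset.sum_mul_sum, Finset.smul_sum]

lemma contrProd_add_left (X Y Z : Lam 𝕜 n) :
    contrProd η (X + Y) Z = contrProd η X Z + contrProd η Y Z := by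
  simp only [contrProd, map_add, add_mul, smul_add, Finset.sum_add_distrib]

lemma contrProd_add_right (X Y Z : Lam 𝕜 n) :
    contrProd η X (Y + Z) = contrProd η X Y + contrProd η X Z := by
  simp only [contrProd, map_add, mul_add, smul_add, Finset.sum_add_distrib]

lemma contrProd_smul_left (c : 𝕜) (X Y : Lam 𝕜 n) :
    contrProd η (c • X) Y = c • contrProd η X Y := by
  simp only [contrProd, map_smul, smul_mul_assoc, Finset.smul_sum, smul_comm c]

lemma contrProd_smul_right (c : 𝕜) (X Y : Lam 𝕜 n) :
    contrProd η X (c • Y) = c • contrProd η X Y := by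
  simp only [contrProd, map_smul, mul_smul_comm, Finset.smul_sum, smul_comm c]

@[simp] lemma contrProd_zero_left (X : Lam 𝕜 n) : contrProd η 0 X = 0 := by simp [contrProd]

@[simp] lemma contrProd_zero_right (X : Lam 𝕜 n) : contrProd η X 0 = 0 := by simp [contrProd]

lemma pairBracket_skew (F G F' G' : Lam 𝕜 n) :
    pairBracket η F G F' G' = -pairBracket η F' G' F G := by
  simp only [pairBracket]; abel

end PairBracket

namespace SpinStructure

variable {P} {i : ι} {x : M} {a b c : ℕ → FormField n M 𝕜}

lemma toFrame_sum {κ : Type*} (s : Finset κ) (θ : κ → FormField n M 𝕜) (i : ι) (x : M) :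
    P.toFrame i (∑ k ∈ s, θ k) x = ∑ k ∈ s, P.toFrame i (θ k) x := by
  simp only [toFrame, Finset.sum_apply, map_sum]

lemma toFrame_zero (i : ι) : P.toFrame i (0 : FormField n M 𝕜) = fun _ => 0 := by
  funext x; simp [toFrame]

lemma kyNext_zero (i : ι) (p : ℕ) (x : M) : P.kyNext i p (0 : FormField n M 𝕜) x = 0 := by
  simp [kyNext, toFrame_zero, extD, lamDeriv_zero]

lemma kyNext_sum {κ : Type*} (s : Finset κ) {θ : κ → FormField n M 𝕜}
    (h : ∀ k ∈ s, P.SmoothForm (θ k)) (hx : x ∈ P.U i) (p : ℕ) :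
    P.kyNext i p (∑ k ∈ s, θ k) x = ∑ k ∈ s, P.kyNext i p (θ k) x := by
  have e : P.toFrame i (∑ k ∈ s, θ k) = fun y => ∑ k ∈ s, P.toFrame i (θ k) y :=
    funext fun y => toFrame_sum s θ i y
  simp only [kyNext, e]
  rw [extD_sum' (fun k hk => (smoothForm_iff.1 (h k hk) i).mdifferentiableAt hx), Finset.smul_sum]

lemma snBracket_zero_left (p q : ℕ) (θ : FormField n M 𝕜) : P.snBracket p q 0 θ = 0 := by
  funext x
  simp [snBracket, toFrame_zero, covForm, lamDeriv_zero, ofFrame]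

lemma snBracket_zero_right (p q : ℕ) (θ : FormField n M 𝕜) : P.snBracket p q θ 0 = 0 := by
  funext x
  simp [snBracket, toFrame_zero, covForm, lamDeriv_zero, ofFrame]

lemma isKY_of_mem (ha : a ∈ P.evenPart 𝕜) (p : ℕ) : P.IsKY p (a p) := by
  by_cases hp : Odd p
  · exact (ha p).1 hp
  · rw [(ha p).2 hp]; exact P.isKY_zero p

lemma IsKY.eq_zero {p : ℕ} (hp : n < p) {θ : FormField n M 𝕜} (h : P.IsKY p θ) : θ = 0 := by
  refine eq_of_toFrame_eq (P := P) fun x => ?_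
  rw [toFrame_zero]
  exact eq_zero_of_lt_degree hp (map_mem_degree _ (h.degree x))

/-- The sum of the components of an element of the even part, in the frame `i`. -/
def total (P : SpinStructure η g ι) (a : ℕ → FormField n M 𝕜) (i : ι) (x : M) : Lam 𝕜 n :=
  ∑ p ∈ Finset.range (n + 1), P.toFrame i (a p) x

/-- The sum of the normalized exterior derivatives of the components. -/
def totalNext (P : SpinStructure η g ι) (a : ℕ → FormField n M 𝕜) (i : ι) (x : M) : Lam 𝕜 n :=
  ∑ p ∈ Finset.range (n + 1), P.kyNext i p (a p) x

lemma snBracket_isKY {k : ℝ} (hk : P.HasConstantCurvature k) (ha : a ∈ P.evenPart 𝕜)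
    (hb : b ∈ P.evenPart 𝕜) {p q r : ℕ} (h : p + q = r + 1) :
    P.IsKY r (P.snBracket p q (a p) (b q)) := by
  by_cases hp : Odd p
  · by_cases hq : Odd q
    · rw [show r = p + q - 1 by omega]
      exact IsKY.snBracket hk hp hq (isKY_of_mem ha p) (isKY_of_mem hb q)
    · rw [(hb q).2 hq, snBracket_zero_right]; exact P.isKY_zero r
  · rw [(ha p).2 hp, snBracket_zero_left]; exact P.isKY_zero r

lemma evenEven_mem {k : ℝ} (hk : P.HasConstantCurvature k) (ha : a ∈ P.evenPart 𝕜)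
    (hb : b ∈ P.evenPart 𝕜) : P.evenEven a b ∈ P.evenPart 𝕜 := by
  refine fun r => ⟨fun _ => ?_, fun hr => Finset.sum_eq_zero fun s hs => ?_⟩
  · exact Submodule.sum_mem _ fun s hs =>
      snBracket_isKY hk ha hb (Finset.HasAntidiagonal.mem_antidiagonal.1 hs)
  · have h := Finset.HasAntidiagonal.mem_antidiagonal.1 hs
    by_cases hp : Odd s.1
    · have hq : ¬Odd s.2 := fun hq => hr (by
        have h2 := hp.add_odd hq
        rw [h] at h2
        exact (Nat.even_add_one.1 h2 |> Nat.not_even_iff_odd.1))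
      rw [(hb _).2 hq, snBracket_zero_right]
    · rw [(ha _).2 hp, snBracket_zero_left]

lemma toFrame_snBracket_of_mem (ha : a ∈ P.evenPart 𝕜) (hb : b ∈ P.evenPart 𝕜) (hx : x ∈ P.U i)
    (p q : ℕ) : P.toFrame i (P.snBracket p q (a p) (b q)) x = pairBracket η (P.toFrame i (a p) x)
      (P.kyNext i p (a p) x) (P.toFrame i (b q) x) (P.kyNext i q (b q) x) := by
  by_cases hp : Odd p
  · by_cases hq : Odd q
    · exact toFrame_snBracket hp hq (isKY_of_mem ha p) (isKY_of_mem hb q) hx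
    · simp [(hb q).2 hq, snBracket_zero_right, kyNext_zero, toFrame_zero, pairBracket]
  · simp [(ha p).2 hp, snBracket_zero_left, kyNext_zero, toFrame_zero, pairBracket]

/-- All bidegrees are absorbed in one bracket of inhomogeneous pairs. The Lie algebra axioms then
follow from identities for `pairBracket` applied once to the totals. -/
lemma toFrame_evenEven {k : ℝ} (hk : P.HasConstantCurvature k) (ha : a ∈ P.evenPart 𝕜)
    (hb : b ∈ P.evenPart 𝕜) (hx : x ∈ P.U i) (r : ℕ) :
    P.toFrame i (P.evenEven a b r) x = lamProj r
      (pairBracket η (P.total a i x) (P.totalNext a i x) (P.total b i x) (P.totalNext b i x)) := by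
  rw [total, totalNext, total, totalNext, pairBracket_sum, evenEven, toFrame_sum]
  simp only [toFrame_snBracket_of_mem ha hb hx]
  refine sum_antidiagonal_eq_lamProj 0 r (f := fun p q => pairBracket η (P.toFrame i (a p) x)
      (P.kyNext i p (a p) x) (P.toFrame i (b q) x) (P.kyNext i q (b q) x)) (fun p q h => ?_)
      (fun p q h => ?_) fun p q hp hq => ?_
  · rcases not_and_or.1 h with h | h
    · simp [(ha p).2 h, kyNext_zero, toFrame_zero, pairBracket]
    · simp [(hb q).2 h, kyNext_zero, toFrame_zero, pairBracket]
  · rcases h with h | h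
    · simp [IsKY.eq_zero h (isKY_of_mem ha p), kyNext_zero, toFrame_zero, pairBracket]
    · simp [IsKY.eq_zero h (isKY_of_mem hb q), kyNext_zero, toFrame_zero, pairBracket]
  · exact ((IsKY.isKYPair (isKY_of_mem ha p) i).bracket hk hp hq
      (IsKY.isKYPair (isKY_of_mem hb q) i)).degree x hx

lemma kyNext_snBracket_of_mem {k : ℝ} (hk : P.HasConstantCurvature k) (ha : a ∈ P.evenPart 𝕜)
    (hb : b ∈ P.evenPart 𝕜) (hx : x ∈ P.U i) {p q r : ℕ} (h : p + q = r + 1) :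
    P.kyNext i r (P.snBracket p q (a p) (b q)) x = pairBracketNext η (k : 𝕜)
      (P.toFrame i (a p) x) (P.kyNext i p (a p) x) (P.toFrame i (b q) x)
      (P.kyNext i q (b q) x) := by
  by_cases hp : Odd p
  · by_cases hq : Odd q
    · rw [show r = p + q - 1 by omega]
      exact kyNext_snBracket hk hp hq (isKY_of_mem ha p) (isKY_of_mem hb q) hx
    · simp [(hb q).2 hq, snBracket_zero_right, kyNext_zero, toFrame_zero, pairBracketNext]
  · simp [(ha p).2 hp, snBracket_zero_left, kyNext_zero, toFrame_zero, pairBracketNext]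

lemma kyNext_evenEven {k : ℝ} (hk : P.HasConstantCurvature k) (ha : a ∈ P.evenPart 𝕜)
    (hb : b ∈ P.evenPart 𝕜) (hx : x ∈ P.U i) (r : ℕ) :
    P.kyNext i r (P.evenEven a b r) x = lamProj (r + 1) (pairBracketNext η (k : 𝕜)
      (P.total a i x) (P.totalNext a i x) (P.total b i x) (P.totalNext b i x)) := by
  rw [total, totalNext, total, totalNext, pairBracketNext_sum, evenEven,
    kyNext_sum _ (fun s hs => (snBracket_isKY hk ha hb
      (Finset.HasAntidiagonal.mem_antidiagonal.1 hs)).smooth) hx,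
    Finset.sum_congr rfl fun s hs => kyNext_snBracket_of_mem hk ha hb hx
      (Finset.HasAntidiagonal.mem_antidiagonal.1 hs)]
  -- The shift is `1` because the second component of a pair lies one degree above the first.
  refine sum_antidiagonal_eq_lamProj 1 r (f := fun p q => pairBracketNext η (k : 𝕜)
      (P.toFrame i (a p) x) (P.kyNext i p (a p) x) (P.toFrame i (b q) x)
      (P.kyNext i q (b q) x)) (fun p q h => ?_) (fun p q h => ?_) fun p q hp hq => ?_
  · rcases not_and_or.1 h with h | h
    · simp [(ha p).2 h, kyNext_zero, toFrame_zero, pairBracketNext]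
    · simp [(hb q).2 h, kyNext_zero, toFrame_zero, pairBracketNext]
  · rcases h with h | h
    · simp [IsKY.eq_zero h (isKY_of_mem ha p), kyNext_zero, toFrame_zero, pairBracketNext]
    · simp [IsKY.eq_zero h (isKY_of_mem hb q), kyNext_zero, toFrame_zero, pairBracketNext]
  · exact ((IsKY.isKYPair (isKY_of_mem ha p) i).bracket hk hp hq
      (IsKY.isKYPair (isKY_of_mem hb q) i)).degree_next x hx

lemma total_evenEven {k : ℝ} (hk : P.HasConstantCurvature k) (ha : a ∈ P.evenPart 𝕜)
    (hb : b ∈ P.evenPart 𝕜) (hx : x ∈ P.U i) : P.total (P.evenEven a b) i x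
      = pairBracket η (P.total a i x) (P.totalNext a i x) (P.total b i x) (P.totalNext b i x) := by
  conv_lhs => rw [total]
  simp only [toFrame_evenEven hk ha hb hx, sum_lamProj]

lemma hat_total (ha : a ∈ P.evenPart 𝕜) (i : ι) (x : M) : hat (P.total a i x) = -P.total a i x := by
  rw [total, map_sum, ← Finset.sum_neg_distrib]
  refine Finset.sum_congr rfl fun p _ => ?_
  by_cases hp : Odd p
  · exact hat_of_odd hp (map_mem_degree _ ((isKY_of_mem ha p).degree x))
  · simp [(ha p).2 hp, toFrame_zero]

lemma totalNext_term_mem (ha : a ∈ P.evenPart 𝕜) (hx : x ∈ P.U i) (p : ℕ) :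
    P.kyNext i p (a p) x ∈ ⋀[𝕜]^(p + 1) (Fin n → 𝕜) :=
  (IsKY.isKYPair (isKY_of_mem ha p) i).degree_next x hx

lemma hat_totalNext (ha : a ∈ P.evenPart 𝕜) (hx : x ∈ P.U i) :
    hat (P.totalNext a i x) = P.totalNext a i x := by
  rw [totalNext, map_sum]
  refine Finset.sum_congr rfl fun p _ => ?_
  by_cases hp : Odd p
  · exact hat_of_even hp.add_one (totalNext_term_mem ha hx p)
  · simp [(ha p).2 hp, kyNext_zero]

lemma totalNext_evenEven {k : ℝ} (hk : P.HasConstantCurvature k) (ha : a ∈ P.evenPart 𝕜)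
    (hb : b ∈ P.evenPart 𝕜) (hx : x ∈ P.U i) :
    P.totalNext (P.evenEven a b) i x = pairBracketNext η (k : 𝕜)
      (P.total a i x) (P.totalNext a i x) (P.total b i x) (P.totalNext b i x) := by
  conv_lhs => rw [totalNext]
  simp only [kyNext_evenEven hk ha hb hx]
  -- The summands are the components of degrees `1` to `n + 1`. The last vanishes for dimensional
  -- reasons, so only the absence of a scalar part has to be checked.
  refine sum_lamProj_succ ?_
  rw [total, totalNext, total, totalNext, pairBracketNext_sum, map_sum]
  refine Finset.sum_eq_zero fun p _ => ?_
  rw [map_sum]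
  refine Finset.sum_eq_zero fun q _ => ?_
  by_cases h : Odd p ∧ Odd q
  · rw [lamProj_of_mem (((IsKY.isKYPair (isKY_of_mem ha p) i).bracket hk h.1 h.2
      (IsKY.isKYPair (isKY_of_mem hb q) i)).degree_next x hx), if_neg (Nat.succ_ne_zero _)]
  · rcases not_and_or.1 h with h | h
    · simp [(ha p).2 h, kyNext_zero, toFrame_zero, pairBracketNext]
    · simp [(hb q).2 h, kyNext_zero, toFrame_zero, pairBracketNext]

lemma total_add (a b : ℕ → FormField n M 𝕜) (i : ι) (x : M) :
    P.total (a + b) i x = P.total a i x + P.total b i x := by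
  simp only [total, Pi.add_apply, toFrame_add, Finset.sum_add_distrib]

lemma total_smul (c : 𝕜) (a : ℕ → FormField n M 𝕜) (i : ι) (x : M) :
    P.total (c • a) i x = c • P.total a i x := by
  simp only [total, Pi.smul_apply, toFrame_smul, Finset.smul_sum]

lemma totalNext_add (ha : a ∈ P.evenPart 𝕜) (hb : b ∈ P.evenPart 𝕜) (hx : x ∈ P.U i) :
    P.totalNext (a + b) i x = P.totalNext a i x + P.totalNext b i x := by
  rw [totalNext, totalNext, totalNext, ← Finset.sum_add_distrib]
  refine Finset.sum_congr rfl fun p _ => ?_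
  rw [Pi.add_apply, kyNext, P.extD_add (isKY_of_mem ha p).smooth (isKY_of_mem hb p).smooth i hx,
    smul_add]
  rfl

lemma totalNext_smul (c : 𝕜) (ha : a ∈ P.evenPart 𝕜) (hx : x ∈ P.U i) :
    P.totalNext (c • a) i x = c • P.totalNext a i x := by
  rw [totalNext, totalNext, Finset.smul_sum]
  refine Finset.sum_congr rfl fun p _ => ?_
  rw [Pi.smul_apply, kyNext, P.extD_smul (isKY_of_mem ha p).smooth c i hx, smul_comm]
  rfl

lemma evenPart_ext {a b : ℕ → FormField n M 𝕜} (h : ∀ r x, P.toFrame (P.idx x) (a r) x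
    = P.toFrame (P.idx x) (b r) x) : a = b :=
  funext fun r => eq_of_toFrame_eq (P := P) (h r)

/-- The KY forms of odd degree on a space of constant curvature form a Lie algebra. -/
theorem isLieAlgebraOn_evenPart {k : ℝ} (hk : P.HasConstantCurvature k) :
    IsLieAlgebraOn 𝕜 (P.evenPart 𝕜) P.evenEven := by
  have hx := fun x => P.mem_idx x
  have skew : ∀ a ∈ P.evenPart 𝕜, ∀ b ∈ P.evenPart 𝕜, P.evenEven a b = -P.evenEven b a :=
    fun a ha b hb => by
      have e : -P.evenEven b a = (-1 : 𝕜) • P.evenEven b a := (neg_one_smul _ _).symm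
      rw [e]
      refine evenPart_ext (P := P) fun r x => ?_
      rw [Pi.smul_apply, toFrame_smul, Pi.smul_apply, toFrame_evenEven hk ha hb (hx x),
        toFrame_evenEven hk hb ha (hx x), pairBracket_skew, map_neg, neg_one_smul]
  have add_right : ∀ a ∈ P.evenPart 𝕜, ∀ b ∈ P.evenPart 𝕜, ∀ c ∈ P.evenPart 𝕜,
      P.evenEven a (b + c) = P.evenEven a b + P.evenEven a c := fun a ha b hb c hc => by
    refine evenPart_ext (P := P) fun r x => ?_
    rw [Pi.add_apply, toFrame_add, Pi.add_apply, toFrame_evenEven hk ha hb (hx x),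
      toFrame_evenEven hk ha hc (hx x), toFrame_evenEven hk ha (Submodule.add_mem _ hb hc) (hx x),
      total_add, totalNext_add hb hc (hx x), ← map_add]
    congr 1
    simp only [pairBracket, contrProd_add_left, contrProd_add_right]
    abel
  have smul_right : ∀ (r : 𝕜), ∀ a ∈ P.evenPart 𝕜, ∀ b ∈ P.evenPart 𝕜,
      P.evenEven a (r • b) = r • P.evenEven a b := fun c a ha b hb => by
    refine evenPart_ext (P := P) fun r x => ?_
    rw [Pi.smul_apply, toFrame_smul, Pi.smul_apply, toFrame_evenEven hk ha hb (hx x),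
      toFrame_evenEven hk ha (Submodule.smul_mem _ c hb) (hx x),
      total_smul, totalNext_smul c hb (hx x), ← map_smul]
    congr 1
    simp only [pairBracket, contrProd_smul_left, contrProd_smul_right, smul_sub]
  refine ⟨fun a ha b hb => evenEven_mem hk ha hb, fun a ha b hb c hc => ?_, add_right,
    fun r a ha b hb => ?_, smul_right, fun a ha => ?_, skew, fun a ha b hb c hc => ?_⟩
  · rw [skew _ (Submodule.add_mem _ ha hb) c hc, add_right c hc a ha b hb, skew c hc a ha,
      skew c hc b hb, neg_add, neg_neg, neg_neg]
  · rw [skew _ (Submodule.smul_mem _ r ha) b hb, smul_right r b hb a ha, skew b hb a ha, smul_neg,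
      neg_neg]
  · refine evenPart_ext (P := P) fun r x => ?_
    rw [toFrame_evenEven hk ha ha (hx x), pairBracket, sub_self, map_zero, Pi.zero_apply,
      toFrame_zero]
  · have hab := evenEven_mem hk ha hb
    have hbc := evenEven_mem hk hb hc
    have hca := evenEven_mem hk hc ha
    refine evenPart_ext (P := P) fun r x => ?_
    rw [Pi.add_apply, Pi.add_apply, toFrame_add, toFrame_add, Pi.add_apply, Pi.add_apply,
      toFrame_evenEven hk ha hbc (hx x), toFrame_evenEven hk hb hca (hx x),
      toFrame_evenEven hk hc hab (hx x), total_evenEven hk hb hc (hx x),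
      total_evenEven hk hc ha (hx x), total_evenEven hk ha hb (hx x),
      totalNext_evenEven hk hb hc (hx x), totalNext_evenEven hk hc ha (hx x),
      totalNext_evenEven hk ha hb (hx x), ← map_add, ← map_add,
      pairBracket_jacobi η (k : 𝕜) (hat_total ha _ x) (hat_totalNext ha (hx x)) (hat_total hb _ x)
        (hat_totalNext hb (hx x)) (hat_total hc _ x) (hat_totalNext hc (hx x)), map_zero,
      Pi.zero_apply, toFrame_zero]

end SpinStructure

end EvenBracket

/-! ### Killing spinors: integrability and symmetry operators. -/

section Spinors

variable {n : ℕ} {𝕜 : Type*} [RCLike 𝕜] {M : Type*} [TopologicalSpace M]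
  [ChartedSpace (EuclideanSpace ℝ (Fin n)) M] [IsManifold (𝓡 n) ∞ M]
  {η : Fin n → ℤˣ} {g : PseudoMetric n M} {ι : Type*} (P : SpinStructure η g ι)
  {S : Type*} [NormedAddCommGroup S] [NormedSpace ℝ S] [NormedSpace 𝕜 S] [IsScalarTower ℝ 𝕜 S]
  [FiniteDimensional ℝ S]
  (ρ : CliffordAlgebra (quadForm ℝ η) →ₐ[ℝ] Module.End 𝕜 S)

lemma ofReal_smul_eq (r : ℝ) (ψ : S) : (r : 𝕜) • ψ = r • ψ := algebraMap_smul 𝕜 r ψ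

/-- The action of an infinitesimal rotation on spinors. -/
def spinRotReal : (Fin n → Fin n → ℝ) →ₗ[ℝ] S →ₗ[ℝ] S :=
  LinearMap.mk₂ ℝ (fun m ψ => spinRot ρ (realMat 𝕜 m) ψ)
    (fun m m' ψ => by
      simp only [spinRot, realMat, Pi.add_apply, RCLike.ofReal_add, add_smul,
        Finset.sum_add_distrib, smul_add, LinearMap.add_apply])
    (fun r m ψ => by
      simp only [spinRot, realMat, Pi.smul_apply, smul_eq_mul, RCLike.ofReal_mul, mul_smul,
        ← Finset.smul_sum, smul_comm _ (r : 𝕜), LinearMap.smul_apply]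
      exact ofReal_smul_eq r _)
    (fun m ψ φ => map_add _ _ _)
    (fun r m ψ => ((spinRot ρ (realMat 𝕜 m)).restrictScalars ℝ).map_smul r ψ)

lemma spinRotReal_apply (m : Fin n → Fin n → ℝ) (ψ : S) :
    spinRotReal ρ m ψ = spinRot ρ (realMat 𝕜 m) ψ := rfl

/-- The Clifford action of forms, as a real bilinear map. -/
def cliffReal : Lam 𝕜 n →ₗ[ℝ] S →ₗ[ℝ] S :=
  LinearMap.mk₂ ℝ (fun X ψ => cliff ρ X ψ) (fun X Y ψ => by rw [map_add, LinearMap.add_apply])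
    (fun r X ψ => by
      rw [← algebraMap_smul 𝕜 r X, map_smul, LinearMap.smul_apply]
      exact ofReal_smul_eq r _)
    (fun X ψ φ => map_add _ _ _) (fun r X ψ => ((cliff ρ X).restrictScalars ℝ).map_smul r ψ)

namespace SpinStructure

/-- A Killing spinor in the trivialization `i`. -/
structure IsKillingIn (i : ι) (lam : 𝕜) (ψ : M → S) : Prop where
  smooth : P.SmoothOn i ψ
  eqn : ∀ x ∈ P.U i, ∀ a, P.covSpinor ρ i a ψ x = lam • gam ρ a (ψ x)

variable {P ρ} {i : ι} {x : M} {ψ φ : M → S} {lam : 𝕜}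

/-- This brings the spin connection to the form `∂ - r(Γ)`, as required by `ricci_identity`. -/
lemma covSpinor_eq (i : ι) (a : Fin n) (ψ : M → S) (x : M) :
    P.covSpinor ρ i a ψ x = P.dirDeriv i a ψ x - spinRotReal ρ (P.connMat i a x) (ψ x) := by
  rw [covSpinor, spinRotReal_apply, spinRot]
  simp only [LinearMap.smul_apply, LinearMap.sum_apply, Module.End.mul_apply, realMat, connMat,
    connUp, RCLike.ofReal_mul, ofReal_sgn]
  congr 2
  refine Finset.sum_congr rfl fun b _ => Finset.sum_congr rfl fun c _ => ?_
  rw [gamUp, gamUp, LinearMap.smul_apply, LinearMap.smul_apply, LinearMap.smul_apply, map_smul,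
    mul_comm, mul_smul, smul_comm (sgn 𝕜 η c) (sgn 𝕜 η b)]

lemma covSpinor_congr {ψ' : M → S} (e : ∀ y ∈ P.U i, ψ' y = ψ y) (hx : x ∈ P.U i) (a : Fin n) :
    P.covSpinor ρ i a ψ' x = P.covSpinor ρ i a ψ x := by
  rw [covSpinor_eq, covSpinor_eq, e x hx, dirDeriv_congr e hx]

lemma IsKillingIn.congr (h : P.IsKillingIn ρ i lam ψ) {ψ' : M → S}
    (e : ∀ y ∈ P.U i, ψ' y = ψ y) : P.IsKillingIn ρ i lam ψ' :=
  ⟨h.smooth.congr e, fun x hx a => by rw [covSpinor_congr e hx, h.eqn x hx, e x hx]⟩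

lemma isKillingSpinor_iff {ψ : M → S} :
    P.IsKillingSpinor ρ lam ψ ↔ ∀ i, P.IsKillingIn ρ i lam (P.spinorIn ρ i ψ) :=
  ⟨fun h i => ⟨h.smooth i, h.eqn i⟩, fun h => ⟨fun i => (h i).smooth, fun i => (h i).eqn⟩⟩

lemma SmoothOn.spinor (hψ : P.SmoothOn i ψ) (L : Module.End 𝕜 S) :
    P.SmoothOn i (fun y => L (ψ y)) := hψ.linear (L.restrictScalars ℝ)

lemma covSpinor_add' (hψ : P.SmoothOn i ψ) (hφ : P.SmoothOn i φ) (hx : x ∈ P.U i) (a : Fin n) :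
    P.covSpinor ρ i a (fun y => ψ y + φ y) x = P.covSpinor ρ i a ψ x + P.covSpinor ρ i a φ x := by
  have e : P.dirDeriv i a (fun y => ψ y + φ y) x = P.dirDeriv i a ψ x + P.dirDeriv i a φ x :=
    P.dirDeriv_add i a hx hψ hφ
  rw [covSpinor_eq, covSpinor_eq, covSpinor_eq, e, map_add]
  abel

lemma covSpinor_smul' (hψ : P.SmoothOn i ψ) (c : 𝕜) (hx : x ∈ P.U i) (a : Fin n) :
    P.covSpinor ρ i a (fun y => c • ψ y) x = c • P.covSpinor ρ i a ψ x := by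
  have e : P.dirDeriv i a (fun y => c • ψ y) x = c • P.dirDeriv i a ψ x :=
    P.dirDeriv_smul i a c hx hψ
  rw [covSpinor_eq, covSpinor_eq, e, spinRotReal_apply, spinRotReal_apply, map_smul, smul_sub]

/-- The spinor covariant derivative is compatible with the Clifford action of forms. -/
lemma covSpinor_cliff {F : M → Lam 𝕜 n} (hF : P.SmoothOn i F) (hψ : P.SmoothOn i ψ)
    (hx : x ∈ P.U i) (a : Fin n) : P.covSpinor ρ i a (fun y => cliff ρ (F y) (ψ y)) x
      = cliff ρ (P.covForm i a F x) (ψ x) + cliff ρ (F x) (P.covSpinor ρ i a ψ x) := by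
  have e : P.dirDeriv i a (fun y => cliff ρ (F y) (ψ y)) x
      = cliff ρ (P.dirDeriv i a F x) (ψ x) + cliff ρ (F x) (P.dirDeriv i a ψ x) :=
    dirDeriv_bilin hF hψ hx a (cliffReal ρ)
  have h := LinearMap.congr_fun ((isSkew_connMat (P := P) (𝕜 := 𝕜) i a x).spinRot_cliff ρ (F x)) (ψ x)
  simp only [LinearMap.sub_apply, Module.End.mul_apply] at h
  rw [covSpinor_eq, covSpinor_eq, covForm_eq hF hx, e, map_sub, map_sub, LinearMap.sub_apply,
    spinRotReal_apply, spinRotReal_apply, rotReal_apply, ← h]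
  abel

lemma covSpinor_gam (hψ : P.SmoothOn i ψ) (a b : Fin n) (hx : x ∈ P.U i) :
    P.covSpinor ρ i a (fun y => gam ρ b (ψ y)) x = gam ρ b (P.covSpinor ρ i a ψ x)
      + ∑ c, (P.connUp i a b c x : 𝕜) • gam ρ c (ψ x) := by
  have e : P.dirDeriv i a (fun y => gam ρ b (ψ y)) x = gam ρ b (P.dirDeriv i a ψ x) :=
    dirDeriv_linear hψ hx a ((gam ρ b).restrictScalars ℝ)
  have h := LinearMap.congr_fun ((isSkew_connMat (P := P) (𝕜 := 𝕜) i a x).spinRot_gam ρ b) (ψ x)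
  simp only [LinearMap.sub_apply, Module.End.mul_apply, LinearMap.neg_apply, LinearMap.sum_apply,
    LinearMap.smul_apply, realMat, connMat] at h
  rw [covSpinor_eq, covSpinor_eq, e, map_sub, spinRotReal_apply, spinRotReal_apply,
    ← neg_neg (∑ c, _), ← h]
  abel

lemma gam_gam_self (a : Fin n) (χ : S) : gam ρ a (gam ρ a χ) = sgn 𝕜 η a • χ := by
  have h := LinearMap.congr_fun (gam_anticomm ρ a a) χ
  rw [if_pos rfl, ← two_smul 𝕜, mul_smul] at h
  exact smul_right_injective S (two_ne_zero : (2 : 𝕜) ≠ 0) h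

/-- The integrability condition of the Killing spinor equation. -/
lemma IsKillingIn.smul_eq_zero {k : ℝ} (hk : P.HasConstantCurvature k)
    (h : P.IsKillingIn ρ i lam ψ) (hx : x ∈ P.U i) {a b : Fin n} (hab : a ≠ b) :
    ((k : 𝕜) + 4 * lam ^ 2) • ψ x = 0 := by
  have hR : spinRotReal ρ (fun c d => P.riem i a b c d x) (ψ x)
      = ((k : 𝕜) / 4) • (gam ρ b (gam ρ a (ψ x)) - gam ρ a (gam ρ b (ψ x))) := by
    rw [spinRotReal_apply, spinRot]
    simp only [LinearMap.smul_apply, LinearMap.sum_apply, Module.End.mul_apply]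
    have e : ∀ c d, realMat 𝕜 (fun c d => P.riem i a b c d x) c d • gamUp ρ c (gam ρ d (ψ x))
        = (if b = c then if a = d then (k : 𝕜) • gam ρ c (gam ρ d (ψ x)) else 0 else 0)
          - (if a = c then if b = d then (k : 𝕜) • gam ρ c (gam ρ d (ψ x)) else 0 else 0) :=
      fun c d => by
        rw [realMat, hk i x hx, gam_eq ρ c, LinearMap.smul_apply]
        split_ifs <;> simp_all [ofReal_sgn, mul_smul]
    simp only [e, Finset.sum_sub_distrib, Finset.sum_ite_eq, Finset.mem_univ, if_true,
      Finset.sum_ite_irrel, Finset.sum_const_zero]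
    module
  have key := ricci_identity (spinRotReal ρ) h.smooth hx
    (fun a y _ => covSpinor_eq (ρ := ρ) i a ψ y) a b (by
      simp only [spinRotReal_apply]
      have := LinearMap.congr_fun ((isSkew_connMat (P := P) (𝕜 := 𝕜) i a x).spinRot_spinRot ρ
        (realMat 𝕜 (P.connMat i b x))) (ψ x)
      simp only [LinearMap.sub_apply, Module.End.mul_apply] at this
      rw [this]
      congr 2
      funext c d
      simp only [realMat, map_sum, RCLike.ofReal_sub, RCLike.ofReal_mul])
  -- Here `∇_b ψ = λ e_b.ψ` is differentiated once more. As in the case of forms, the term from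
  -- `∇_{e_a} e_b` is matched by the bracket term of the Ricci identity.
  have e1 : ∀ a b, P.dirDeriv i a (P.covSpinor ρ i b ψ) x
      - spinRotReal ρ (P.connMat i a x) (P.covSpinor ρ i b ψ x)
      = (lam * lam) • gam ρ b (gam ρ a (ψ x))
        + lam • ∑ c, (P.connUp i a b c x : 𝕜) • gam ρ c (ψ x) := fun a b => by
    rw [← covSpinor_eq, covSpinor_congr (fun y hy => h.eqn y hy b) hx,
      covSpinor_smul' (h.smooth.spinor (gam ρ b)) lam hx, covSpinor_gam h.smooth a b hx,
      h.eqn x hx, map_smul, smul_add, smul_smul]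
  rw [e1, e1, hR] at key
  simp only [h.eqn x hx, ← ofReal_smul_eq (𝕜 := 𝕜), ← connUp_sub, RCLike.ofReal_sub, sub_smul,
    Finset.sum_sub_distrib, smul_comm _ lam, ← Finset.smul_sum] at key
  have h2 := LinearMap.congr_fun (gam_anticomm ρ a b) (ψ x)
  rw [if_neg hab, LinearMap.add_apply, Module.End.mul_apply, Module.End.mul_apply,
    LinearMap.zero_apply] at h2
  have h3 : gam ρ a (gam ρ b (ψ x)) = -gam ρ b (gam ρ a (ψ x)) := eq_neg_of_add_eq_zero_left h2
  rw [h3] at key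
  -- For `a ≠ b` both commutators equal `2 e_b.e_a.ψ`, so the Ricci identity reads `2λ² e_b.e_a.ψ =
  -- -(k/2) e_b.e_a.ψ`; this is doubled.
  have h4 : ((k : 𝕜) + 4 * lam ^ 2) • gam ρ b (gam ρ a (ψ x)) = 0 := by
    refine Eq.trans ?_ ((congrArg (fun χ : S => (2 : 𝕜) • χ) (sub_eq_zero.2 key)).trans
      (smul_zero _))
    module
  -- Clifford multiplication by a frame vector squares to `±1`, so `e_b.e_a` can be inverted.
  have h5 := congrArg (fun χ : S => (sgn 𝕜 η a * sgn 𝕜 η b) • gam ρ a (gam ρ b χ)) h4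
  simp only [map_smul (gam ρ _), gam_gam_self, map_zero, smul_zero] at h5
  rw [← h5]
  simp only [smul_smul]
  congr 1
  linear_combination (-((k : 𝕜) + 4 * lam ^ 2)) * sgn_mul_self 𝕜 η a * sgn 𝕜 η b * sgn 𝕜 η b
    - ((k : 𝕜) + 4 * lam ^ 2) * sgn_mul_self 𝕜 η b

/-- The symmetry operator of a KY form of odd degree, in a trivialization. -/
lemma IsKillingIn.symmetry {k : ℝ} (hk : P.HasConstantCurvature k) {p : ℕ} (hp : Odd p)
    {F G : M → Lam 𝕜 n} (h : P.IsKYPair i p F G) (hψ : P.IsKillingIn ρ i lam ψ) :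
    P.IsKillingIn ρ i lam (fun y => (lam * p) • cliff ρ (F y) (ψ y)
      + ((p : 𝕜) / 2) • cliff ρ (G y) (ψ y)) := by
  have hF : P.SmoothOn i (fun y => cliff ρ (F y) (ψ y)) := h.smooth.bilin hψ.smooth (cliffReal ρ)
  have hG : P.SmoothOn i (fun y => cliff ρ (G y) (ψ y)) :=
    h.smooth_next.bilin hψ.smooth (cliffReal ρ)
  have hF' := hF.spinor ((lam * p) • (1 : Module.End 𝕜 S))
  have hG' := hG.spinor (((p : 𝕜) / 2) • (1 : Module.End 𝕜 S))
  refine ⟨hF'.add hG', fun x hx b => ?_⟩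
  -- The integrability condition needs two distinct frame indices. If `n ≤ 1` the form `e_b ∧ F` has
  -- degree at least 2 and vanishes by itself.
  have e : ((k : 𝕜) + 4 * lam ^ 2) • cliff ρ (coE b * F x) (ψ x) = 0 := by
    by_cases hn : ∃ a, a ≠ b
    · obtain ⟨a, ha⟩ := hn
      rw [← map_smul, hψ.smul_eq_zero hk hx ha, map_zero]
    · have : n ≤ 1 := by
        by_contra! h1
        have : Nontrivial (Fin n) := Fin.nontrivial_iff_two_le.2 h1
        exact hn (exists_ne b)
      rw [eq_zero_of_lt_degree (by have := hp.pos; omega) (coE_mul_mem b (h.degree x hx)), map_zero,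
        LinearMap.zero_apply, smul_zero]
  have eF : cliff ρ (F x) (gam ρ b (ψ x)) = cliff ρ (contr b (F x)) (ψ x)
      - sgn 𝕜 η b • cliff ρ (coE b * F x) (ψ x) := by
    have := LinearMap.congr_fun (cliff_mul_gam ρ b (F x)) (ψ x)
    rw [Module.End.mul_apply] at this
    rw [this, h.hat_eq hp hx, mul_neg, smul_neg, map_neg, map_sub, map_neg, map_neg, map_smul]
    simp only [LinearMap.sub_apply, LinearMap.neg_apply, LinearMap.smul_apply]
    abel
  have eG : cliff ρ (G x) (gam ρ b (ψ x)) = sgn 𝕜 η b • cliff ρ (coE b * G x) (ψ x)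
      - cliff ρ (contr b (G x)) (ψ x) := by
    have := LinearMap.congr_fun (cliff_mul_gam ρ b (G x)) (ψ x)
    rw [Module.End.mul_apply] at this
    rw [this, h.hat_next_eq hp hx, map_sub, map_smul]
    simp only [LinearMap.sub_apply, LinearMap.smul_apply]
  have eX : ∀ X : Lam 𝕜 n, gam ρ b (cliff ρ X (ψ x)) = sgn 𝕜 η b • cliff ρ (coE b * X) (ψ x)
      + cliff ρ (contr b X) (ψ x) := fun X => by
    have := LinearMap.congr_fun (gam_mul_cliff ρ b X) (ψ x)
    rw [Module.End.mul_apply] at this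
    rw [this, map_add, map_smul]
    simp only [LinearMap.add_apply, LinearMap.smul_apply]
  have e1 : P.covSpinor ρ i b (fun y => (lam * p) • cliff ρ (F y) (ψ y)
      + ((p : 𝕜) / 2) • cliff ρ (G y) (ψ y)) x
      = (lam * p) • (cliff ρ (contr b (G x)) (ψ x) + lam • cliff ρ (F x) (gam ρ b (ψ x)))
        + ((p : 𝕜) / 2) • ((-((k : 𝕜) * sgn 𝕜 η b)) • cliff ρ (coE b * F x) (ψ x)
          + lam • cliff ρ (G x) (gam ρ b (ψ x))) := by
    have := covSpinor_add' (ρ := ρ) hF' hG' hx b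
    refine this.trans ?_
    have e2 := covSpinor_smul' (ρ := ρ) hF (lam * p) hx b
    have e3 := covSpinor_smul' (ρ := ρ) hG ((p : 𝕜) / 2) hx b
    refine (congrArg₂ (· + ·) e2 e3).trans ?_
    rw [covSpinor_cliff h.smooth hψ.smooth hx, covSpinor_cliff h.smooth_next hψ.smooth hx,
      h.eqn x hx, h.covForm_next hk hp.pos hx, hψ.eqn x hx, map_smul, map_smul, map_smul,
      LinearMap.smul_apply]
  -- All contractions and the terms in `e_b ∧ G` agree on both sides. The difference is `-(p/2)(k +
  -- 4λ²) (e_b ∧ F).ψ`, up to the metric sign of `b`.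
  rw [e1, eF, eG, map_add, map_smul, map_smul, eX, eX]
  linear_combination (norm := module) (-((p : 𝕜) / 2 * sgn 𝕜 η b)) • e

end SpinStructure

end Spinors

/-! ### Global symmetry operators, and currents of Killing spinors. -/

section Brackets

variable {n : ℕ} {𝕜 : Type*} [RCLike 𝕜] {M : Type*} [TopologicalSpace M]
  [ChartedSpace (EuclideanSpace ℝ (Fin n)) M] [IsManifold (𝓡 n) ∞ M]
  {η : Fin n → ℤˣ} {g : PseudoMetric n M} {ι : Type*} {P : SpinStructure η g ι}
  {S : Type*} [NormedAddCommGroup S] [NormedSpace ℝ S] [NormedSpace 𝕜 S] [IsScalarTower ℝ 𝕜 S]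
  {ρ : CliffordAlgebra (quadForm ℝ η) →ₐ[ℝ] Module.End 𝕜 S}

namespace SpinStructure

variable {i : ι} {x : M} {ψ φ : M → S} {lam : 𝕜} {p : ℕ}

lemma spinorIn_cliff (hx : x ∈ P.U i) (X : Lam 𝕜 n) (χ : S) :
    ρ (P.trans i (P.idx x) x) (cliff ρ X χ)
      = cliff ρ (ExteriorAlgebra.map (P.coTrans 𝕜 i (P.idx x) x) X)
        (ρ (P.trans i (P.idx x) x) χ) :=
  ((isFrameChange hx (P.mem_idx x)).cliff_map_apply ρ X χ).symm

lemma spinorIn_symOp {θ : FormField n M 𝕜} (hp : Odd p) (h : P.IsKY p θ) (hx : x ∈ P.U i) :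
    P.spinorIn ρ i (P.symOp ρ lam p θ ψ) x
      = (lam * p) • cliff ρ (P.toFrame i θ x) (P.spinorIn ρ i ψ x)
        + ((p : 𝕜) / 2) • cliff ρ (P.kyNext i p θ x) (P.spinorIn ρ i ψ x) := by
  have hj := P.mem_idx x
  rw [spinorIn, symOp, map_add, map_smul, map_smul, spinorIn_cliff hx, spinorIn_cliff hx,
    ← toFrame_eq hj, ← extD_toFrame h.smooth hx hj, hp.neg_one_pow, kyNext, map_smul,
    LinearMap.smul_apply, smul_smul, spinorIn]
  congr 2
  · ring
  · have := add_one_ne_zero' (𝕜 := 𝕜) p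
    field_simp

lemma symOp_zero_left (p : ℕ) (ψ : M → S) : P.symOp ρ lam p 0 ψ = 0 := by
  funext x
  have h := kyNext_zero (P := P) (𝕜 := 𝕜) (P.idx x) 0 x
  rw [kyNext] at h
  simp only [Nat.cast_zero, zero_add, div_one, one_smul] at h
  rw [symOp, h, toFrame_zero]
  simp

lemma symOp_mem [FiniteDimensional ℝ S] {k : ℝ} (hk : P.HasConstantCurvature k)
    {θ : FormField n M 𝕜} (hp : Odd p) (h : P.IsKY p θ) (hψ : ψ ∈ P.oddPart ρ lam) :
    P.symOp ρ lam p θ ψ ∈ P.oddPart ρ lam :=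
  isKillingSpinor_iff.2 fun i => ((isKillingSpinor_iff.1 hψ i).symmetry hk hp
    (IsKY.isKYPair h i)).congr fun _ hy => spinorIn_symOp hp h hy

lemma evenOdd_mem [FiniteDimensional ℝ S] {k : ℝ} (hk : P.HasConstantCurvature k)
    {θ : ℕ → FormField n M 𝕜} (hθ : θ ∈ P.evenPart 𝕜) (hψ : ψ ∈ P.oddPart ρ lam) :
    P.evenOdd ρ lam θ ψ ∈ P.oddPart ρ lam := by
  refine Submodule.sum_mem _ fun p _ => ?_
  by_cases hp : Odd p
  · exact symOp_mem hk hp (isKY_of_mem hθ p) hψ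
  · rw [(hθ p).2 hp, symOp_zero_left]; exact Submodule.zero_mem _

lemma symOp_add_left {θ θ' : FormField n M 𝕜} (h : P.SmoothForm θ) (h' : P.SmoothForm θ') (p : ℕ)
    (ψ : M → S) : P.symOp ρ lam p (θ + θ') ψ = P.symOp ρ lam p θ ψ + P.symOp ρ lam p θ' ψ := by
  funext x
  simp only [symOp, toFrame_add, Pi.add_apply, map_add, LinearMap.add_apply, smul_add]
  rw [← toFrame_add, P.extD_add h h' _ (P.mem_idx x), map_add, LinearMap.add_apply, smul_add]
  abel

lemma symOp_smul_left (c : 𝕜) {θ : FormField n M 𝕜} (h : P.SmoothForm θ) (p : ℕ)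
    (ψ : M → S) : P.symOp ρ lam p (c • θ) ψ = c • P.symOp ρ lam p θ ψ := by
  funext x
  rw [symOp, P.extD_smul h c _ (P.mem_idx x), toFrame_smul, Pi.smul_apply, Pi.smul_apply, symOp,
    map_smul, map_smul, LinearMap.smul_apply, LinearMap.smul_apply, smul_add, smul_comm c,
    smul_comm c]

lemma symOp_add_right (θ : FormField n M 𝕜) (p : ℕ) (ψ φ : M → S) :
    P.symOp ρ lam p θ (ψ + φ) = P.symOp ρ lam p θ ψ + P.symOp ρ lam p θ φ := by
  funext x
  simp only [symOp, Pi.add_apply, map_add, smul_add]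
  abel

lemma symOp_smul_right (c : 𝕜) (θ : FormField n M 𝕜) (p : ℕ) (ψ : M → S) :
    P.symOp ρ lam p θ (c • ψ) = c • P.symOp ρ lam p θ ψ := by
  funext x
  simp only [symOp, Pi.smul_apply, map_smul, smul_add, smul_comm c]

lemma evenOdd_add_left {θ θ' : ℕ → FormField n M 𝕜} (h : θ ∈ P.evenPart 𝕜)
    (h' : θ' ∈ P.evenPart 𝕜) (ψ : M → S) :
    P.evenOdd ρ lam (θ + θ') ψ = P.evenOdd ρ lam θ ψ + P.evenOdd ρ lam θ' ψ := by
  rw [evenOdd, evenOdd, evenOdd, ← Finset.sum_add_distrib]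
  exact Finset.sum_congr rfl fun p _ =>
    symOp_add_left (isKY_of_mem h p).smooth (isKY_of_mem h' p).smooth p ψ

lemma evenOdd_smul_left (c : 𝕜) {θ : ℕ → FormField n M 𝕜} (h : θ ∈ P.evenPart 𝕜) (ψ : M → S) :
    P.evenOdd ρ lam (c • θ) ψ = c • P.evenOdd ρ lam θ ψ := by
  rw [evenOdd, evenOdd, Finset.smul_sum]
  exact Finset.sum_congr rfl fun p _ => symOp_smul_left c (isKY_of_mem h p).smooth p ψ

lemma evenOdd_add_right (θ : ℕ → FormField n M 𝕜) (ψ φ : M → S) :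
    P.evenOdd ρ lam θ (ψ + φ) = P.evenOdd ρ lam θ ψ + P.evenOdd ρ lam θ φ := by
  simp only [evenOdd, symOp_add_right, Finset.sum_add_distrib]

lemma evenOdd_smul_right (c : 𝕜) (θ : ℕ → FormField n M 𝕜) (ψ : M → S) :
    P.evenOdd ρ lam θ (c • ψ) = c • P.evenOdd ρ lam θ ψ := by
  simp only [evenOdd, symOp_smul_right, Finset.smul_sum]

end SpinStructure

/-! ### Dirac currents -/

variable {σ : 𝕜 →+* 𝕜} (B : SpinorInner ρ σ)

/-- The inhomogeneous Dirac current, as a real bilinear map. -/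
def totalCurrentReal : S →ₗ[ℝ] S →ₗ[ℝ] Lam 𝕜 n :=
  LinearMap.mk₂ ℝ (totalCurrent B) (totalCurrent_add_left B)
    (fun r ψ φ => by
      rw [← algebraMap_smul 𝕜 r ψ, totalCurrent_smul_left]
      change σ (r : 𝕜) • _ = _
      rw [B.map_ofReal]
      exact algebraMap_smul 𝕜 r _)
    (totalCurrent_add_right B)
    (fun r ψ φ => by
      rw [← algebraMap_smul 𝕜 r φ, totalCurrent_smul_right]
      exact algebraMap_smul 𝕜 r _)

namespace SpinStructure

variable [FiniteDimensional ℝ S] {i : ι} {x : M} {ψ φ : M → S} {lam : 𝕜} {p : ℕ}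

lemma SmoothOn.totalCurrent (hψ : P.SmoothOn i ψ) (hφ : P.SmoothOn i φ) :
    P.SmoothOn i (fun y => totalCurrent B (ψ y) (φ y)) := hψ.bilin hφ (totalCurrentReal B)

/-- The connection matrix is real and skew, so the connection terms on the two spinors combine to
the rotation of the current by `totalCurrent_spinRot`. -/
lemma covForm_totalCurrent (hψ : P.SmoothOn i ψ) (hφ : P.SmoothOn i φ) (hx : x ∈ P.U i)
    (a : Fin n) : P.covForm i a (fun y => totalCurrent B (ψ y) (φ y)) x
      = totalCurrent B (P.covSpinor ρ i a ψ x) (φ x)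
        + totalCurrent B (ψ x) (P.covSpinor ρ i a φ x) := by
  have e : P.dirDeriv i a (fun y => SpinGeom.totalCurrent B (ψ y) (φ y)) x
      = SpinGeom.totalCurrent B (P.dirDeriv i a ψ x) (φ x)
        + SpinGeom.totalCurrent B (ψ x) (P.dirDeriv i a φ x) :=
    dirDeriv_bilin hψ hφ hx a (totalCurrentReal B)
  have h1 : ∀ χ χ' ξ : S, SpinGeom.totalCurrent B (χ - χ') ξ
      = SpinGeom.totalCurrent B χ ξ - SpinGeom.totalCurrent B χ' ξ := fun χ χ' ξ =>
    LinearMap.map_sub₂ (totalCurrentReal B) χ χ' ξ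
  have h2 : ∀ χ ξ ξ' : S, SpinGeom.totalCurrent B χ (ξ - ξ')
      = SpinGeom.totalCurrent B χ ξ - SpinGeom.totalCurrent B χ ξ' := fun χ ξ ξ' =>
    map_sub (totalCurrentReal B χ) ξ ξ'
  rw [covForm_eq (hψ.totalCurrent B hφ) hx, covSpinor_eq, covSpinor_eq, e, h1, h2,
    spinRotReal_apply, spinRotReal_apply, rotReal_apply,
    ← (isSkew_connMat (P := P) (𝕜 := 𝕜) i a x).totalCurrent_spinRot B
      fun b c => B.map_ofReal _]
  abel

lemma IsKillingIn.covForm_totalCurrent (hψ : P.IsKillingIn ρ i lam ψ)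
    (hφ : P.IsKillingIn ρ i lam φ) (hx : x ∈ P.U i) (b : Fin n) :
    P.covForm i b (fun y => totalCurrent B (ψ y) (φ y)) x
      = sgn 𝕜 η b • (coE b * (lam • totalCurrent B (ψ x) (φ x)
          + (((B.ε : ℤ) : 𝕜) * σ lam) • hat (totalCurrent B (ψ x) (φ x))))
        + contr b (lam • totalCurrent B (ψ x) (φ x)
          - (((B.ε : ℤ) : 𝕜) * σ lam) • hat (totalCurrent B (ψ x) (φ x))) := by
  have hσ : σ (sgn 𝕜 η b) = sgn 𝕜 η b := by simp [sgn]
  rw [SpinStructure.covForm_totalCurrent B hψ.smooth hφ.smooth hx, hψ.eqn x hx, hφ.eqn x hx,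
    gam_eq ρ b, LinearMap.smul_apply, LinearMap.smul_apply, smul_comm lam, smul_comm lam,
    totalCurrent_smul_left, totalCurrent_smul_right, hσ, ← smul_add, totalCurrent_killing,
    smul_add, smul_smul, sgn_mul_self, one_smul]

/-- The derivative of the `p`-form Dirac current of two Killing spinors. -/
lemma IsKillingIn.covForm_currentLam (hψ : P.IsKillingIn ρ i lam ψ)
    (hφ : P.IsKillingIn ρ i lam φ) (hx : x ∈ P.U i) (b : Fin n) (p : ℕ) :
    P.covForm i b (fun y => currentLam B p (ψ y) (φ y)) x
      = sgn 𝕜 η b • lamProj p (coE b * (lam • totalCurrent B (ψ x) (φ x)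
          + (((B.ε : ℤ) : 𝕜) * σ lam) • hat (totalCurrent B (ψ x) (φ x))))
        + (lam - ((B.ε : ℤ) : 𝕜) * σ lam * (-1) ^ (p + 1)) •
          contr b (currentLam B (p + 1) (ψ x) (φ x)) := by
  have h := covForm_commute (hψ.smooth.totalCurrent B hφ.smooth) hx b (lamProj p)
    fun X => by rw [rotReal_apply, rotReal_apply, lamProj_rot]
  simp only [lamProj_totalCurrent] at h
  rw [h, hψ.covForm_totalCurrent B hφ hx, map_add, map_smul, lamProj_contr, map_sub, map_smul,
    map_smul, lamProj_hat, lamProj_totalCurrent, ← map_smul (contr b), sub_smul, smul_smul]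

lemma currentLam_mem (p : ℕ) (χ ξ : S) : currentLam B p χ ξ ∈ ⋀[𝕜]^p (Fin n → 𝕜) := by
  rw [← lamProj_totalCurrent]; exact lamProj_mem _ _

lemma SmoothOn.currentLam (hψ : P.SmoothOn i ψ) (hφ : P.SmoothOn i φ) (p : ℕ) :
    P.SmoothOn i (fun y => currentLam B p (ψ y) (φ y)) := by
  simp only [← lamProj_totalCurrent]
  exact (hψ.totalCurrent B hφ).lam (lamProj p)

/-- The Dirac currents of odd degree, for `ε σ(λ) = -λ`. -/
lemma IsKillingIn.isKYPair_current (hp : Odd p) (hlam : ((B.ε : ℤ) : 𝕜) * σ lam = -lam)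
    (hψ : P.IsKillingIn ρ i lam ψ) (hφ : P.IsKillingIn ρ i lam φ) :
    P.IsKYPair i p (fun y => currentLam B p (ψ y) (φ y))
      (fun y => (2 * lam) • currentLam B (p + 1) (ψ y) (φ y)) := by
  refine ⟨hψ.smooth.currentLam B hφ.smooth p,
    (hψ.smooth.currentLam B hφ.smooth (p + 1)).lam ((2 * lam) • LinearMap.id),
    fun _ _ => currentLam_mem B _ _ _, fun _ _ => Submodule.smul_mem _ _ (currentLam_mem B _ _ _),
    fun x hx b => ?_⟩
  obtain ⟨p, rfl⟩ : ∃ r, p = r + 1 := ⟨p - 1, by have := hp.pos; omega⟩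
  have hp' : Even p := by
    by_contra h
    exact Nat.not_even_iff_odd.2 hp (Nat.not_even_iff_odd.1 h).add_one
  -- The wedge term involves the current of even degree one below, with coefficient `λ - λ = 0`. The
  -- contraction involves the even degree one above, with coefficient `λ - (-λ) = 2λ`.
  rw [hψ.covForm_currentLam B hφ hx, hlam, lamProj_succ_coE_mul, map_add, map_smul, map_smul,
    lamProj_hat, hp'.neg_one_pow, hp.add_one.neg_one_pow, one_smul, ← add_smul, add_neg_cancel,
    zero_smul, mul_zero, smul_zero, zero_add, map_smul]
  congr 1
  ring

/-- The duals of the Dirac currents, for `ε σ(λ) = -(-1)ᵖ λ`. -/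
lemma IsKillingIn.isKYPair_hodge_current (hp : p ≤ n)
    (hlam : ((B.ε : ℤ) : 𝕜) * σ lam = -(-1) ^ p * lam)
    (hψ : P.IsKillingIn ρ i lam ψ) (hφ : P.IsKillingIn ρ i lam φ) :
    ∃ G, P.IsKYPair i (n - p) (fun y => hodge η (currentLam B p (ψ y) (φ y))) G := by
  have hs := hψ.smooth.currentLam B hφ.smooth
  have e : ∀ x ∈ P.U i, ∀ b, P.covForm i b (fun y => hodge η (currentLam B p (ψ y) (φ y))) x
      = hodge η (sgn 𝕜 η b • lamProj p (coE b * (lam • totalCurrent B (ψ x) (φ x)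
          + (-(-1) ^ p * lam) • hat (totalCurrent B (ψ x) (φ x))))) := fun x hx b => by
    rw [covForm_commute (hs p) hx b (hodge η) fun X => by
      rw [rotReal_apply, rotReal_apply, (isSkew_connMat i b x).rot_hodge],
      hψ.covForm_currentLam B hφ hx, hlam]
    -- Under condition (B) the coefficient of the contraction vanishes, so only the wedge term
    -- remains under the star.
    have : lam - -(-1) ^ p * lam * (-1) ^ (p + 1) = 0 := by
      have h1 : ((-1 : 𝕜) ^ p) * (-1) ^ p = 1 := by rw [← mul_pow]; simp
      rw [pow_succ]
      linear_combination (-lam) * h1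
    rw [this, zero_smul, add_zero]
  cases p with
  | zero =>
    -- In degree 0 there is no wedge term either: the current is a constant function, and its dual
    -- is parallel.
    refine ⟨fun _ => 0, (hs 0).lam (hodge η), smoothOn_const 0,
      fun _ _ => hodge_mem hp (currentLam_mem B _ _ _), fun _ _ => Submodule.zero_mem _,
      fun x hx b => ?_⟩
    rw [e x hx, lamProj_zero_coE_mul, smul_zero, map_zero, map_zero]
  | succ p =>
    -- The wedge coefficient is `2λ`, and `hodge_coE_mul` rewrites `⋆(e_b ∧ X)` as the contraction
    -- of `⋆ hat X`. So the next form is obtained from the current of degree one lower.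
    let L : Lam 𝕜 n →ₗ[𝕜] Lam 𝕜 n := hodge η ∘ₗ hat.toLinearMap ∘ₗ ((2 * lam) • LinearMap.id)
    have hL : ∀ X, L X = hodge η (hat ((2 * lam) • X)) := fun X => rfl
    refine ⟨fun y => L (currentLam B p (ψ y) (φ y)), (hs (p + 1)).lam (hodge η), (hs p).lam L,
      fun _ _ => hodge_mem hp (currentLam_mem B _ _ _), fun x _ => ?_, fun x hx b => ?_⟩
    · rw [hL, show n - (p + 1) + 1 = n - p by omega, hat_of_degree (Submodule.smul_mem _ _
        (currentLam_mem B p _ _))]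
      exact hodge_mem (by omega) (Submodule.smul_mem _ _ (Submodule.smul_mem _ _
        (currentLam_mem B _ _ _)))
    · rw [hL, e x hx, lamProj_succ_coE_mul, map_smul, hodge_coE_mul, smul_smul, sgn_mul_self, one_smul,
        map_add, map_smul, map_smul, lamProj_hat, lamProj_totalCurrent, smul_smul, ← add_smul]
      congr 5
      have h1 : ((-1 : 𝕜) ^ p) * (-1) ^ p = 1 := by rw [← mul_pow]; simp
      rw [pow_succ]
      linear_combination lam * h1

lemma toFrame_diracCurrent (hx : x ∈ P.U i) (p : ℕ) (ψ φ : M → S) :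
    P.toFrame i (P.diracCurrent B p ψ φ) x
      = currentLam B p (P.spinorIn ρ i ψ x) (P.spinorIn ρ i φ x) := by
  have hj := P.mem_idx x
  rw [toFrame_idx hj (F := currentLam B p (ψ x) (φ x)) rfl, ← lamProj_totalCurrent, ← lamProj_map,
    ← lamProj_totalCurrent]
  congr 1
  exact ((isFrameChange hx hj).totalCurrent_apply B (ψ x) (φ x)).symm

lemma toFrame_star (hx : x ∈ P.U i) (θ : FormField n M 𝕜) :
    P.toFrame i (P.star θ) x = hodge η (P.toFrame i θ x) := by
  have hj := P.mem_idx x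
  have hf := isFrameChange hx hj
  rw [toFrame_idx hj (F := hodge η (P.toFrame (P.idx x) θ x)) rfl, toFrame_eq hj i θ]
  exact (IsIsom.hodge_map hf.isIsom hf.map_vol _).symm

lemma diracCurrent_mem (hp : Odd p) (hlam : ((B.ε : ℤ) : 𝕜) * σ lam = -lam)
    (hψ : ψ ∈ P.oddPart ρ lam) (hφ : φ ∈ P.oddPart ρ lam) :
    P.diracCurrent B p ψ φ ∈ P.KY 𝕜 p :=
  isKY_of_isKYPair (fun _ => map_mem_degree _ (currentLam_mem B _ _ _)) fun i =>
    ⟨_, ((isKillingSpinor_iff.1 hψ i).isKYPair_current B hp hlam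
      (isKillingSpinor_iff.1 hφ i)).congr fun _ hy => toFrame_diracCurrent B hy p ψ φ⟩

lemma star_diracCurrent_mem (hp : p ≤ n) (hlam : ((B.ε : ℤ) : 𝕜) * σ lam = -(-1) ^ p * lam)
    (hψ : ψ ∈ P.oddPart ρ lam) (hφ : φ ∈ P.oddPart ρ lam) :
    P.star (P.diracCurrent B p ψ φ) ∈ P.KY 𝕜 (n - p) := by
  refine isKY_of_isKYPair (fun x => ?_) fun i => ?_
  · refine map_mem_degree _ ?_
    rw [toFrame_diracCurrent B (P.mem_idx x)]
    exact hodge_mem hp (currentLam_mem B _ _ _)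
  · obtain ⟨G, hG⟩ := (isKillingSpinor_iff.1 hψ i).isKYPair_hodge_current B hp hlam
      (isKillingSpinor_iff.1 hφ i)
    exact ⟨G, hG.congr fun _ hy => by rw [toFrame_star hy, toFrame_diracCurrent B hy]⟩

end SpinStructure

end Brackets

/-! ### Assembly of the brackets into a superalgebra. -/

section Superalgebra

/-- A superalgebra from its four brackets. -/
lemma isSuperalgebra_of {R : Type*} [CommRing R] {V₀ V₁ : Type*} [AddCommGroup V₀] [Module R V₀]
    [AddCommGroup V₁] [Module R V₁] {g₀ : Submodule R V₀} {g₁ : Submodule R V₁}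
    {ee : V₀ → V₀ → V₀} {eo : V₀ → V₁ → V₁} {oo : V₁ → V₁ → V₀}
    (ee_mem : ∀ a ∈ g₀, ∀ b ∈ g₀, ee a b ∈ g₀)
    (ee_add : ∀ a ∈ g₀, ∀ b ∈ g₀, ∀ c ∈ g₀, ee a (b + c) = ee a b + ee a c)
    (ee_smul : ∀ (r : R), ∀ a ∈ g₀, ∀ b ∈ g₀, ee a (r • b) = r • ee a b)
    (ee_skew : ∀ a ∈ g₀, ∀ b ∈ g₀, ee a b = -ee b a)
    (eo_mem : ∀ a ∈ g₀, ∀ b ∈ g₁, eo a b ∈ g₁)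
    (eo_add_left : ∀ a ∈ g₀, ∀ b ∈ g₀, ∀ c ∈ g₁, eo (a + b) c = eo a c + eo b c)
    (eo_smul_left : ∀ (r : R), ∀ a ∈ g₀, ∀ b ∈ g₁, eo (r • a) b = r • eo a b)
    (eo_add_right : ∀ a ∈ g₀, ∀ b ∈ g₁, ∀ c ∈ g₁, eo a (b + c) = eo a b + eo a c)
    (eo_smul_right : ∀ (r : R), ∀ a ∈ g₀, ∀ b ∈ g₁, eo a (r • b) = r • eo a b)
    (oo_mem : ∀ a ∈ g₁, ∀ b ∈ g₁, oo a b ∈ g₀)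
    (oo_add : ∀ a ∈ g₁, ∀ b ∈ g₁, ∀ c ∈ g₁, oo a (b + c) = oo a b + oo a c)
    (oo_smul : ∀ (r : R), ∀ a ∈ g₁, ∀ b ∈ g₁, oo a (r • b) = r • oo a b)
    (oo_symm : ∀ a ∈ g₁, ∀ b ∈ g₁, oo a b = oo b a) :
    IsSuperalgebra R g₀ g₁
      (fun a b => (ee a.1 b.1 + oo a.2 b.2, eo a.1 b.2 - eo b.1 a.2)) := by
  have ee0 : ∀ a ∈ g₀, ee a 0 = 0 := fun a ha => by
    simpa using ee_smul 0 a ha 0 g₀.zero_mem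
  have ee0' : ∀ a ∈ g₀, ee 0 a = 0 := fun a ha => by
    rw [ee_skew 0 g₀.zero_mem a ha, ee0 a ha, neg_zero]
  have oo0 : ∀ a ∈ g₁, oo a 0 = 0 := fun a ha => by
    simpa using oo_smul 0 a ha 0 g₁.zero_mem
  have oo0' : ∀ a ∈ g₁, oo 0 a = 0 := fun a ha => by
    rw [oo_symm 0 g₁.zero_mem a ha, oo0 a ha]
  have eo0 : ∀ a ∈ g₀, eo a 0 = 0 := fun a ha => by
    simpa using eo_smul_right 0 a ha 0 g₁.zero_mem
  have eo0' : ∀ a ∈ g₁, eo 0 a = 0 := fun a ha => by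
    simpa using eo_smul_left 0 0 g₀.zero_mem a ha
  have h0 := g₀.zero_mem
  have h1 := g₁.zero_mem
  have ee_add_left : ∀ a ∈ g₀, ∀ b ∈ g₀, ∀ c ∈ g₀, ee (a + b) c = ee a c + ee b c :=
    fun a ha b hb c hc => by
      rw [ee_skew _ (add_mem ha hb) c hc, ee_add c hc a ha b hb, ee_skew c hc a ha,
        ee_skew c hc b hb, neg_add, neg_neg, neg_neg]
  have ee_smul_left : ∀ (r : R), ∀ a ∈ g₀, ∀ b ∈ g₀, ee (r • a) b = r • ee a b :=
    fun r a ha b hb => by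
      rw [ee_skew _ (g₀.smul_mem r ha) b hb, ee_smul r b hb a ha, ee_skew b hb a ha, smul_neg,
        neg_neg]
  have oo_add_left : ∀ a ∈ g₁, ∀ b ∈ g₁, ∀ c ∈ g₁, oo (a + b) c = oo a c + oo b c :=
    fun a ha b hb c hc => by
      rw [oo_symm _ (add_mem ha hb) c hc, oo_add c hc a ha b hb, oo_symm c hc a ha,
        oo_symm c hc b hb]
  have oo_smul_left : ∀ (r : R), ∀ a ∈ g₁, ∀ b ∈ g₁, oo (r • a) b = r • oo a b :=
    fun r a ha b hb => by
      rw [oo_symm _ (g₁.smul_mem r ha) b hb, oo_smul r b hb a ha, oo_symm b hb a ha]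
  refine ⟨?_, ?_, ?_, ?_, ?_, ?_, ?_, ?_, ?_, ?_, ?_⟩
  · rintro a ⟨ha, ha'⟩ b ⟨hb, hb'⟩ c ⟨hc, hc'⟩
    ext1
    · simp only [Prod.fst_add, Prod.snd_add, ee_add_left _ ha _ hb _ hc, oo_add_left _ ha' _ hb' _ hc']
      abel
    · simp only [Prod.fst_add, Prod.snd_add, eo_add_left _ ha _ hb _ hc', eo_add_right _ hc _ ha' _ hb']
      abel
  · rintro a ⟨ha, ha'⟩ b ⟨hb, hb'⟩ c ⟨hc, hc'⟩
    ext1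
    · simp only [Prod.fst_add, Prod.snd_add, ee_add _ ha _ hb _ hc, oo_add _ ha' _ hb' _ hc']
      abel
    · simp only [Prod.fst_add, Prod.snd_add, eo_add_left _ hb _ hc _ ha', eo_add_right _ ha _ hb' _ hc']
      abel
  · rintro r a ⟨ha, ha'⟩ b ⟨hb, hb'⟩
    ext1
    · simp only [Prod.smul_fst, Prod.smul_snd, ee_smul_left r _ ha _ hb, oo_smul_left r _ ha' _ hb',
        smul_add]
    · simp only [Prod.smul_fst, Prod.smul_snd, eo_smul_left r _ ha _ hb', eo_smul_right r _ hb _ ha',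
        smul_sub]
  · rintro r a ⟨ha, ha'⟩ b ⟨hb, hb'⟩
    ext1
    · simp only [Prod.smul_fst, Prod.smul_snd, ee_smul r _ ha _ hb, oo_smul r _ ha' _ hb', smul_add]
    · simp only [Prod.smul_fst, Prod.smul_snd, eo_smul_left r _ hb _ ha', eo_smul_right r _ ha _ hb',
        smul_sub]
  · intro a ha b hb
    refine ⟨?_, ?_⟩
    · simpa only [oo0 0 h1, add_zero, SetLike.mem_coe] using ee_mem a ha b hb
    · simp [eo0 a ha, eo0 b hb]
  · intro a ha b hb
    refine ⟨?_, ?_⟩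
    · simp [ee0 a ha, oo0' b hb]
    · simpa only [eo0 0 h0, sub_zero, SetLike.mem_coe] using eo_mem a ha b hb
  · intro a ha b hb
    refine ⟨?_, ?_⟩
    · simp [ee0' b hb, oo0 a ha]
    · simpa only [eo0 0 h0, zero_sub, SetLike.mem_coe] using neg_mem (eo_mem b hb a ha)
  · intro a ha b hb
    refine ⟨?_, ?_⟩
    · simpa only [ee0 0 h0, zero_add, SetLike.mem_coe] using oo_mem a ha b hb
    · simp [eo0' a ha, eo0' b hb]
  · intro a ha b hb
    ext1
    · simp [oo0 0 h1, ee_skew a ha b hb]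
    · simp [eo0 a ha, eo0 b hb]
  · intro a ha b hb
    ext1
    · simp [ee0 a ha, ee0' a ha, oo0 b hb, oo0' b hb]
    · simp
  · intro a ha b hb
    ext1
    · simp [oo_symm a ha b hb]
    · simp [eo0' a ha, eo0' b hb]

variable {n : ℕ} {𝕜 : Type*} [RCLike 𝕜] {M : Type*} [TopologicalSpace M]
  [ChartedSpace (EuclideanSpace ℝ (Fin n)) M] [IsManifold (𝓡 n) ∞ M]
  {η : Fin n → ℤˣ} {g : PseudoMetric n M} {ι : Type*} {P : SpinStructure η g ι}
  {S : Type*} [NormedAddCommGroup S] [NormedSpace ℝ S] [NormedSpace 𝕜 S] [IsScalarTower ℝ 𝕜 S]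
  {ρ : CliffordAlgebra (quadForm ℝ η) →ₐ[ℝ] Module.End 𝕜 S} {σ : 𝕜 →+* 𝕜}

namespace SpinStructure

variable {lam : 𝕜} {q : ℕ}

lemma single_mem_evenPart (hq : Odd q) {θ : FormField n M 𝕜} (h : θ ∈ P.KY 𝕜 q) :
    (Pi.single q θ : ℕ → FormField n M 𝕜) ∈ P.evenPart 𝕜 := fun p => by
  by_cases hp : p = q
  · subst hp
    exact ⟨fun _ => by rwa [Pi.single_eq_same], fun h' => absurd hq h'⟩
  · rw [Pi.single_eq_of_ne hp]
    exact ⟨fun _ => Submodule.zero_mem _, fun _ => rfl⟩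

/-- The odd-odd brackets: a sesquilinear pairing of Killing spinors with values in KY forms. -/
lemma isOddOddBracket_of [FiniteDimensional ℝ S] {k : ℝ} (hk : P.HasConstantCurvature k)
    (B : SpinorInner ρ σ) (hq : Odd q) (κ : ℤˣ) {J : (M → S) → (M → S) → FormField n M 𝕜}
    (mem : ∀ ψ ∈ P.oddPart ρ lam, ∀ φ ∈ P.oddPart ρ lam, J ψ φ ∈ P.KY 𝕜 q)
    (add_left : ∀ ψ ψ' φ, J (ψ + ψ') φ = J ψ φ + J ψ' φ)
    (add_right : ∀ ψ φ φ', J ψ (φ + φ') = J ψ φ + J ψ φ')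
    (smul_left : ∀ (c : 𝕜) ψ φ, J (c • ψ) φ = σ c • J ψ φ)
    (smul_right : ∀ (c : 𝕜) ψ φ, J ψ (c • φ) = c • J ψ φ)
    (exchange : σ = RingHom.id 𝕜 → ∀ ψ φ, J φ ψ = ((κ : ℤ) : 𝕜) • J ψ φ) :
    IsOddOddBracket P ρ σ lam q κ J := by
  have hL := isLieAlgebraOn_evenPart (𝕜 := 𝕜) hk
  have hF : ∀ (r : ℝ) (θ : ℕ → FormField n M 𝕜), r • θ = (r : 𝕜) • θ := fun r θ =>
    (algebraMap_smul 𝕜 r θ).symm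
  have hS : ∀ (r : ℝ) (ψ : M → S), r • ψ = (r : 𝕜) • ψ := fun r ψ =>
    (algebraMap_smul 𝕜 r ψ).symm
  have mem' : ∀ ψ ∈ P.oddPart ρ lam, ∀ φ ∈ P.oddPart ρ lam, polarized J ψ φ ∈ P.KY 𝕜 q :=
    fun ψ hψ φ hφ => Submodule.smul_mem _ _ (add_mem (mem ψ hψ φ hφ) (mem φ hφ ψ hψ))
  refine ⟨mem, ?_, fun hσ ψ _ φ _ => exchange hσ ψ φ, fun hσ hκ => ?_⟩
  · refine isSuperalgebra_of (R := ℝ) (ee := P.evenEven) (eo := P.evenOdd ρ lam)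
      (oo := fun ψ φ => Pi.single q (polarized J ψ φ)) hL.closed hL.add_right
      (fun r a ha b hb => by rw [hF, hF, hL.smul_right (r : 𝕜) a ha b hb]) hL.skew
      (fun a ha b hb => evenOdd_mem hk ha hb) (fun a ha b hb c _ => evenOdd_add_left ha hb c)
      (fun r a ha b _ => by rw [hF, hS, evenOdd_smul_left (r : 𝕜) ha b])
      (fun a _ b _ c _ => evenOdd_add_right a b c)
      (fun r a _ b _ => by rw [hS, hS, evenOdd_smul_right (r : 𝕜) a b])
      (fun a ha b hb => single_mem_evenPart hq (mem' a ha b hb))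
      (fun a _ b _ c _ => ?_) (fun r a _ b _ => ?_) fun a _ b _ => ?_
    · rw [← Pi.single_add]
      congr 1
      simp only [polarized, add_left, add_right, ← smul_add]
      congr 1
      abel
    -- Polarization mixes a linear with a `σ`-linear slot. It is homogeneous for real scalars
    -- because these are fixed by `σ`, which is why the superalgebra is over `ℝ`.
    · rw [hS, hF, ← Pi.single_smul]
      congr 1
      simp only [polarized, smul_left, smul_right, B.map_ofReal, ← smul_add, smul_comm (r : 𝕜)]
    · rw [polarized, polarized, add_comm]
  · have symm : ∀ ψ φ, J φ ψ = J ψ φ := fun ψ φ => by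
      rw [exchange hσ ψ φ, hκ]; simp
    exact isSuperalgebra_of (R := 𝕜) (ee := P.evenEven) (eo := P.evenOdd ρ lam)
      (oo := fun ψ φ => Pi.single q (J ψ φ)) hL.closed hL.add_right hL.smul_right hL.skew
      (fun a ha b hb => evenOdd_mem hk ha hb) (fun a ha b hb c _ => evenOdd_add_left ha hb c)
      (fun r a ha b _ => evenOdd_smul_left r ha b)
      (fun a _ b _ c _ => evenOdd_add_right a b c) (fun r a _ b _ => evenOdd_smul_right r a b)
      (fun a ha b hb => single_mem_evenPart hq (mem a ha b hb))
      (fun a _ b _ c _ => by rw [add_right, Pi.single_add])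
      (fun r a _ b _ => by rw [smul_right, Pi.single_smul])
      (fun a _ b _ => by rw [symm])

variable (B : SpinorInner ρ σ) (p : ℕ)

lemma currentLam_add_left (ψ ψ' φ : S) :
    currentLam B p (ψ + ψ') φ = currentLam B p ψ φ + currentLam B p ψ' φ := by
  simp only [← lamProj_totalCurrent, totalCurrent_add_left, map_add]

lemma currentLam_add_right (ψ φ φ' : S) :
    currentLam B p ψ (φ + φ') = currentLam B p ψ φ + currentLam B p ψ φ' := by
  simp only [← lamProj_totalCurrent, totalCurrent_add_right, map_add]

lemma currentLam_smul_left (c : 𝕜) (ψ φ : S) :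
    currentLam B p (c • ψ) φ = σ c • currentLam B p ψ φ := by
  simp only [← lamProj_totalCurrent, totalCurrent_smul_left, map_smul]

lemma currentLam_smul_right (c : 𝕜) (ψ φ : S) :
    currentLam B p ψ (c • φ) = c • currentLam B p ψ φ := by
  simp only [← lamProj_totalCurrent, totalCurrent_smul_right, map_smul]

lemma diracCurrent_add_left (ψ ψ' φ : M → S) :
    P.diracCurrent B p (ψ + ψ') φ = P.diracCurrent B p ψ φ + P.diracCurrent B p ψ' φ := by
  funext x; simp only [diracCurrent, ofFrame, Pi.add_apply, currentLam_add_left, map_add]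

lemma diracCurrent_add_right (ψ φ φ' : M → S) :
    P.diracCurrent B p ψ (φ + φ') = P.diracCurrent B p ψ φ + P.diracCurrent B p ψ φ' := by
  funext x; simp only [diracCurrent, ofFrame, Pi.add_apply, currentLam_add_right, map_add]

lemma diracCurrent_smul_left (c : 𝕜) (ψ φ : M → S) :
    P.diracCurrent B p (c • ψ) φ = σ c • P.diracCurrent B p ψ φ := by
  funext x; simp only [diracCurrent, ofFrame, Pi.smul_apply, currentLam_smul_left, map_smul]

lemma diracCurrent_smul_right (c : 𝕜) (ψ φ : M → S) :
    P.diracCurrent B p ψ (c • φ) = c • P.diracCurrent B p ψ φ := by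
  funext x; simp only [diracCurrent, ofFrame, Pi.smul_apply, currentLam_smul_right, map_smul]

lemma diracCurrent_exchange (hσ : σ = RingHom.id 𝕜) (ψ φ : M → S) :
    P.diracCurrent B p φ ψ = ((B.exchangeSign p : ℤ) : 𝕜) • P.diracCurrent B p ψ φ := by
  funext x
  simp only [diracCurrent, ofFrame, Pi.smul_apply, ← map_smul]
  rw [currentLam_exchange B hσ]

lemma star_add (θ θ' : FormField n M 𝕜) : P.star (θ + θ') = P.star θ + P.star θ' := by
  funext x; simp only [star, ofFrame, toFrame_add, Pi.add_apply, map_add]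

lemma star_smul (c : 𝕜) (θ : FormField n M 𝕜) : P.star (c • θ) = c • P.star θ := by
  funext x; simp only [star, ofFrame, toFrame_smul, Pi.smul_apply, map_smul]

end SpinStructure

end Superalgebra

end SpinGeom

end

theorem mainTheorem1 {n : ℕ} {M : Type*} [TopologicalSpace M]
    [ChartedSpace (EuclideanSpace ℝ (Fin n)) M] [IsManifold (𝓡 n) ∞ M]
    {η : Fin n → ℤˣ} {g : SpinGeom.PseudoMetric n M} {ι : Type*}
    (P : SpinGeom.SpinStructure η g ι) (k : ℝ) (hk : P.HasConstantCurvature k)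
    {𝕜 : Type*} [RCLike 𝕜]
    {S : Type*} [NormedAddCommGroup S] [NormedSpace ℝ S] [NormedSpace 𝕜 S] [IsScalarTower ℝ 𝕜 S]
    [FiniteDimensional 𝕜 S]
    (ρ : CliffordAlgebra (SpinGeom.quadForm ℝ η) →ₐ[ℝ] Module.End 𝕜 S)
    {σ : 𝕜 →+* 𝕜} (B : SpinGeom.SpinorInner ρ σ) (lam : 𝕜) :
    SpinGeom.IsLieAlgebraOn 𝕜 (P.evenPart 𝕜) P.evenEven ∧
    (∀ θ ∈ P.evenPart 𝕜, ∀ ψ ∈ P.oddPart ρ lam, P.evenOdd ρ lam θ ψ ∈ P.oddPart ρ lam) ∧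
    (∀ p : ℕ, Odd p → ((B.ε : ℤ) : 𝕜) * σ lam = -lam →
      SpinGeom.IsOddOddBracket P ρ σ lam p (B.exchangeSign p)
        (fun ψ φ ↦ P.diracCurrent B p ψ φ)) ∧
    (∀ p : ℕ, p ≤ n → Odd (n - p) → ((B.ε : ℤ) : 𝕜) * σ lam = -(-1) ^ p * lam →
      SpinGeom.IsOddOddBracket P ρ σ lam (n - p) (B.exchangeSign p)
        (fun ψ φ ↦ P.star (P.diracCurrent B p ψ φ))) := by
  -- The calculus lemmas treat spinor fields as maps into a real finite-dimensional space.
  have : FiniteDimensional ℝ S := Module.Finite.trans 𝕜 S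
  refine ⟨SpinGeom.SpinStructure.isLieAlgebraOn_evenPart hk,
    fun θ hθ ψ hψ => SpinGeom.SpinStructure.evenOdd_mem hk hθ hψ, fun p hp hlam => ?_,
    fun p hp hpn hlam => ?_⟩
  · exact SpinGeom.SpinStructure.isOddOddBracket_of hk B hp _
      (fun ψ hψ φ hφ => SpinGeom.SpinStructure.diracCurrent_mem B hp hlam hψ hφ)
      (SpinGeom.SpinStructure.diracCurrent_add_left B p)
      (SpinGeom.SpinStructure.diracCurrent_add_right B p)
      (SpinGeom.SpinStructure.diracCurrent_smul_left B p)
      (SpinGeom.SpinStructure.diracCurrent_smul_right B p)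
      (SpinGeom.SpinStructure.diracCurrent_exchange B p)
  · exact SpinGeom.SpinStructure.isOddOddBracket_of hk B hpn _
      (fun ψ hψ φ hφ => SpinGeom.SpinStructure.star_diracCurrent_mem B hp hlam hψ hφ)
      (fun ψ ψ' φ => by
        rw [SpinGeom.SpinStructure.diracCurrent_add_left, SpinGeom.SpinStructure.star_add])
      (fun ψ φ φ' => by
        rw [SpinGeom.SpinStructure.diracCurrent_add_right, SpinGeom.SpinStructure.star_add])
      (fun c ψ φ => by
        rw [SpinGeom.SpinStructure.diracCurrent_smul_left, SpinGeom.SpinStructure.star_smul])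
      (fun c ψ φ => by
        rw [SpinGeom.SpinStructure.diracCurrent_smul_right, SpinGeom.SpinStructure.star_smul])
      (fun hσ ψ φ => by
        rw [SpinGeom.SpinStructure.diracCurrent_exchange B p hσ, SpinGeom.SpinStructure.star_smul])
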